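/- **Setting.** For each $n\in\mathbb N$ let $p=p_n\in\mathbb N$ and let $(\tilde T,U,\{Z(t)\})$ be a triple (whose law may depend on $n$) of a failure time $\tilde T\ge 0$, a censoring time $U\ge 0$ and an $\mathbb R^p$-valued covariate process. Put $T:=\min(\tilde T,U)$ with distribution function $F_T$, $\delta:=\mathbf 1\{\tilde T\le U\}$, $t_+:=\inf\{t\ge0:F_T(t)=1\}\in[0,\infty]$, and let the time index set be $\mathcal T:=[0,t_+]$ if $t_+<\infty$, $\mathcal T:=[0,\infty)$ otherwise. Write $N(t):=\mathbf 1\{T\le t,\delta=1\}$, $Y(t):=\mathbf 1\{T\ge t\}$. Assume the Cox model: given $\mathcal Z:=\{Z(t):t\in\mathcal T\}$, the times $\tilde T$ and $U$ are independent and $\tilde T$ has hazard function $t\mapsto\lambda_0(t)\exp\{\beta^{o\top}Z(t)\}$ on $\mathcal T$, that is, $\mathbb P(\tilde T>t\mid\mathcal Z)=\exp\bigl(-\int_0^t\lambda_0(s)e^{\beta^{o\top}Z(s)}\,ds\bigr)$ almost surely for each $t\in\mathcal T$, for some measurable $\lambda_0\ge0$ and $\beta^o\in\mathbb R^p$ (both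 may depend on $n$). Let $(\tilde T_i,U_i,\{Z_i(t)\})$, $i=1,\dots,n$, be independent copies of the triple, with corresponding $T_i,\delta_i,N_i,Y_i$, and let $$\ell(\beta):=\frac1n\sum_{i=1}^n\int_{\mathcal T}\beta^\top Z_i(s)\,dN_i(s)-\frac1n\sum_{i=1}^n\int_{\mathcal T}\log\Bigl[\sum_{j=1}^nY_j(s)e^{\beta^\top Z_j(s)}\Bigr]dN_i(s)$$ be the log-partial likelihood divided by $n$, and $\dot\ell$ its gradient. Let $$\mu(t):=\frac{\mathbb E\{Z(t)Y(t)e^{\beta^{o\top}Z(t)}\}}{\mathbb E\{Y(t)e^{\beta^{o\top}Z(t)}\}},\qquad \Sigma:=\mathbb E\int_{\mathcal T}\{Z(s)-\mu(s)\}\{Z(s)-\mu(s)\}^\top\,dN(s).$$ **Assumptions.** (A1) (a) $\{Z(t):t\in\mathcal T\}$ is predictable (for the filtration generated by $N$, $Y$ and $Z$), and there is a constant $K_Z>0$, not depending on $n$, with $\mathbb P\{\|Z(t)\|_\infty\le K_Z\}=1$ for all $t\in\mathcal T$; (b) for each $n$ there is a deterministic $L>0$ such that, almost surely, $\|Z(s)-Z(t)\|_\infty\le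 L|s-t|$ for all $s,t\in\mathcal T$. (A2) For each $n$: (a) $T$ has a bounded density $f_T$ with respect to Lebesgue measure; (b) $\int_0^{t_+}t^\alpha f_T(t)\,dt<\infty$ for some $\alpha>0$. (A3)(a) $p_n=o(e^{n^a})$ for every $a>0$. (A4)(c) With $d_o:=|\{j:\beta^o_j\ne0\}|$, $r_j:=|\{i:(\Sigma^{-1})_{ij}\ne0\}|$ and $\|A\|_{\mathrm{op},1}:=\sup_{v\ne0}\|Av\|_1/\|v\|_1$, there is $\delta_0>0$ such that $$\|\Sigma^{-1}\|_{\mathrm{op},1}^2\max\Bigl\{\frac{d_o\log(np)}{n^{1/2}},\,n^{-(1/3-\delta_0)}\Bigr\}\max_{1\le j\le p}r_j=o\Bigl(\frac1{\log^{1/2}(np)}\Bigr).$$ Moreover $\|\beta^o\|_1=o(\log n)$ (in particular, $\|\beta^o\|_1$ may be bounded in $n$). **Proposition 1.** Under these assumptions, let $c=c_n\in\mathbb R^p$ satisfy $\|c\|_1=1$ and $c^\top\Sigma^{-1}c\to\nu^2\in(0,\infty)$ as $n\to\infty$. Then $$n^{1/2}c^\top\Sigma^{-1}\dot\ell(\beta^o)\xrightarrow{d}\mathcal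 N(0,\nu^2)\qquad(n\to\infty).$$ -/

import Mathlib

open MeasureTheory ProbabilityTheory Filter Topology Asymptotics
open scoped NNReal ENNReal Matrix

noncomputable section

/-- The `ℓ₁` norm of a vector. -/
def l1Norm {p : ℕ} (v : Fin p → ℝ) : ℝ := ∑ j, |v j|

/-- The operator norm of a square matrix induced by the `ℓ₁` norm. -/
def opOneNorm {p : ℕ} (A : Matrix (Fin p) (Fin p) ℝ) : ℝ :=
  ⨆ v : {v : Fin p → ℝ // v ≠ 0}, l1Norm (A *ᵥ v.1) / l1Norm v.1

/-- The largest number of non-zero entries in a column of a square matrix. -/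
def maxColumnSupport {p : ℕ} (A : Matrix (Fin p) (Fin p) ℝ) : ℕ :=
  Finset.univ.sup fun j => (Finset.univ.filter fun i => A i j ≠ 0).card

/-- The number of non-zero coordinates of a vector. -/
def supportSize {p : ℕ} (v : Fin p → ℝ) : ℕ := (Finset.univ.filter fun j => v j ≠ 0).card

/-- `exp (-x)` for `x ∈ [0, ∞]`, with `exp (-∞) = 0`. -/
def expNeg (x : ℝ≥0∞) : ℝ := if x = ∞ then 0 else Real.exp (-x.toReal)

/-- A triple consisting of a failure time, a censoring time and a `p`-variate covariate process.
Only the values of the covariate process on the time index set (`timeSet` below) are ever used. -/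
structure SurvivalTriple (Ω : Type*) [MeasurableSpace Ω] (p : ℕ) where
  failure : Ω → ℝ
  censoring : Ω → ℝ
  Z : ℝ → Ω → Fin p → ℝ
  measurable_failure : Measurable failure
  measurable_censoring : Measurable censoring
  measurable_Z : ∀ t, Measurable (Z t)
  failure_nonneg : ∀ ω, 0 ≤ failure ω
  censoring_nonneg : ∀ ω, 0 ≤ censoring ω

namespace SurvivalTriple

variable {Ω : Type*} [mΩ : MeasurableSpace Ω] {p : ℕ}

/-- The observed time `T`, the minimum of the failure time and the censoring time. -/
def T (X : SurvivalTriple Ω p) (ω : Ω) : ℝ := min (X.failure ω) (X.censoring ω)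

/-- The counting process `N(t) = 1{T ≤ t, δ = 1}`, where `δ = 1` means failure ≤ censoring. -/
def N (X : SurvivalTriple Ω p) (t : ℝ) (ω : Ω) : ℝ :=
  if X.T ω ≤ t ∧ X.failure ω ≤ X.censoring ω then 1 else 0

/-- The at-risk process `Y(t) = 1{T ≥ t}`. -/
def Y (X : SurvivalTriple Ω p) (t : ℝ) (ω : Ω) : ℝ := if t ≤ X.T ω then 1 else 0

/-- The measure `dN(·)(ω)` whose distribution function is `t ↦ N(t)(ω)`. -/
def dN (X : SurvivalTriple Ω p) (ω : Ω) : Measure ℝ :=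
  if X.failure ω ≤ X.censoring ω then Measure.dirac (X.T ω) else 0

/-- `t₊ = inf {t ≥ 0 : F_T(t) = 1}`, which is `∞` if there is no such `t`. -/
def tPlus (X : SurvivalTriple Ω p) (P : Measure Ω) : EReal :=
  sInf ((fun t : ℝ => (t : EReal)) '' {t : ℝ | 0 ≤ t ∧ cdf (P.map X.T) t = 1})

/-- The time index set: `[0, t₊]` if `t₊ < ∞` and `[0, ∞)` otherwise. -/
def timeSet (X : SurvivalTriple Ω p) (P : Measure Ω) : Set ℝ :=
  {t | 0 ≤ t ∧ (t : EReal) ≤ X.tPlus P}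

theorem measurable_T (X : SurvivalTriple Ω p) : Measurable X.T :=
  X.measurable_failure.min X.measurable_censoring

theorem measurable_N (X : SurvivalTriple Ω p) (t : ℝ) : Measurable (X.N t) :=
  Measurable.ite ((measurableSet_le X.measurable_T measurable_const).inter
    (measurableSet_le X.measurable_failure X.measurable_censoring))
    measurable_const measurable_const

theorem measurable_Y (X : SurvivalTriple Ω p) (t : ℝ) : Measurable (X.Y t) :=
  Measurable.ite (measurableSet_le measurable_const X.measurable_T)
    measurable_const measurable_const

/-- The natural filtration generated by `N`, `Y` and the covariate process. -/
def naturalFiltration (X : SurvivalTriple Ω p) (P : Measure Ω) : Filtration ℝ≥0 mΩ where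
  seq t := ⨆ s : {s : ℝ // s ∈ X.timeSet P ∧ s ≤ t},
    MeasurableSpace.comap (X.N s) inferInstance ⊔ MeasurableSpace.comap (X.Y s) inferInstance ⊔
      MeasurableSpace.comap (X.Z s) inferInstance
  mono' _ u htu := iSup_le fun s => le_iSup_of_le
    (f := fun s : {s : ℝ // s ∈ X.timeSet P ∧ s ≤ u} =>
      MeasurableSpace.comap (X.N s) inferInstance ⊔ MeasurableSpace.comap (X.Y s) inferInstance ⊔
        MeasurableSpace.comap (X.Z s) inferInstance)
    ⟨s.1, s.2.1, s.2.2.trans (NNReal.coe_le_coe.2 htu)⟩ le_rfl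
  le' _ := iSup_le fun s => sup_le
    (sup_le (X.measurable_N s).comap_le (X.measurable_Y s).comap_le) (X.measurable_Z s).comap_le

/-- The σ-algebra generated by the whole covariate process. -/
abbrev covariateSigma (X : SurvivalTriple Ω p) (P : Measure Ω) : MeasurableSpace Ω :=
  ⨆ t : {t : ℝ // t ∈ X.timeSet P}, MeasurableSpace.comap (X.Z t) inferInstance

/-- The Cox model with baseline hazard `haz` and regression vector `β`: given the covariate
process, failure and censoring times are independent and the failure time has hazard function
`t ↦ haz t * exp (βᵀ Z(t))` on the time index set. -/
structure IsCoxModel (X : SurvivalTriple Ω p) (P : Measure Ω) (haz : ℝ → ℝ≥0)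
    (β : Fin p → ℝ) : Prop where
  measurable_haz : Measurable haz
  condIndep : ∀ A B : Set ℝ, MeasurableSet A → MeasurableSet B →
    P[(X.failure ⁻¹' A ∩ X.censoring ⁻¹' B).indicator (fun _ => (1 : ℝ)) | X.covariateSigma P]
      =ᵐ[P]
    P[(X.failure ⁻¹' A).indicator (fun _ => (1 : ℝ)) | X.covariateSigma P] *
      P[(X.censoring ⁻¹' B).indicator (fun _ => (1 : ℝ)) | X.covariateSigma P]
  survival : ∀ t ∈ X.timeSet P,
    P[(X.failure ⁻¹' Set.Ioi t).indicator (fun _ => (1 : ℝ)) | X.covariateSigma P] =ᵐ[P]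
      fun ω => expNeg (∫⁻ s in Set.Ioc 0 t,
        (haz s : ℝ≥0∞) * ENNReal.ofReal (Real.exp (β ⬝ᵥ X.Z s ω)))

/-- The covariate process, indexed by the time index set, is predictable. -/
def IsPredictableCovariate (X : SurvivalTriple Ω p) (P : Measure Ω) : Prop :=
  IsStronglyPredictable (X.naturalFiltration P)
    (fun (t : ℝ≥0) (ω : Ω) => (X.timeSet P).indicator (fun s => X.Z s ω) (t : ℝ))

/-- `‖Z(t)‖_∞ ≤ K` almost surely, for every `t` in the time index set. -/
def IsBoundedCovariate (X : SurvivalTriple Ω p) (P : Measure Ω) (K : ℝ) : Prop :=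
  ∀ t ∈ X.timeSet P, ∀ᵐ ω ∂P, ∀ j, |X.Z t ω j| ≤ K

/-- Almost surely, `‖Z(s) - Z(t)‖_∞ ≤ L |s - t|` for all `s, t` in the time index set. -/
def IsLipschitzCovariate (X : SurvivalTriple Ω p) (P : Measure Ω) (L : ℝ) : Prop :=
  ∀ᵐ ω ∂P, ∀ s ∈ X.timeSet P, ∀ t ∈ X.timeSet P, ∀ j, |X.Z s ω j - X.Z t ω j| ≤ L * |s - t|

/-- The observed time has a bounded Lebesgue density. -/
def HasBoundedDensity (X : SurvivalTriple Ω p) (P : Measure Ω) : Prop :=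
  HasPDF X.T P volume ∧ ∃ C : ℝ≥0, ∀ᵐ t ∂volume, pdf X.T P volume t ≤ C

/-- The density of the observed time has a finite moment of some positive order. -/
def HasSomeMoment (X : SurvivalTriple Ω p) (P : Measure Ω) : Prop :=
  ∃ α : ℝ, 0 < α ∧ ∫⁻ t in X.timeSet P, ENNReal.ofReal (t ^ α) * pdf X.T P volume t < ∞

/-- The unnormalised weight `w̃(t, β) = Y(t) exp (βᵀ Z(t))`. -/
def weight (X : SurvivalTriple Ω p) (β : Fin p → ℝ) (t : ℝ) (ω : Ω) : ℝ :=
  X.Y t ω * Real.exp (β ⬝ᵥ X.Z t ω)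

/-- `μ(t, β) = E{Z(t) w̃(t, β)} / E{w̃(t, β)}`. -/
def tiltedMean (X : SurvivalTriple Ω p) (P : Measure Ω) (β : Fin p → ℝ) (t : ℝ) (j : Fin p) : ℝ :=
  (∫ ω, X.Z t ω j * X.weight β t ω ∂P) / ∫ ω, X.weight β t ω ∂P

/-- `Σ = E ∫ {Z(s) - μ(s, β)} {Z(s) - μ(s, β)}ᵀ dN(s)`. -/
def informationMatrix (X : SurvivalTriple Ω p) (P : Measure Ω) (β : Fin p → ℝ) :
    Matrix (Fin p) (Fin p) ℝ :=
  Matrix.of fun j k => ∫ ω, (∫ s in X.timeSet P,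
    (X.Z s ω j - X.tiltedMean P β s j) * (X.Z s ω k - X.tiltedMean P β s k) ∂(X.dN ω)) ∂P

/-- The log-partial likelihood, divided by `n`, of the sample whose `i`-th member is the triple
evaluated at `x i`. -/
def logPartialLikelihood (X : SurvivalTriple Ω p) (P : Measure Ω) {n : ℕ} (x : Fin n → Ω)
    (β : Fin p → ℝ) : ℝ :=
  (1 / (n : ℝ)) * ∑ i, ∫ s in X.timeSet P, β ⬝ᵥ X.Z s (x i) ∂(X.dN (x i)) -
    (1 / (n : ℝ)) * ∑ i, ∫ s in X.timeSet P,
      Real.log (∑ j, X.weight β s (x j)) ∂(X.dN (x i))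

/-- The score vector, i.e. the gradient of the log-partial likelihood divided by `n`. -/
def score (X : SurvivalTriple Ω p) (P : Measure Ω) {n : ℕ} (x : Fin n → Ω)
    (β : Fin p → ℝ) (j : Fin p) : ℝ :=
  fderiv ℝ (X.logPartialLikelihood P x) β (Pi.single j 1)

end SurvivalTriple

end

/-! Put `a = Σ⁻¹ c`. Since `Σ` is symmetric, the statistic is `√n aᵀ ℓ̇(β)`, a normalised sum over
observed events of `b(T_i) - A_n(T_i)`, where `b = aᵀ Z` and `A_n(s)` is the average of `b` over
those still at risk at `s`, weighted by relative risk. With `K` the bound on the covariates, `|b| ≤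
κ = ‖a‖₁ K + 1`, and the weights lie between `h⁻¹` and `h = exp(‖β‖₁ K)`.

The plan is to replace `A_n` by its population counterpart `m` with an `L¹` error that vanishes, and
then to apply a Lyapunov central limit theorem to the independent and identically distributed sum
that results.

The obstacle is the right tail, where few subjects are at risk and the survival probability `S(T)`
of an event time is small. As `T` has no atoms, `S(T)` is uniform. Hence events with `S(T) < ε` have
probability at most `ε`, while `E[1/S(T); S(T) ≥ ε] ≤ log(1/ε)`. With `ε = 1/n`, on average at most
one event is discarded, at cost `2κ`, and all other moments carry only a factor `log n` and powers
of `h`.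

For the retained events, the deviation `Δ = A_n - m` satisfies `Δ (1 + V) = U`, where `U` and `V`
are averages over the sample of centred kernels. Because `|Δ| ≤ 2κ` in any case, `|Δ - U|` is
quadratic in `U` and `V`, without any lower bound on `1 + V`. The sum of the `U` is a V-statistic.
Subtracting its projection onto the second argument leaves a completely degenerate kernel, whose
contribution is of order `log n` in total. Altogether the error is `O(κ h⁴ log n / √n)`
(`lintegral_abs_normalizedScore_sub_le`).

The projection is identified through the hazard: for every nonnegative measurable `f`, the mean of
`f(T, Z)` over events equals the mean of the integral of `f(s, Z)` against the hazard up to `T`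
(`HasHazard`). This is Fubini's theorem for the conditional laws of failure and censoring times
given the covariate path. Integrating the kernel against the hazard cancels its denominator, so the
projection is the compensator of the event term, up to the truncation (`linProj_eq`). The influence
function is therefore the integral of `b - m` against the event process minus its compensator.

The same identity yields what the central limit theorem needs. The mean is zero. The variance is the
mean of `(b - m)²` over events, that is `aᵀ Σ a = cᵀ Σ⁻¹ c`. The total hazard has `k`-th moment at
most `k!`, so the third absolute moment is at most `28 (2κ)³`.

Finally, the sparsity condition forces `‖Σ⁻¹‖ = o(n^(1/6))`, hence `κ = o(n^(1/6))`, and `‖β‖₁ =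
o(log n)` makes `h⁴ ≤ n^(1/12)` eventually. Both `κ³ / √n` and `κ h⁴ log n / √n` then tend to zero.
-/

set_option linter.unusedSectionVars false

/-! ### Characteristic functions and a Lyapunov theorem for triangular arrays -/

/-- Second-order Taylor bound for `x ↦ exp (i x)`. -/
theorem norm_cexp_ofReal_mul_I_sub_taylor_le (x : ℝ) :
    ‖Complex.exp (x * Complex.I) - (1 + x * Complex.I - x ^ 2 / 2)‖ ≤ 4 * |x| ^ 3 := by
  have hx : ‖(x * Complex.I : ℂ)‖ = |x| := by simp
  rcases le_total |x| 1 with h | h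
  · have h1 := Complex.norm_exp_sub_sum_le_norm_mul_exp (x * Complex.I) 3
    have h2 : ∑ m ∈ Finset.range 3, (x * Complex.I : ℂ) ^ m / (m.factorial : ℂ)
        = 1 + x * Complex.I - x ^ 2 / 2 := by
      simp only [Finset.sum_range_succ, Finset.sum_range_zero, Nat.factorial]
      push_cast
      rw [mul_pow _ _ 2, Complex.I_sq]
      ring
    rw [h2, hx] at h1
    refine h1.trans ?_
    have h3 : Real.exp |x| ≤ 4 := by
      have := Real.exp_le_exp.2 h
      have := Real.exp_one_lt_d9
      linarith
    have := mul_le_mul_of_nonneg_left h3 (pow_nonneg (abs_nonneg x) 3)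
    linarith
  · have h1 : ‖Complex.exp (x * Complex.I)‖ = 1 := Complex.norm_exp_ofReal_mul_I x
    have h2 : ‖(1 + x * Complex.I - x ^ 2 / 2 : ℂ)‖ ≤ 1 + |x| + |x| ^ 2 / 2 := by
      refine (norm_sub_le _ _).trans (add_le_add ((norm_add_le _ _).trans ?_) ?_)
      · simp
      · simp
    refine (norm_sub_le _ _).trans ?_
    rw [h1]
    have h3 : |x| ≤ |x| ^ 3 := by nlinarith [sq_nonneg (|x| - 1), abs_nonneg x]
    have h4 : |x| ^ 2 ≤ |x| ^ 3 := by nlinarith [sq_nonneg (|x|), abs_nonneg x]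
    have h5 : 1 ≤ |x| ^ 3 := by nlinarith
    linarith

/-- This Lipschitz bound is what makes `L¹` closeness sufficient for equality of limiting
characteristic functions. -/
theorem norm_cexp_ofReal_mul_I_sub_le (x y : ℝ) :
    ‖Complex.exp (x * Complex.I) - Complex.exp (y * Complex.I)‖ ≤ |x - y| := by
  have h : Complex.exp (x * Complex.I) - Complex.exp (y * Complex.I)
      = Complex.exp (y * Complex.I) * (Complex.exp (Complex.I * ((x - y : ℝ) : ℂ)) - 1) := by
    rw [mul_sub, ← Complex.exp_add]
    push_cast
    ring_nf
  rw [h, norm_mul, Complex.norm_exp_ofReal_mul_I, one_mul]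
  exact Real.norm_exp_I_mul_ofReal_sub_one_le

/-- Taylor expansion of the characteristic function of a centred variable with a third moment. -/
theorem norm_charFun_sub_taylor_le {Ω : Type*} [MeasurableSpace Ω] (P : Measure Ω)
    [IsProbabilityMeasure P] {f : Ω → ℝ} (hf : Measurable f)
    (h3 : Integrable (fun ω => |f ω| ^ 3) P) (h0 : ∫ ω, f ω ∂P = 0) (t : ℝ) :
    ‖charFun (P.map f) t - (1 - ((t ^ 2 * ∫ ω, f ω ^ 2 ∂P : ℝ) : ℂ) / 2)‖
      ≤ 4 * |t| ^ 3 * ∫ ω, |f ω| ^ 3 ∂P := by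
  have hm3 : MemLp f 3 P := by
    refine (integrable_norm_rpow_iff hf.aestronglyMeasurable (by norm_num) (by norm_num)).1 ?_
    simpa using h3
  have hm2 : MemLp f 2 P := hm3.mono_exponent (by norm_num)
  have hm1 : Integrable f P := hm3.integrable (by norm_num)
  have hi2 : Integrable (fun ω => f ω ^ 2) P := hm2.integrable_sq
  have hexp : Integrable (fun ω => Complex.exp (((t * f ω : ℝ) : ℂ) * Complex.I)) P := by
    refine Integrable.of_bound (C := 1) (by fun_prop) (ae_of_all _ fun ω => ?_)
    rw [Complex.norm_exp_ofReal_mul_I]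
  have hpoly : Integrable (fun ω => (1 + ((t * f ω : ℝ) : ℂ) * Complex.I
      - ((t * f ω : ℝ) : ℂ) ^ 2 / 2)) P := by
    refine ((integrable_const _).add ((hm1.const_mul t).ofReal.mul_const _)).sub ?_
    have := ((hi2.const_mul (t ^ 2)).ofReal (𝕜 := ℂ)).div_const 2
    refine this.congr (ae_of_all _ fun ω => ?_)
    simp [mul_pow]
  have hval : ∫ ω, (1 + ((t * f ω : ℝ) : ℂ) * Complex.I - ((t * f ω : ℝ) : ℂ) ^ 2 / 2) ∂P
      = 1 - ((t ^ 2 * ∫ ω, f ω ^ 2 ∂P : ℝ) : ℂ) / 2 := by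
    have e : ∀ ω, (((t * f ω : ℝ) : ℂ) ^ 2 / 2) = (((t ^ 2 * f ω ^ 2 : ℝ)) : ℂ) / 2 := by
      intro ω; push_cast; ring
    simp_rw [e]
    rw [integral_sub, integral_add, integral_mul_const, integral_div, integral_complex_ofReal,
      integral_complex_ofReal, integral_const_mul, integral_const_mul, h0]
    · simp
    · exact integrable_const _
    · exact (hm1.const_mul t).ofReal.mul_const _
    · exact (integrable_const _).add ((hm1.const_mul t).ofReal.mul_const _)
    · exact ((hi2.const_mul (t ^ 2)).ofReal (𝕜 := ℂ)).div_const 2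
  have hc : charFun (P.map f) t = ∫ ω, Complex.exp (((t * f ω : ℝ) : ℂ) * Complex.I) ∂P := by
    rw [charFun_apply_real, integral_map hf.aemeasurable (by fun_prop)]
    push_cast; rfl
  rw [hc, ← hval, ← integral_sub hexp hpoly, ← integral_const_mul]
  refine norm_integral_le_of_norm_le (h3.const_mul _) (ae_of_all _ fun ω => ?_)
  refine (norm_cexp_ofReal_mul_I_sub_taylor_le (t * f ω)).trans (le_of_eq ?_)
  rw [abs_mul, mul_pow]; ring

/-- A central limit theorem for row-wise independent and identically distributed arrays, for
variables which are close in `L¹` to the normalised row sums. -/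
theorem tendstoInDistribution_of_close_to_iid_row_sum
    {Ω : ℕ → Type*} [∀ n, MeasurableSpace (Ω n)] {P : ∀ n, Measure (Ω n)}
    [∀ n, IsProbabilityMeasure (P n)]
    {Ω' : ℕ → Type*} [∀ n, MeasurableSpace (Ω' n)] {P' : ∀ n, Measure (Ω' n)}
    [∀ n, IsProbabilityMeasure (P' n)] {ξ : ∀ n, Fin n → Ω' n → Ω n}
    (hξ_law : ∀ n i, MeasurePreserving (ξ n i) (P' n) (P n))
    (hξ_indep : ∀ n, iIndepFun (ξ n) (P' n))
    {W : ∀ n, Ω' n → ℝ} (hW : ∀ n, AEMeasurable (W n) (P' n))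
    {ψ : ∀ n, Ω n → ℝ} (hψ : ∀ᶠ n in atTop, Measurable (ψ n))
    (hψ0 : ∀ᶠ n in atTop, ∫ x, ψ n x ∂(P n) = 0) {ν : ℝ}
    (hψ2 : Tendsto (fun n => ∫ x, ψ n x ^ 2 ∂(P n)) atTop (𝓝 (ν ^ 2)))
    (hψ3 : ∀ᶠ n in atTop, Integrable (fun x => |ψ n x| ^ 3) (P n))
    (hψ3' : Tendsto (fun n : ℕ => (√(n : ℝ))⁻¹ * ∫ x, |ψ n x| ^ 3 ∂(P n)) atTop (𝓝 0))
    (hclose : Tendsto (fun n : ℕ => ∫⁻ ω, ENNReal.ofReal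
      |W n ω - (√(n : ℝ))⁻¹ * ∑ i, ψ n (ξ n i ω)| ∂(P' n)) atTop (𝓝 0)) :
    TendstoInDistribution W atTop (id : ℝ → ℝ) P' (gaussianReal 0 (ν ^ 2).toNNReal) where
  forall_aemeasurable := hW
  tendsto := by
    refine ProbabilityMeasure.tendsto_iff_tendsto_charFun.2 fun t => ?_
    have hlim : charFun ((gaussianReal 0 (ν ^ 2).toNNReal).map (id : ℝ → ℝ)) t
        = Complex.exp (-((t ^ 2 * ν ^ 2 : ℝ) : ℂ) / 2) := by
      rw [Measure.map_id, charFun_gaussianReal, Real.coe_toNNReal _ (sq_nonneg ν)]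
      push_cast
      ring_nf
    simp only [ProbabilityMeasure.coe_mk]
    rw [hlim]
    have hpow : Tendsto (fun n : ℕ => (charFun ((P n).map (ψ n)) ((√(n : ℝ))⁻¹ * t)) ^ n) atTop
        (𝓝 (Complex.exp (-((t ^ 2 * ν ^ 2 : ℝ) : ℂ) / 2))) := by
      -- It suffices that `n (φ_n - 1)` converges, since `(1 + z_n / n)^n → exp z` when `z_n → z`.
      have key : Tendsto (fun n : ℕ => (n : ℂ) *
          (charFun ((P n).map (ψ n)) ((√(n : ℝ))⁻¹ * t) - 1)) atTop
          (𝓝 (-((t ^ 2 * ν ^ 2 : ℝ) : ℂ) / 2)) := by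
        have h1 : Tendsto (fun n : ℕ => -((t ^ 2 * ∫ x, ψ n x ^ 2 ∂(P n) : ℝ) : ℂ) / 2) atTop
            (𝓝 (-((t ^ 2 * ν ^ 2 : ℝ) : ℂ) / 2)) :=
          (((Complex.continuous_ofReal.tendsto _).comp (hψ2.const_mul (t ^ 2))).neg).div_const 2
        refine h1.congr_dist ?_
        refine squeeze_zero' (Eventually.of_forall fun _ => dist_nonneg) ?_
          (by simpa using hψ3'.const_mul (4 * |t| ^ 3))
        filter_upwards [hψ, hψ0, hψ3, eventually_gt_atTop 0] with n h1 h2 h3 hn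
        have hn' : (0 : ℝ) < n := by exact_mod_cast hn
        have hs : 0 < √(n : ℝ) := Real.sqrt_pos.2 hn'
        have hss : √(n : ℝ) * √(n : ℝ) = n := Real.mul_self_sqrt hn'.le
        have := norm_charFun_sub_taylor_le (P n) h1 h3 h2 ((√(n : ℝ))⁻¹ * t)
        rw [dist_comm, dist_eq_norm]
        have e : (n : ℂ) * (charFun ((P n).map (ψ n)) ((√(n : ℝ))⁻¹ * t) - 1)
            - -((t ^ 2 * ∫ x, ψ n x ^ 2 ∂(P n) : ℝ) : ℂ) / 2
            = (n : ℂ) * (charFun ((P n).map (ψ n)) ((√(n : ℝ))⁻¹ * t)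
              - (1 - ((((√(n : ℝ))⁻¹ * t) ^ 2 * ∫ x, ψ n x ^ 2 ∂(P n) : ℝ) : ℂ) / 2)) := by
          have : ((√(n : ℝ))⁻¹ * t) ^ 2 = t ^ 2 / n := by
            rw [mul_pow, inv_pow, Real.sq_sqrt hn'.le]; field_simp
          rw [this]
          have hnc : (n : ℂ) ≠ 0 := by exact_mod_cast hn.ne'
          push_cast
          field_simp
          ring
        rw [e, norm_mul, Complex.norm_natCast]
        refine (mul_le_mul_of_nonneg_left this hn'.le).trans (le_of_eq ?_)
        rw [abs_mul, mul_pow, abs_of_pos (inv_pos.2 hs)]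
        -- The Taylor remainder is cubic in `t / √n`, so `n` of them leave the factor `1 / √n` of
        -- Lyapunov's condition.
        have : (n : ℝ) * (√(n : ℝ))⁻¹ ^ 3 = (√(n : ℝ))⁻¹ := by
          field_simp
          rw [Real.sq_sqrt hn'.le]
        calc _ = 4 * |t| ^ 3 * ((n : ℝ) * (√(n : ℝ))⁻¹ ^ 3 * ∫ x, |ψ n x| ^ 3 ∂(P n)) := by ring
          _ = _ := by rw [this]
      have := Complex.tendsto_one_add_pow_exp_of_tendsto key
      simpa using this
    refine hpow.congr_dist ?_
    have hz : Tendsto (fun n : ℕ => |t| * (∫⁻ ω, ENNReal.ofReal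
      |W n ω - (√(n : ℝ))⁻¹ * ∑ i, ψ n (ξ n i ω)| ∂(P' n)).toReal) atTop (𝓝 0) := by
      have := ((ENNReal.tendsto_toReal ENNReal.zero_ne_top).comp hclose).const_mul |t|
      simpa using this
    refine squeeze_zero' (Eventually.of_forall fun _ => dist_nonneg) ?_ hz
    -- The bound by `1` serves only to make the difference integrable, so that lower integral and
    -- Bochner integral agree.
    filter_upwards [hψ, (ENNReal.tendsto_nhds_zero.1 hclose 1 one_pos)] with n h1 hcl
    have hmeas : ∀ i, Measurable (fun ω => ψ n (ξ n i ω)) :=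
      fun i => h1.comp (hξ_law n i).measurable
    have hsum : Measurable (fun ω => ∑ i, ψ n (ξ n i ω)) :=
      Finset.measurable_fun_sum _ fun i _ => hmeas i
    have hrow : (charFun ((P n).map (ψ n)) ((√(n : ℝ))⁻¹ * t)) ^ n
        = charFun ((P' n).map (fun ω => (√(n : ℝ))⁻¹ * ∑ i, ψ n (ξ n i ω))) t := by
      have hind : iIndepFun (fun i ω => ψ n (ξ n i ω)) (P' n) :=
        (hξ_indep n).comp (fun _ => ψ n) (fun _ => h1)
      rw [charFun_map_mul_comp hsum.aemeasurable,
        hind.charFun_map_fun_sum_eq_prod (fun i => (hmeas i).aemeasurable)]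
      have : ∀ i, (P' n).map (fun ω => ψ n (ξ n i ω)) = (P n).map (ψ n) := fun i => by
        rw [← (hξ_law n i).map_eq, Measure.map_map h1 (hξ_law n i).measurable]; rfl
      simp [this]
    rw [hrow]
    set Ψ : Ω' n → ℝ := fun ω => (√(n : ℝ))⁻¹ * ∑ i, ψ n (ξ n i ω) with hΨ
    have hΨm : Measurable Ψ := hsum.const_mul _
    have hc : ∀ g : Ω' n → ℝ, AEMeasurable g (P' n) → charFun ((P' n).map g) t
        = ∫ ω, Complex.exp (((t * g ω : ℝ) : ℂ) * Complex.I) ∂(P' n) := fun g hg => by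
      rw [charFun_apply_real, integral_map hg (by fun_prop)]
      push_cast; rfl
    have hInt : ∀ g : Ω' n → ℝ, AEMeasurable g (P' n) →
        Integrable (fun ω => Complex.exp (((t * g ω : ℝ) : ℂ) * Complex.I)) (P' n) := by
      intro g hg
      refine Integrable.of_bound (C := 1) ?_ (ae_of_all _ fun ω => ?_)
      · have : AEMeasurable (fun ω => Complex.exp (((t * g ω : ℝ) : ℂ) * Complex.I)) (P' n) := by
          fun_prop
        exact this.aestronglyMeasurable
      · rw [Complex.norm_exp_ofReal_mul_I]
    rw [dist_comm, dist_eq_norm, hc _ (hW n), hc _ hΨm.aemeasurable,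
      ← integral_sub (hInt _ (hW n)) (hInt _ hΨm.aemeasurable)]
    have hL : Integrable (fun ω => |W n ω - Ψ ω|) (P' n) := by
      refine ⟨((hW n).sub hΨm.aemeasurable).abs.aestronglyMeasurable, ?_⟩
      refine (hasFiniteIntegral_iff_ofReal (ae_of_all _ fun _ => abs_nonneg _)).2 ?_
      exact hcl.trans_lt ENNReal.one_lt_top
    rw [← integral_eq_lintegral_of_nonneg_ae (ae_of_all _ fun _ => abs_nonneg _)
      hL.aestronglyMeasurable, ← integral_const_mul]
    refine norm_integral_le_of_norm_le (hL.const_mul _) (ae_of_all _ fun ω => ?_)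
    refine (norm_cexp_ofReal_mul_I_sub_le _ _).trans (le_of_eq ?_)
    rw [← mul_sub, abs_mul]

/-! ### The probability integral transform and small survival probabilities -/

theorem continuous_measureReal_Iic (μ : Measure ℝ) [IsFiniteMeasure μ] [NullSingletonClass μ] :
    Continuous fun s => μ.real (Set.Iic s) := by
  -- The distribution function is, up to a constant, a primitive of `1` with respect to `μ`, and
  -- primitives are continuous when there are no atoms.
  have h : (fun s => μ.real (Set.Iic s))
      = fun s => (∫ _ in (0 : ℝ)..s, (1 : ℝ) ∂μ) + μ.real (Set.Iic 0) := by
    funext s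
    rw [← intervalIntegral.integral_Iic_sub_Iic (integrable_const _).integrableOn
      (integrable_const _).integrableOn]
    simp
  rw [h]
  exact ((integrable_const (1 : ℝ)).continuous_primitive 0).add continuous_const

theorem monotone_measureReal_Iic (μ : Measure ℝ) [IsFiniteMeasure μ] :
    Monotone fun s => μ.real (Set.Iic s) :=
  fun _ _ hst => measureReal_mono (Set.Iic_subset_Iic.2 hst)

/-- The probability integral transform, for a finite measure without atoms. -/
theorem map_measureReal_Iic (μ : Measure ℝ) [IsFiniteMeasure μ] [NullSingletonClass μ] :
    μ.map (fun s => μ.real (Set.Iic s)) = volume.restrict (Set.Icc 0 (μ.real Set.univ)) := by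
  set F : ℝ → ℝ := fun s => μ.real (Set.Iic s) with hF
  have hcont : Continuous F := continuous_measureReal_Iic μ
  have hmono : Monotone F := monotone_measureReal_Iic μ
  have hbot : Tendsto F atBot (𝓝 0) := by
    have h := tendsto_measure_iInter_atBot (μ := μ) (s := fun s : ℝ => Set.Iic s)
      (fun _ => measurableSet_Iic.nullMeasurableSet) (fun _ _ h => Set.Iic_subset_Iic.2 h)
      ⟨0, measure_ne_top _ _⟩
    have he : (⋂ s : ℝ, Set.Iic s) = ∅ := by
      ext x
      simp only [Set.mem_iInter, Set.mem_Iic, Set.mem_empty_iff_false, iff_false, not_forall,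
        not_le]
      exact ⟨x - 1, by linarith⟩
    rw [he, measure_empty] at h
    exact (ENNReal.tendsto_toReal ENNReal.zero_ne_top).comp h
  have htop : Tendsto F atTop (𝓝 (μ.real Set.univ)) :=
    (ENNReal.tendsto_toReal (measure_ne_top μ _)).comp (tendsto_measure_Iic_atTop μ)
  refine Measure.ext_of_Iic _ _ fun u => ?_
  rw [Measure.map_apply hcont.measurable measurableSet_Iic, Measure.restrict_apply measurableSet_Iic]
  have hvol : volume (Set.Iic u ∩ Set.Icc 0 (μ.real Set.univ))
      = ENNReal.ofReal (min u (μ.real Set.univ)) := by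
    have : Set.Iic u ∩ Set.Icc 0 (μ.real Set.univ) = Set.Icc 0 (min u (μ.real Set.univ)) := by
      ext x; simp only [Set.mem_inter_iff, Set.mem_Iic, Set.mem_Icc, le_min_iff]; tauto
    rw [this, Real.volume_Icc, sub_zero]
  rw [hvol]
  rcases lt_or_ge u 0 with hu | hu
  · have : F ⁻¹' Set.Iic u = ∅ := by
      ext x
      simp only [Set.mem_preimage, Set.mem_Iic, Set.mem_empty_iff_false, iff_false, not_le]
      exact hu.trans_le measureReal_nonneg
    rw [this, measure_empty, ENNReal.ofReal_of_nonpos ((min_le_left _ _).trans hu.le)]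
  rcases le_or_gt (μ.real Set.univ) u with hM | hM
  · have : F ⁻¹' Set.Iic u = Set.univ := by
      ext x
      simp only [Set.mem_preimage, Set.mem_Iic, Set.mem_univ, iff_true]
      exact (measureReal_mono (Set.subset_univ _)).trans hM
    rw [this, min_eq_right hM, measureReal_def, ENNReal.ofReal_toReal (measure_ne_top _ _)]
  rw [min_eq_left hM.le]
  rcases (F ⁻¹' Set.Iic u).eq_empty_or_nonempty with he | hne
  · have h0 : u ≤ 0 := by
      refine ge_of_tendsto hbot (Eventually.of_forall fun x => ?_)
      have : x ∉ F ⁻¹' Set.Iic u := by rw [he]; simp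
      simpa using (not_le.1 this).le
    rw [he, measure_empty, ENNReal.ofReal_of_nonpos h0]
  · have hbdd : BddAbove (F ⁻¹' Set.Iic u) := by
      obtain ⟨x, hx⟩ := (htop.eventually (lt_mem_nhds hM)).exists
      refine ⟨x, fun y hy => ?_⟩
      by_contra hxy
      exact absurd (hmono (not_le.1 hxy).le) (not_le.2 (lt_of_le_of_lt hy hx))
    have hclosed : IsClosed (F ⁻¹' Set.Iic u) := isClosed_Iic.preimage hcont
    -- The sublevel set is a closed half-line ending at `q`; continuity forces `F q = u`, so its
    -- mass is exactly `u` even if `F` is flat somewhere.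
    set q := sSup (F ⁻¹' Set.Iic u) with hq
    have hqm : F q ≤ u := hclosed.csSup_mem hne hbdd
    have hset : F ⁻¹' Set.Iic u = Set.Iic q := by
      ext x
      exact ⟨fun hx => le_csSup hbdd hx, fun hx => (hmono hx).trans hqm⟩
    have hqu : F q = u := by
      refine le_antisymm hqm (not_lt.1 fun hlt => ?_)
      have hev : ∀ᶠ x in 𝓝[>] q, F x < u :=
        (hcont.continuousAt.eventually (gt_mem_nhds hlt)).filter_mono nhdsWithin_le_nhds
      obtain ⟨x, hx, hqx⟩ := (hev.and self_mem_nhdsWithin).exists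
      exact absurd (le_csSup hbdd (show x ∈ F ⁻¹' Set.Iic u from hx.le)) (not_le.2 hqx)
    rw [hset, ← hqu]
    exact (ENNReal.ofReal_toReal (measure_ne_top μ _)).symm

/-- Change of variables along the distribution function of a measure without atoms. -/
theorem lintegral_comp_measureReal_Iic (μ : Measure ℝ) [IsFiniteMeasure μ] [NullSingletonClass μ]
    {f : ℝ → ℝ≥0∞} (hf : Measurable f) :
    ∫⁻ s, f (μ.real (Set.Iic s)) ∂μ = ∫⁻ u in Set.Icc 0 (μ.real Set.univ), f u := by
  rw [← map_measureReal_Iic, lintegral_map hf (continuous_measureReal_Iic μ).measurable]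

/-- The substitution `u = μ(-∞, s]` reduces this to the integral of `u ^ k`. It drives the recursion
for the moments of the total hazard. -/
theorem lintegral_ofReal_pow_measureReal_Iic (μ : Measure ℝ) [IsFiniteMeasure μ]
    [NullSingletonClass μ] (k : ℕ) :
    ∫⁻ s, ENNReal.ofReal (μ.real (Set.Iic s) ^ k) ∂μ
      = ENNReal.ofReal (μ.real Set.univ ^ (k + 1) / (k + 1)) := by
  rw [lintegral_comp_measureReal_Iic μ (f := fun u => ENNReal.ofReal (u ^ k)) (by fun_prop),
    ← ofReal_integral_eq_lintegral_ofReal, integral_Icc_eq_integral_Ioc,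
    ← intervalIntegral.integral_of_le measureReal_nonneg, integral_pow]
  · simp
  · exact (continuous_pow k).integrableOn_Icc
  · filter_upwards [ae_restrict_mem measurableSet_Icc] with u hu using pow_nonneg hu.1 k

/-- With `μ` an integrated hazard this is the relation `∫ exp(-Λ) dΛ = 1 - exp(-Λ)`, which recovers
a law from its hazard. -/
theorem lintegral_ofReal_exp_neg_measureReal_Iic (μ : Measure ℝ) [IsFiniteMeasure μ]
    [NullSingletonClass μ] :
    ∫⁻ s, ENNReal.ofReal (Real.exp (-μ.real (Set.Iic s))) ∂μ
      = ENNReal.ofReal (1 - Real.exp (-μ.real Set.univ)) := by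
  rw [lintegral_comp_measureReal_Iic μ (f := fun u => ENNReal.ofReal (Real.exp (-u)))
    (by fun_prop),
    ← ofReal_integral_eq_lintegral_ofReal, integral_Icc_eq_integral_Ioc,
    ← intervalIntegral.integral_of_le measureReal_nonneg]
  · congr 1
    rw [intervalIntegral.integral_comp_neg (fun u => Real.exp u)]
    simp
  · exact (Real.continuous_exp.comp continuous_neg).integrableOn_Icc
  · exact ae_of_all _ fun u => (Real.exp_pos _).le

theorem measureReal_Ici_eq_one_sub (μ : Measure ℝ) [IsProbabilityMeasure μ]
    [NullSingletonClass μ] (s : ℝ) : μ.real (Set.Ici s) = 1 - μ.real (Set.Iic s) := by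
  rw [← probReal_compl_eq_one_sub measurableSet_Iic, Set.compl_Iic]
  exact measureReal_congr Ioi_ae_eq_Ici.symm

/-- The value of the survival function at an observation is uniform; small values are unlikely. -/
theorem measure_survival_lt_le (μ : Measure ℝ) [IsProbabilityMeasure μ]
    [NullSingletonClass μ] (ε : ℝ) :
    μ {s | μ.real (Set.Ici s) < ε} ≤ ENNReal.ofReal ε := by
  have hm : MeasurableSet {u : ℝ | 1 - u < ε} := measurableSet_lt (by fun_prop) (by fun_prop)
  have : {s | μ.real (Set.Ici s) < ε} = (fun s => μ.real (Set.Iic s)) ⁻¹' {u | 1 - u < ε} := by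
    ext s; simp [measureReal_Ici_eq_one_sub]
  rw [this, ← Measure.map_apply (continuous_measureReal_Iic μ).measurable hm, map_measureReal_Iic,
    Measure.restrict_apply hm]
  calc _ ≤ volume (Set.Icc (1 - ε) 1) := measure_mono fun u hu => by
        simp only [probReal_univ, Set.mem_inter_iff, Set.mem_ofPred_eq, Set.mem_Icc] at hu ⊢
        exact ⟨by linarith [hu.1], hu.2.2⟩
    _ = _ := by rw [Real.volume_Icc]; congr 1; ring

/-- The truncated mean of the reciprocal of the survival function at an observation. -/
theorem lintegral_inv_survival_le (μ : Measure ℝ) [IsProbabilityMeasure μ]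
    [NullSingletonClass μ] {ε : ℝ} (hε : 0 < ε) (hε1 : ε ≤ 1) :
    ∫⁻ s, ENNReal.ofReal ({s | ε ≤ μ.real (Set.Ici s)}.indicator
      (fun s => (μ.real (Set.Ici s))⁻¹) s) ∂μ ≤ ENNReal.ofReal (-Real.log ε) := by
  have hm : MeasurableSet {u : ℝ | ε ≤ 1 - u} := measurableSet_le (by fun_prop) (by fun_prop)
  have hf : Measurable fun u : ℝ => ENNReal.ofReal ({u : ℝ | ε ≤ 1 - u}.indicator
      (fun u => (1 - u)⁻¹) u) := by
    refine ENNReal.measurable_ofReal.comp (Measurable.indicator (by fun_prop) hm)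
  have h1 := lintegral_comp_measureReal_Iic μ hf
  have h2 : ∫⁻ s, ENNReal.ofReal ({s | ε ≤ μ.real (Set.Ici s)}.indicator
      (fun s => (μ.real (Set.Ici s))⁻¹) s) ∂μ = ∫⁻ s, ENNReal.ofReal
        ({u : ℝ | ε ≤ 1 - u}.indicator (fun u => (1 - u)⁻¹) (μ.real (Set.Iic s))) ∂μ := by
    refine lintegral_congr fun s => ?_
    simp only [Set.indicator, Set.mem_ofPred_eq, measureReal_Ici_eq_one_sub]
  rw [h2, h1, probReal_univ]
  have hle : ∀ u ∈ Set.Icc (0 : ℝ) 1, ENNReal.ofReal ({u : ℝ | ε ≤ 1 - u}.indicator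
      (fun u => (1 - u)⁻¹) u)
      = (Set.Icc 0 (1 - ε)).indicator (fun u => ENNReal.ofReal (1 - u)⁻¹) u := by
    intro u hu
    by_cases h : ε ≤ 1 - u
    · rw [Set.indicator_of_mem (show u ∈ {u : ℝ | ε ≤ 1 - u} from h),
        Set.indicator_of_mem (show u ∈ Set.Icc 0 (1 - ε) from ⟨hu.1, by linarith⟩)]
    · rw [Set.indicator_of_notMem (show u ∉ {u : ℝ | ε ≤ 1 - u} from h),
        Set.indicator_of_notMem, ENNReal.ofReal_zero]
      exact fun h' => h (by linarith [h'.2])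
  rw [setLIntegral_congr_fun measurableSet_Icc hle]
  refine (setLIntegral_le_lintegral _ _).trans ?_
  rw [lintegral_indicator measurableSet_Icc, ← ofReal_integral_eq_lintegral_ofReal]
  · rw [integral_Icc_eq_integral_Ioc, ← intervalIntegral.integral_of_le (by linarith)]
    refine ENNReal.ofReal_le_ofReal (le_of_eq ?_)
    rw [intervalIntegral.integral_comp_sub_left (fun u => u⁻¹) 1, sub_sub_cancel, sub_zero,
      integral_inv_of_pos hε one_pos, one_div, Real.log_inv]
  · refine ContinuousOn.integrableOn_Icc (ContinuousOn.inv₀ (by fun_prop) fun u hu => ?_)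
    have := hu.2; intro h; linarith
  · filter_upwards [ae_restrict_mem measurableSet_Icc] with u hu
    exact inv_nonneg.2 (by linarith [hu.2])

/-! ### Second moments of kernel sums over an independent sample -/

section iid

variable {Ω Ω' : Type*} [MeasurableSpace Ω] [MeasurableSpace Ω'] {P : Measure Ω}
  {P' : Measure Ω'} [IsProbabilityMeasure P] [IsProbabilityMeasure P'] {n : ℕ}
  {ξ : Fin n → Ω' → Ω}

theorem integral_comp_iid_pair (hlaw : ∀ i, MeasurePreserving (ξ i) P' P)
    (hind : iIndepFun ξ P') {i j : Fin n} (hij : i ≠ j) {f : Ω × Ω → ℝ} (hf : Measurable f) :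
    ∫ ω, f (ξ i ω, ξ j ω) ∂P' = ∫ z, f z ∂(P.prod P) := by
  have h := (indepFun_iff_map_prod_eq_prod_map_map (hlaw i).aemeasurable
    (hlaw j).aemeasurable).1 (hind.indepFun hij)
  rw [(hlaw i).map_eq, (hlaw j).map_eq] at h
  rw [← h, integral_map ((hlaw i).measurable.prodMk (hlaw j).measurable).aemeasurable
    hf.aestronglyMeasurable]

theorem integrable_mul_comp_iid (hlaw : ∀ i, MeasurePreserving (ξ i) P' P)
    {φ χ : Ω → Ω → ℝ} (hφ : Measurable (Function.uncurry φ)) (hχ : Measurable (Function.uncurry χ))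
    {A B : ℝ} (hA : ∀ x y, |φ x y| ≤ A) (hB : ∀ x y, |χ x y| ≤ B) (i j k l : Fin n) :
    Integrable (fun ω => φ (ξ i ω) (ξ j ω) * χ (ξ k ω) (ξ l ω)) P' := by
  have h1 : Measurable fun ω => φ (ξ i ω) (ξ j ω) :=
    hφ.comp ((hlaw i).measurable.prodMk (hlaw j).measurable)
  have h2 : Measurable fun ω => χ (ξ k ω) (ξ l ω) :=
    hχ.comp ((hlaw k).measurable.prodMk (hlaw l).measurable)
  refine Integrable.of_bound (C := A * B) (h1.mul h2).aestronglyMeasurable (ae_of_all _ fun ω => ?_)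
  rw [Real.norm_eq_abs, abs_mul]
  exact mul_le_mul (hA _ _) (hB _ _) (abs_nonneg _) ((abs_nonneg _).trans (hA (ξ i ω) (ξ j ω)))

/-- A product of two kernels has mean zero if one of its four arguments occurs only once and the
corresponding kernel is centred in it. -/
theorem integral_mul_comp_iid_eq_zero_left (hlaw : ∀ i, MeasurePreserving (ξ i) P' P)
    (hind : iIndepFun ξ P') {φ χ : Ω → Ω → ℝ} (hφ : Measurable (Function.uncurry φ))
    (hχ : Measurable (Function.uncurry χ)) {A B : ℝ} (hA : ∀ x y, |φ x y| ≤ A)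
    (hB : ∀ x y, |χ x y| ≤ B) (h0 : ∀ y, ∫ x, φ x y ∂P = 0)
    {i j k l : Fin n} (hij : i ≠ j) (hik : i ≠ k) (hil : i ≠ l) :
    ∫ ω, φ (ξ i ω) (ξ j ω) * χ (ξ k ω) (ξ l ω) ∂P' = 0 := by
  have hdisj : Disjoint ({i} : Finset (Fin n)) {j, k, l} := by
    simp [hij, hik, hil]
  have hI := hind.indepFun_finset _ _ hdisj fun i => (hlaw i).measurable
  let w : (({j, k, l} : Finset (Fin n)) → Ω) → Ω × Ω × Ω := fun g =>
    (g ⟨j, by simp⟩, g ⟨k, by simp⟩, g ⟨l, by simp⟩)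
  let v : (({i} : Finset (Fin n)) → Ω) → Ω := fun g => g ⟨i, by simp⟩
  have hI2 : IndepFun (ξ i) (fun ω => (ξ j ω, ξ k ω, ξ l ω)) P' :=
    hI.comp (φ := v) (ψ := w) (by fun_prop) (by fun_prop)
  have hWm : Measurable fun ω => (ξ j ω, ξ k ω, ξ l ω) :=
    (hlaw j).measurable.prodMk ((hlaw k).measurable.prodMk (hlaw l).measurable)
  have h := (indepFun_iff_map_prod_eq_prod_map_map (hlaw i).aemeasurable hWm.aemeasurable).1 hI2
  rw [(hlaw i).map_eq] at h
  have : IsProbabilityMeasure (P'.map fun ω => (ξ j ω, ξ k ω, ξ l ω)) :=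
    Measure.isProbabilityMeasure_map hWm.aemeasurable
  let F : Ω × Ω × Ω × Ω → ℝ := fun z => φ z.1 z.2.1 * χ z.2.2.1 z.2.2.2
  have hF : Measurable F :=
    (hφ.comp (f := fun z : Ω × Ω × Ω × Ω => (z.1, z.2.1)) (by fun_prop)).mul
      (hχ.comp (f := fun z : Ω × Ω × Ω × Ω => (z.2.2.1, z.2.2.2)) (by fun_prop))
  have e : ∫ ω, φ (ξ i ω) (ξ j ω) * χ (ξ k ω) (ξ l ω) ∂P'
      = ∫ z, F z ∂(P'.map fun ω => (ξ i ω, ξ j ω, ξ k ω, ξ l ω)) := by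
    rw [integral_map ((hlaw i).measurable.prodMk hWm).aemeasurable hF.aestronglyMeasurable]
  have hFi : Integrable F (P.prod (P'.map fun ω => (ξ j ω, ξ k ω, ξ l ω))) := by
    refine Integrable.of_bound (C := A * B) hF.aestronglyMeasurable (ae_of_all _ fun z => ?_)
    rw [Real.norm_eq_abs, abs_mul]
    exact mul_le_mul (hA _ _) (hB _ _) (abs_nonneg _) ((abs_nonneg _).trans (hA z.1 z.1))
  rw [e, h, integral_prod_symm _ hFi]
  simp [F, integral_mul_const, h0]

theorem integral_mul_comp_iid_eq_zero_right (hlaw : ∀ i, MeasurePreserving (ξ i) P' P)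
    (hind : iIndepFun ξ P') {φ χ : Ω → Ω → ℝ} (hφ : Measurable (Function.uncurry φ))
    (hχ : Measurable (Function.uncurry χ)) {A B : ℝ} (hA : ∀ x y, |φ x y| ≤ A)
    (hB : ∀ x y, |χ x y| ≤ B) (h0 : ∀ x, ∫ y, φ x y ∂P = 0)
    {i j k l : Fin n} (hij : j ≠ i) (hik : j ≠ k) (hil : j ≠ l) :
    ∫ ω, φ (ξ i ω) (ξ j ω) * χ (ξ k ω) (ξ l ω) ∂P' = 0 :=
  integral_mul_comp_iid_eq_zero_left (φ := fun x y => φ y x) hlaw hind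
    (hφ.comp measurable_swap) hχ (fun x y => hA y x) hB h0 hij hik hil

/-- The second moment of a sum over the second argument of a kernel centred in that argument. -/
theorem integral_sq_sum_kernel_le (hlaw : ∀ i, MeasurePreserving (ξ i) P' P)
    (hind : iIndepFun ξ P') {φ : Ω → Ω → ℝ} (hφ : Measurable (Function.uncurry φ))
    {A : ℝ} (hA : ∀ x y, |φ x y| ≤ A) (h0 : ∀ x, ∫ y, φ x y ∂P = 0) (i : Fin n) :
    ∫ ω, (∑ j, φ (ξ i ω) (ξ j ω)) ^ 2 ∂P'
      ≤ ∫ x, φ x x ^ 2 ∂P + n * ∫ z, φ z.1 z.2 ^ 2 ∂(P.prod P) := by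
  have hInt := fun j l => integrable_mul_comp_iid hlaw hφ hφ hA hA i j i l
  have e : ∫ ω, (∑ j, φ (ξ i ω) (ξ j ω)) ^ 2 ∂P'
      = ∑ j, ∑ l, ∫ ω, φ (ξ i ω) (ξ j ω) * φ (ξ i ω) (ξ l ω) ∂P' := by
    simp_rw [sq, Finset.sum_mul_sum]
    rw [integral_finsetSum _ fun j _ => integrable_finsetSum _ fun l _ => hInt j l]
    exact Finset.sum_congr rfl fun j _ => integral_finsetSum _ fun l _ => hInt j l
  -- Of two distinct indices `j` and `l`, at least one differs from `i` and so occurs only once; the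
  -- kernel is centred in that argument.
  have hz : ∀ j l, j ≠ l → ∫ ω, φ (ξ i ω) (ξ j ω) * φ (ξ i ω) (ξ l ω) ∂P' = 0 := by
    intro j l hjl
    by_cases hji : j = i
    · have := integral_mul_comp_iid_eq_zero_right hlaw hind hφ hφ hA hA h0 (i := i) (j := l)
        (k := i) (l := j) (by rw [← hji]; exact hjl.symm) (by rw [← hji]; exact hjl.symm) hjl.symm
      rw [← this]
      exact integral_congr_ae (ae_of_all _ fun ω => mul_comm _ _)
    · exact integral_mul_comp_iid_eq_zero_right hlaw hind hφ hφ hA hA h0 hji hji hjl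
  have hdiag : ∀ j, ∑ l, ∫ ω, φ (ξ i ω) (ξ j ω) * φ (ξ i ω) (ξ l ω) ∂P'
      = ∫ ω, φ (ξ i ω) (ξ j ω) ^ 2 ∂P' := fun j => by
    rw [Finset.sum_eq_single j (fun l _ hl => hz j l hl.symm) (by simp)]
    simp_rw [sq]
  have hsq : Measurable fun z : Ω × Ω => φ z.1 z.2 ^ 2 :=
    (show Measurable fun z : Ω × Ω => φ z.1 z.2 from hφ).pow_const 2
  have hval : ∀ j, ∫ ω, φ (ξ i ω) (ξ j ω) ^ 2 ∂P'
      ≤ (if j = i then ∫ x, φ x x ^ 2 ∂P else 0) + ∫ z, φ z.1 z.2 ^ 2 ∂(P.prod P) := by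
    intro j
    have hnn : 0 ≤ ∫ z, φ z.1 z.2 ^ 2 ∂(P.prod P) := integral_nonneg fun _ => sq_nonneg _
    split_ifs with hji
    · subst hji
      have hm : Measurable fun x => φ x x ^ 2 :=
        hsq.comp (measurable_id.prodMk measurable_id)
      have := integral_map (μ := P') (hlaw j).aemeasurable
        (f := fun x => φ x x ^ 2) hm.aestronglyMeasurable
      rw [(hlaw j).map_eq] at this
      rw [← this]
      linarith
    · rw [zero_add]
      exact (integral_comp_iid_pair hlaw hind (Ne.symm hji) hsq).le
  rw [e]
  simp_rw [hdiag]
  refine (Finset.sum_le_sum fun j _ => hval j).trans (le_of_eq ?_)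
  rw [Finset.sum_add_distrib]
  simp

/-- The second moment of the off-diagonal sum of a completely degenerate kernel. -/
theorem integral_sq_sum_degenerate_kernel_le (hlaw : ∀ i, MeasurePreserving (ξ i) P' P)
    (hind : iIndepFun ξ P') {φ : Ω → Ω → ℝ} (hφ : Measurable (Function.uncurry φ))
    {A : ℝ} (hA : ∀ x y, |φ x y| ≤ A) (h0 : ∀ x, ∫ y, φ x y ∂P = 0)
    (h0' : ∀ y, ∫ x, φ x y ∂P = 0) :
    ∫ ω, (∑ q ∈ Finset.univ.offDiag, φ (ξ q.1 ω) (ξ q.2 ω)) ^ 2 ∂P'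
      ≤ 2 * (n : ℝ) ^ 2 * ∫ z, φ z.1 z.2 ^ 2 ∂(P.prod P) := by
  set D : Finset (Fin n × Fin n) := Finset.univ.offDiag with hD
  set a := ∫ z, φ z.1 z.2 ^ 2 ∂(P.prod P) with ha
  have ha0 : 0 ≤ a := integral_nonneg fun _ => sq_nonneg _
  have hInt := fun q r : Fin n × Fin n => integrable_mul_comp_iid hlaw hφ hφ hA hA q.1 q.2 r.1 r.2
  have hsq : Measurable fun z : Ω × Ω => φ z.1 z.2 ^ 2 :=
    (show Measurable fun z : Ω × Ω => φ z.1 z.2 from hφ).pow_const 2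
  have hself : ∀ q ∈ D, ∫ ω, φ (ξ q.1 ω) (ξ q.2 ω) ^ 2 ∂P' = a := fun q hq =>
    integral_comp_iid_pair hlaw hind (Finset.mem_offDiag.1 hq).2.2 hsq
  have hpair : ∀ q ∈ D, ∀ r ∈ D, ∫ ω, φ (ξ q.1 ω) (ξ q.2 ω) * φ (ξ r.1 ω) (ξ r.2 ω) ∂P'
      ≤ (if r = q then a else 0) + (if r = q.swap then a else 0) := by
    intro q hq r hr
    have hq' := (Finset.mem_offDiag.1 hq).2.2
    have hr' := (Finset.mem_offDiag.1 hr).2.2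
    -- Only `r = q` and its transpose can contribute: otherwise some index of `q` is absent from
    -- `r`, and degeneracy in that argument kills the mean. The transpose is not a square, hence the
    -- arithmetic-geometric bound.
    by_cases h : r = q ∨ r = q.swap
    · have hle : ∫ ω, φ (ξ q.1 ω) (ξ q.2 ω) * φ (ξ r.1 ω) (ξ r.2 ω) ∂P' ≤ a := by
        have hi := fun q : Fin n × Fin n =>
          (hInt q q).congr (ae_of_all _ fun ω => (sq (φ (ξ q.1 ω) (ξ q.2 ω))).symm)
        calc _ ≤ ∫ ω, (1 / 2 * φ (ξ q.1 ω) (ξ q.2 ω) ^ 2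
                + 1 / 2 * φ (ξ r.1 ω) (ξ r.2 ω) ^ 2) ∂P' := by
              refine integral_mono (hInt q r) (((hi q).const_mul _).add ((hi r).const_mul _))
                fun ω => ?_
              dsimp only
              nlinarith [sq_nonneg (φ (ξ q.1 ω) (ξ q.2 ω) - φ (ξ r.1 ω) (ξ r.2 ω))]
          _ = a := by
              rw [integral_add ((hi q).const_mul _) ((hi r).const_mul _), integral_const_mul,
                integral_const_mul, hself q hq, hself r hr]
              ring
      refine hle.trans ?_
      rcases h with h | h
      · rw [if_pos h]; split_ifs <;> linarith
      · rw [if_pos h]; split_ifs <;> linarith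
    · have hn1 : 0 ≤ (if r = q then a else 0) + (if r = q.swap then a else 0) := by
        split_ifs <;> linarith
      refine le_trans (le_of_eq ?_) hn1
      by_cases h1 : q.1 = r.1 ∨ q.1 = r.2
      · have h2 : q.2 ≠ r.1 ∧ q.2 ≠ r.2 := by
          rw [not_or] at h
          constructor
          · rintro h3
            rcases h1 with h1 | h1
            · exact hq' (h1.trans h3.symm)
            · exact h.2 (Prod.ext h3.symm h1.symm)
          · rintro h3
            rcases h1 with h1 | h1
            · exact h.1 (Prod.ext h1.symm h3.symm)
            · exact hq' (h1.trans h3.symm)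
        exact integral_mul_comp_iid_eq_zero_right hlaw hind hφ hφ hA hA h0 hq'.symm h2.1 h2.2
      · rw [not_or] at h1
        exact integral_mul_comp_iid_eq_zero_left hlaw hind hφ hφ hA hA h0' hq' h1.1 h1.2
  have e : ∫ ω, (∑ q ∈ D, φ (ξ q.1 ω) (ξ q.2 ω)) ^ 2 ∂P'
      = ∑ q ∈ D, ∑ r ∈ D, ∫ ω, φ (ξ q.1 ω) (ξ q.2 ω) * φ (ξ r.1 ω) (ξ r.2 ω) ∂P' := by
    simp_rw [sq, Finset.sum_mul_sum]
    rw [integral_finsetSum _ fun j _ => integrable_finsetSum _ fun l _ => hInt j l]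
    exact Finset.sum_congr rfl fun j _ => integral_finsetSum _ fun l _ => hInt j l
  rw [e]
  have hrow : ∀ q ∈ D, ∑ r ∈ D, ∫ ω, φ (ξ q.1 ω) (ξ q.2 ω) * φ (ξ r.1 ω) (ξ r.2 ω) ∂P'
      ≤ 2 * a := by
    intro q hq
    refine (Finset.sum_le_sum fun r hr => hpair q hq r hr).trans ?_
    rw [Finset.sum_add_distrib, Finset.sum_ite_eq', Finset.sum_ite_eq']
    split_ifs <;> linarith
  refine (Finset.sum_le_sum hrow).trans ?_
  rw [Finset.sum_const, nsmul_eq_mul]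
  have hcard : (D.card : ℝ) ≤ (n : ℝ) ^ 2 := by
    have : D.card ≤ n * n := by
      rw [hD, Finset.offDiag_card]; simp
    calc (D.card : ℝ) ≤ ((n * n : ℕ) : ℝ) := by exact_mod_cast this
      _ = _ := by push_cast; ring
  nlinarith [mul_le_mul_of_nonneg_right hcard ha0]

end iid

/-! ### Population risk sets, truncation at small survival probabilities, and the two kernels -/

/-- The indicator of being at risk at time `s`. -/
noncomputable def atRisk {Ω : Type*} (T : Ω → ℝ) (s : ℝ) (x : Ω) : ℝ := if s ≤ T x then 1 else 0

section risk

variable {Ω : Type*} [MeasurableSpace Ω]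

/-- The survival function `s ↦ P(T ≥ s)`. -/
noncomputable def survivalFun (P : Measure Ω) (T : Ω → ℝ) (s : ℝ) : ℝ := ∫ x, atRisk T s x ∂P

/-- The mean weight `E(Y(s) w(s))` at risk at time `s`. -/
noncomputable def riskMean (P : Measure Ω) (T : Ω → ℝ) (w : ℝ → Ω → ℝ) (s : ℝ) : ℝ :=
  ∫ x, atRisk T s x * w s x ∂P

/-- The weighted mean `E(Y(s) w(s) b(s)) / E(Y(s) w(s))`. -/
noncomputable def riskTilt (P : Measure Ω) (T : Ω → ℝ) (w b : ℝ → Ω → ℝ) (s : ℝ) : ℝ :=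
  (∫ x, atRisk T s x * w s x * b s x ∂P) / riskMean P T w s

/-- The centred contribution `Y(s) w(s) (b(s) - m(s))` to the risk sum. -/
noncomputable def riskResidual (P : Measure Ω) (T : Ω → ℝ) (w b : ℝ → Ω → ℝ) (s : ℝ) (x : Ω) : ℝ :=
  atRisk T s x * w s x * (b s x - riskTilt P T w b s)

/-- Observation `x` is an event at a time whose survival probability is at least `ε`. -/
noncomputable def gate (P : Measure Ω) (T : Ω → ℝ) (D : Set Ω) (ε : ℝ) (x : Ω) : ℝ :=
  D.indicator (fun x => {s | ε ≤ survivalFun P T s}.indicator 1 (T x)) x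

/-- The gated reciprocal survival probability. -/
noncomputable def gatedInv (P : Measure Ω) (T : Ω → ℝ) (D : Set Ω) (ε : ℝ) (x : Ω) : ℝ :=
  gate P T D ε x * (survivalFun P T (T x))⁻¹

/-- The kernel of the linear part of the weighted average over the risk set. -/
noncomputable def linKernel (P : Measure Ω) (T : Ω → ℝ) (D : Set Ω) (w b : ℝ → Ω → ℝ) (ε : ℝ)
    (x y : Ω) : ℝ :=
  gate P T D ε x * (riskResidual P T w b (T x) y / riskMean P T w (T x))

/-- The kernel of the relative fluctuation of the total weight of the risk set. -/
noncomputable def massKernel (P : Measure Ω) (T : Ω → ℝ) (D : Set Ω) (w : ℝ → Ω → ℝ) (ε : ℝ)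
    (x y : Ω) : ℝ :=
  gate P T D ε x * (atRisk T (T x) y * w (T x) y / riskMean P T w (T x) - 1)

/-- The projection of `linKernel` onto its second argument. -/
noncomputable def linProj (P : Measure Ω) (T : Ω → ℝ) (D : Set Ω) (w b : ℝ → Ω → ℝ) (ε : ℝ)
    (y : Ω) : ℝ :=
  ∫ x, linKernel P T D w b ε x y ∂P

/-- Measurability and boundedness of the weight process `w` and of the process `b`, for an
observation time `T` with a continuous law and an event `D`. -/
structure IsRiskModel (P : Measure Ω) (T : Ω → ℝ) (D : Set Ω) (w b : ℝ → Ω → ℝ) (κ h : ℝ) :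
    Prop where
  measurable_T : Measurable T
  measurableSet_D : MeasurableSet D
  measurable_w : Measurable (Function.uncurry w)
  measurable_b : Measurable (Function.uncurry b)
  nullSingleton : NullSingletonClass (P.map T)
  pos_κ : 0 < κ
  one_le_h : 1 ≤ h
  le_w : ∀ s x, h⁻¹ ≤ w s x
  w_le : ∀ s x, w s x ≤ h
  abs_b_le : ∀ s x, |b s x| ≤ κ

theorem atRisk_nonneg (T : Ω → ℝ) (s : ℝ) (x : Ω) : 0 ≤ atRisk T s x := by
  unfold atRisk; split_ifs <;> norm_num

theorem atRisk_le_one (T : Ω → ℝ) (s : ℝ) (x : Ω) : atRisk T s x ≤ 1 := by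
  unfold atRisk; split_ifs <;> norm_num

theorem atRisk_sq (T : Ω → ℝ) (s : ℝ) (x : Ω) : atRisk T s x ^ 2 = atRisk T s x := by
  unfold atRisk; split_ifs <;> norm_num

@[simp] theorem atRisk_self (T : Ω → ℝ) (x : Ω) : atRisk T (T x) x = 1 := by simp [atRisk]

theorem measurable_atRisk {T : Ω → ℝ} (hT : Measurable T) :
    Measurable (Function.uncurry (atRisk T)) :=
  Measurable.ite (measurableSet_le measurable_fst (hT.comp measurable_snd))
    measurable_const measurable_const

namespace IsRiskModel

variable {P : Measure Ω} [IsProbabilityMeasure P] {T : Ω → ℝ} {D : Set Ω} {w b : ℝ → Ω → ℝ}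
  {κ h : ℝ}

theorem measurable_uncurry_integral {f : ℝ → Ω → ℝ} (hf : Measurable (Function.uncurry f)) :
    Measurable fun s => ∫ x, f s x ∂P :=
  (hf.stronglyMeasurable.integral_prod_right (ν := P)).measurable

theorem integrable_section {f : ℝ → Ω → ℝ} (hf : Measurable (Function.uncurry f)) {C : ℝ}
    (hC : ∀ s x, |f s x| ≤ C) (s : ℝ) : Integrable (f s) P :=
  Integrable.of_bound (C := C) (hf.comp (measurable_const.prodMk measurable_id)).aestronglyMeasurable
    (ae_of_all _ fun x => hC s x)

variable (H : IsRiskModel P T D w b κ h)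
include H

theorem w_pos (s : ℝ) (x : Ω) : 0 < w s x :=
  (inv_pos.2 (zero_lt_one.trans_le H.one_le_h)).trans_le (H.le_w s x)

theorem h_pos : 0 < h := zero_lt_one.trans_le H.one_le_h

theorem measurable_survivalFun : Measurable (survivalFun P T) :=
  measurable_uncurry_integral (measurable_atRisk H.measurable_T)

theorem measurable_weight : Measurable (Function.uncurry fun s x => atRisk T s x * w s x) :=
  (measurable_atRisk H.measurable_T).mul H.measurable_w

theorem measurable_weight_mul :
    Measurable (Function.uncurry fun s x => atRisk T s x * w s x * b s x) :=
  H.measurable_weight.mul H.measurable_b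

theorem measurable_riskMean : Measurable (riskMean P T w) :=
  measurable_uncurry_integral H.measurable_weight

theorem measurable_riskTilt : Measurable (riskTilt P T w b) :=
  (measurable_uncurry_integral H.measurable_weight_mul).div H.measurable_riskMean

theorem measurable_riskResidual : Measurable (Function.uncurry (riskResidual P T w b)) :=
  H.measurable_weight.mul (H.measurable_b.sub (H.measurable_riskTilt.comp measurable_fst))

theorem measurable_gate (ε : ℝ) : Measurable (gate P T D ε) := by
  refine Measurable.indicator ?_ H.measurableSet_D
  refine Measurable.comp (g := {s | ε ≤ survivalFun P T s}.indicator 1) ?_ H.measurable_T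
  exact measurable_one.indicator (measurableSet_le measurable_const H.measurable_survivalFun)

theorem measurable_gatedInv (ε : ℝ) : Measurable (gatedInv P T D ε) :=
  (H.measurable_gate ε).mul (H.measurable_survivalFun.comp H.measurable_T).inv

theorem measurable_comp_T {f : ℝ → Ω → ℝ} (hf : Measurable (Function.uncurry f)) :
    Measurable fun z : Ω × Ω => f (T z.1) z.2 :=
  hf.comp ((H.measurable_T.comp measurable_fst).prodMk measurable_snd)

theorem measurable_linKernel (ε : ℝ) : Measurable (Function.uncurry (linKernel P T D w b ε)) :=
  ((H.measurable_gate ε).comp measurable_fst).mul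
    ((H.measurable_comp_T H.measurable_riskResidual).div
      (H.measurable_riskMean.comp (H.measurable_T.comp measurable_fst)))

theorem measurable_massKernel (ε : ℝ) : Measurable (Function.uncurry (massKernel P T D w ε)) :=
  ((H.measurable_gate ε).comp measurable_fst).mul
    (((H.measurable_comp_T H.measurable_weight).div
      (H.measurable_riskMean.comp (H.measurable_T.comp measurable_fst))).sub measurable_const)

theorem measurable_linProj (ε : ℝ) : Measurable (linProj P T D w b ε) :=
  ((H.measurable_linKernel ε).stronglyMeasurable.integral_prod_left (μ := P)).measurable

theorem integrable_atRisk (s : ℝ) : Integrable (atRisk T s) P :=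
  integrable_section (measurable_atRisk H.measurable_T) (C := 1)
    (fun s x => by rw [abs_of_nonneg (atRisk_nonneg _ _ _)]; exact atRisk_le_one _ _ _) s

theorem abs_weight_le (s : ℝ) (x : Ω) : |atRisk T s x * w s x| ≤ h := by
  rw [abs_of_nonneg (mul_nonneg (atRisk_nonneg _ _ _) (H.w_pos s x).le)]
  calc _ ≤ 1 * h := mul_le_mul (atRisk_le_one _ _ _) (H.w_le s x) (H.w_pos s x).le zero_le_one
    _ = h := one_mul h

theorem integrable_weight (s : ℝ) : Integrable (fun x => atRisk T s x * w s x) P :=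
  integrable_section H.measurable_weight H.abs_weight_le s

theorem integrable_weight_mul (s : ℝ) : Integrable (fun x => atRisk T s x * w s x * b s x) P :=
  integrable_section H.measurable_weight_mul (C := h * κ) (fun s x => by
    rw [abs_mul]
    exact mul_le_mul (H.abs_weight_le s x) (H.abs_b_le s x) (abs_nonneg _) H.h_pos.le) s

theorem survivalFun_nonneg (s : ℝ) : 0 ≤ survivalFun P T s :=
  integral_nonneg fun x => atRisk_nonneg T s x

theorem survivalFun_le_one (s : ℝ) : survivalFun P T s ≤ 1 := by
  calc survivalFun P T s ≤ ∫ _, (1 : ℝ) ∂P :=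
        integral_mono (H.integrable_atRisk s) (integrable_const _) fun x => atRisk_le_one T s x
    _ = 1 := by simp

theorem survivalFun_eq (s : ℝ) : survivalFun P T s = (P.map T).real (Set.Ici s) := by
  have : atRisk T s = (T ⁻¹' Set.Ici s).indicator 1 := by
    funext x; simp [atRisk, Set.indicator]
  rw [survivalFun, this, integral_indicator_one (H.measurable_T measurableSet_Ici),
    map_measureReal_apply H.measurable_T measurableSet_Ici]

/-- The lower bound on the weights: through it reciprocals of the mean risk are controlled by
reciprocals of the survival probability, at the price of a factor `h`. -/
theorem inv_mul_survivalFun_le (s : ℝ) : h⁻¹ * survivalFun P T s ≤ riskMean P T w s := by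
  rw [survivalFun, ← integral_const_mul]
  refine integral_mono ((H.integrable_atRisk s).const_mul _) (H.integrable_weight s) fun x => ?_
  simp only
  rw [mul_comm]
  exact mul_le_mul_of_nonneg_left (H.le_w s x) (atRisk_nonneg _ _ _)

theorem riskMean_nonneg (s : ℝ) : 0 ≤ riskMean P T w s :=
  integral_nonneg fun x => mul_nonneg (atRisk_nonneg T s x) (H.w_pos s x).le

theorem abs_integral_weight_mul_le (s : ℝ) :
    |∫ x, atRisk T s x * w s x * b s x ∂P| ≤ κ * riskMean P T w s := by
  rw [riskMean, ← integral_const_mul, ← Real.norm_eq_abs]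
  refine norm_integral_le_of_norm_le ((H.integrable_weight s).const_mul κ) (ae_of_all _ fun x => ?_)
  rw [Real.norm_eq_abs, abs_mul, mul_comm κ,
    abs_of_nonneg (mul_nonneg (atRisk_nonneg T s x) (H.w_pos s x).le)]
  exact mul_le_mul_of_nonneg_left (H.abs_b_le s x)
    (mul_nonneg (atRisk_nonneg T s x) (H.w_pos s x).le)

theorem abs_riskTilt_le (s : ℝ) : |riskTilt P T w b s| ≤ κ := by
  rw [riskTilt, abs_div, abs_of_nonneg (H.riskMean_nonneg s)]
  exact div_le_of_le_mul₀ (H.riskMean_nonneg s) H.pos_κ.le (H.abs_integral_weight_mul_le s)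

theorem abs_sub_riskTilt_le (s : ℝ) (x : Ω) : |b s x - riskTilt P T w b s| ≤ 2 * κ := by
  have h1 := abs_sub (b s x) (riskTilt P T w b s)
  have h2 := H.abs_b_le s x
  have h3 := H.abs_riskTilt_le s
  linarith

theorem integral_riskResidual (s : ℝ) : ∫ x, riskResidual P T w b s x ∂P = 0 := by
  have e : ∀ x, riskResidual P T w b s x = atRisk T s x * w s x * b s x
      - riskTilt P T w b s * (atRisk T s x * w s x) := fun x => by
    unfold riskResidual; ring
  simp_rw [e]
  rw [integral_sub (H.integrable_weight_mul s) ((H.integrable_weight s).const_mul _),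
    integral_const_mul]
  change _ - riskTilt P T w b s * riskMean P T w s = 0
  by_cases h0 : riskMean P T w s = 0
  -- If the mean risk vanishes, the quotient in `riskTilt` takes the default value `0`, and the
  -- numerator vanishes as well, so centring needs no truncation.
  · have := H.abs_integral_weight_mul_le s
    rw [h0, mul_zero] at this
    rw [h0, mul_zero, sub_zero]
    exact abs_nonpos_iff.1 this
  · rw [riskTilt, div_mul_cancel₀ _ h0, sub_self]

theorem abs_riskResidual_le (s : ℝ) (x : Ω) :
    |riskResidual P T w b s x| ≤ 2 * κ * h * atRisk T s x := by
  rw [riskResidual, abs_mul, abs_mul, abs_of_nonneg (atRisk_nonneg T s x),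
    abs_of_pos (H.w_pos s x)]
  have := mul_le_mul (H.w_le s x) (H.abs_sub_riskTilt_le s x) (abs_nonneg _) H.h_pos.le
  calc _ = atRisk T s x * (w s x * |b s x - riskTilt P T w b s|) := by ring
    _ ≤ atRisk T s x * (h * (2 * κ)) := mul_le_mul_of_nonneg_left this (atRisk_nonneg _ _ _)
    _ = _ := by ring

omit H in
theorem gate_eq_zero_or_one (ε : ℝ) (x : Ω) : gate P T D ε x = 0 ∨ gate P T D ε x = 1 := by
  unfold gate
  by_cases h1 : x ∈ D
  · rw [Set.indicator_of_mem h1]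
    by_cases h2 : T x ∈ {s | ε ≤ survivalFun P T s}
    · right; rw [Set.indicator_of_mem h2]; rfl
    · left; rw [Set.indicator_of_notMem h2]
  · left; rw [Set.indicator_of_notMem h1]

omit H in
theorem le_survivalFun_of_gate {ε : ℝ} {x : Ω} (hx : gate P T D ε x = 1) :
    x ∈ D ∧ ε ≤ survivalFun P T (T x) := by
  unfold gate at hx
  by_cases h1 : x ∈ D
  · rw [Set.indicator_of_mem h1] at hx
    by_cases h2 : T x ∈ {s | ε ≤ survivalFun P T s}
    · exact ⟨h1, h2⟩
    · rw [Set.indicator_of_notMem h2] at hx; simp at hx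
  · rw [Set.indicator_of_notMem h1] at hx; simp at hx

theorem gatedInv_nonneg (ε : ℝ) (x : Ω) : 0 ≤ gatedInv P T D ε x := by
  unfold gatedInv
  rcases gate_eq_zero_or_one (P := P) (T := T) (D := D) ε x with h0 | h1
  · simp [h0]
  · rw [h1, one_mul]; exact inv_nonneg.2 (H.survivalFun_nonneg _)

theorem gate_le_gatedInv {ε : ℝ} (hε : 0 < ε) (x : Ω) : gate P T D ε x ≤ gatedInv P T D ε x := by
  unfold gatedInv
  rcases gate_eq_zero_or_one (P := P) (T := T) (D := D) ε x with h0 | h1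
  · simp [h0]
  · rw [h1, one_mul]
    exact (one_le_inv₀ (hε.trans_le (le_survivalFun_of_gate h1).2)).2 (H.survivalFun_le_one _)

theorem gatedInv_le {ε : ℝ} (hε : 0 < ε) (x : Ω) : gatedInv P T D ε x ≤ ε⁻¹ := by
  unfold gatedInv
  rcases gate_eq_zero_or_one (P := P) (T := T) (D := D) ε x with h0 | h1
  · rw [h0, zero_mul]; exact inv_nonneg.2 hε.le
  · rw [h1, one_mul]
    exact inv_anti₀ hε (le_survivalFun_of_gate h1).2

theorem integrable_gatedInv {ε : ℝ} (hε : 0 < ε) : Integrable (gatedInv P T D ε) P :=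
  Integrable.of_bound (C := ε⁻¹) (H.measurable_gatedInv ε).aestronglyMeasurable
    (ae_of_all _ fun x => by
      rw [Real.norm_eq_abs, abs_of_nonneg (H.gatedInv_nonneg ε x)]; exact H.gatedInv_le hε x)

/-- As `S(T)` is uniform, the truncated mean of `1 / S(T)` is at most the integral of `1 / u` over
`[ε, 1]`. This logarithm is the whole price of the sparse right tail. -/
theorem integral_gatedInv_le {ε : ℝ} (hε : 0 < ε) (hε1 : ε ≤ 1) :
    ∫ x, gatedInv P T D ε x ∂P ≤ -Real.log ε := by
  have := H.nullSingleton
  have hprob : IsProbabilityMeasure (P.map T) :=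
    Measure.isProbabilityMeasure_map H.measurable_T.aemeasurable
  have h1 := lintegral_inv_survival_le (P.map T) hε hε1
  have hlog : 0 ≤ -Real.log ε := by linarith [Real.log_nonpos hε.le hε1]
  rw [integral_eq_lintegral_of_nonneg_ae (ae_of_all _ (H.gatedInv_nonneg ε))
    (H.measurable_gatedInv ε).aestronglyMeasurable]
  refine ENNReal.toReal_le_of_le_ofReal hlog (le_trans ?_ h1)
  have hfun : (fun s => (P.map T).real (Set.Ici s)) = survivalFun P T := by
    funext s; exact (H.survivalFun_eq s).symm
  have hm : Measurable fun s => ENNReal.ofReal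
      ({s | ε ≤ survivalFun P T s}.indicator (fun s => (survivalFun P T s)⁻¹) s) :=
    ENNReal.measurable_ofReal.comp (H.measurable_survivalFun.inv.indicator
      (measurableSet_le measurable_const H.measurable_survivalFun))
  have h2 : ∀ s, (P.map T).real (Set.Ici s) = survivalFun P T s := fun s =>
    (H.survivalFun_eq s).symm
  simp_rw [h2]
  rw [lintegral_map hm H.measurable_T]
  refine lintegral_mono fun x => ENNReal.ofReal_le_ofReal ?_
  unfold gatedInv gate
  by_cases hs : T x ∈ {s | ε ≤ survivalFun P T s}
  · rw [Set.indicator_of_mem hs]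
    have hinv := inv_nonneg.2 (H.survivalFun_nonneg (T x))
    by_cases hD : x ∈ D
    · rw [Set.indicator_of_mem hD, Set.indicator_of_mem hs]; simp
    · rw [Set.indicator_of_notMem hD]; simpa using hinv
  · rw [Set.indicator_of_notMem hs]
    by_cases hD : x ∈ D
    · rw [Set.indicator_of_mem hD, Set.indicator_of_notMem hs]; simp
    · rw [Set.indicator_of_notMem hD]; simp

/-- The other side of the trade-off in `ε`: the events discarded by the truncation are rare. -/
theorem measureReal_survivalFun_lt_le {ε : ℝ} (hε : 0 ≤ ε) :
    P.real {x | survivalFun P T (T x) < ε} ≤ ε := by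
  have := H.nullSingleton
  have hprob : IsProbabilityMeasure (P.map T) :=
    Measure.isProbabilityMeasure_map H.measurable_T.aemeasurable
  refine ENNReal.toReal_le_of_le_ofReal hε ?_
  refine le_trans (le_of_eq ?_) (measure_survival_lt_le (P.map T) ε)
  simp_rw [← H.survivalFun_eq]
  rw [Measure.map_apply H.measurable_T (measurableSet_lt H.measurable_survivalFun measurable_const)]
  rfl

theorem gate_mul_inv_riskMean_le {ε : ℝ} (hε : 0 < ε) (x : Ω) :
    gate P T D ε x * (riskMean P T w (T x))⁻¹ ≤ h * gatedInv P T D ε x := by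
  unfold gatedInv
  rcases gate_eq_zero_or_one (P := P) (T := T) (D := D) ε x with h0 | h1
  · simp [h0]
  · have hS := hε.trans_le (le_survivalFun_of_gate h1).2
    rw [h1, one_mul, one_mul]
    have := inv_anti₀ (mul_pos (inv_pos.2 H.h_pos) hS) (H.inv_mul_survivalFun_le (T x))
    rwa [mul_inv, inv_inv] at this

omit H in
theorem gate_nonneg (ε : ℝ) (x : Ω) : 0 ≤ gate P T D ε x := by
  rcases gate_eq_zero_or_one (P := P) (T := T) (D := D) ε x with h0 | h0 <;> rw [h0]
  exact zero_le_one

/-- The at-risk indicator is kept because its mean over `y` is `S(T x)`, which later cancels one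
power of `1 / S(T x)`. -/
theorem abs_linKernel_le {ε : ℝ} (hε : 0 < ε) (x y : Ω) :
    |linKernel P T D w b ε x y| ≤ 2 * κ * h ^ 2 * (gatedInv P T D ε x * atRisk T (T x) y) := by
  unfold linKernel
  rw [abs_mul, abs_div, abs_of_nonneg (gate_nonneg ε x), abs_of_nonneg (H.riskMean_nonneg _)]
  have h1 := H.gate_mul_inv_riskMean_le hε x
  have h2 := H.abs_riskResidual_le (T x) y
  have hg : 0 ≤ gate P T D ε x * (riskMean P T w (T x))⁻¹ :=
    mul_nonneg (gate_nonneg ε x) (inv_nonneg.2 (H.riskMean_nonneg _))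
  calc _ = (gate P T D ε x * (riskMean P T w (T x))⁻¹) * |riskResidual P T w b (T x) y| := by
        rw [div_eq_mul_inv]; ring
    _ ≤ (h * gatedInv P T D ε x) * (2 * κ * h * atRisk T (T x) y) :=
        mul_le_mul h1 h2 (abs_nonneg _) (hg.trans h1)
    _ = _ := by ring

theorem abs_linKernel_le' {ε : ℝ} (hε : 0 < ε) (x y : Ω) :
    |linKernel P T D w b ε x y| ≤ 2 * κ * h ^ 2 * gatedInv P T D ε x := by
  refine (H.abs_linKernel_le hε x y).trans ?_
  have h1 := mul_le_mul_of_nonneg_left (atRisk_le_one T (T x) y) (H.gatedInv_nonneg ε x)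
  rw [mul_one] at h1
  exact mul_le_mul_of_nonneg_left h1 (mul_nonneg (by linarith [H.pos_κ]) (sq_nonneg h))

theorem abs_massKernel_add_gate_le {ε : ℝ} (hε : 0 < ε) (x y : Ω) :
    |massKernel P T D w ε x y + gate P T D ε x| ≤
      h ^ 2 * (gatedInv P T D ε x * atRisk T (T x) y) := by
  have e : massKernel P T D w ε x y + gate P T D ε x
      = (gate P T D ε x * (riskMean P T w (T x))⁻¹) * (atRisk T (T x) y * w (T x) y) := by
    unfold massKernel; rw [div_eq_mul_inv]; ring
  have h1 := H.gate_mul_inv_riskMean_le hε x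
  have hg : 0 ≤ gate P T D ε x * (riskMean P T w (T x))⁻¹ :=
    mul_nonneg (gate_nonneg ε x) (inv_nonneg.2 (H.riskMean_nonneg _))
  have hw : 0 ≤ atRisk T (T x) y * w (T x) y :=
    mul_nonneg (atRisk_nonneg _ _ _) (H.w_pos _ _).le
  rw [e, abs_of_nonneg (mul_nonneg hg hw)]
  calc _ ≤ (h * gatedInv P T D ε x) * (atRisk T (T x) y * h) :=
        mul_le_mul h1 (mul_le_mul_of_nonneg_left (H.w_le _ _) (atRisk_nonneg _ _ _)) hw (hg.trans h1)
    _ = _ := by ring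

theorem sq_linKernel_le {ε : ℝ} (hε : 0 < ε) (x y : Ω) :
    linKernel P T D w b ε x y ^ 2 ≤ 4 * κ ^ 2 * h ^ 4 *
      (gatedInv P T D ε x ^ 2 * atRisk T (T x) y + gatedInv P T D ε x) := by
  have h1 := pow_le_pow_left₀ (abs_nonneg _) (H.abs_linKernel_le hε x y) 2
  rw [sq_abs] at h1
  refine h1.trans ?_
  have e : (2 * κ * h ^ 2 * (gatedInv P T D ε x * atRisk T (T x) y)) ^ 2
      = 4 * κ ^ 2 * h ^ 4 * (gatedInv P T D ε x ^ 2 * atRisk T (T x) y ^ 2) := by ring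
  rw [e, atRisk_sq]
  refine mul_le_mul_of_nonneg_left ?_ (by positivity)
  linarith [H.gatedInv_nonneg ε x]

/-- Writing the kernel as `u - g` with `g` the gate, the bound follows from `(u - g)² ≤ 2u² + 2g²`.
The right-hand side has the same shape as for `linKernel`, so both kernels share the moment bounds
below. -/
theorem sq_massKernel_le {ε : ℝ} (hε : 0 < ε) (x y : Ω) :
    massKernel P T D w ε x y ^ 2 ≤ 2 * h ^ 4 *
      (gatedInv P T D ε x ^ 2 * atRisk T (T x) y + gatedInv P T D ε x) := by
  have h1 := pow_le_pow_left₀ (abs_nonneg _) (H.abs_massKernel_add_gate_le hε x y) 2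
  rw [sq_abs] at h1
  have e : (h ^ 2 * (gatedInv P T D ε x * atRisk T (T x) y)) ^ 2
      = h ^ 4 * (gatedInv P T D ε x ^ 2 * atRisk T (T x) y ^ 2) := by ring
  rw [e, atRisk_sq] at h1
  have h2 : gate P T D ε x ^ 2 ≤ h ^ 4 * gatedInv P T D ε x := by
    have h3 : gate P T D ε x ^ 2 = gate P T D ε x := by
      rcases gate_eq_zero_or_one (P := P) (T := T) (D := D) ε x with h0 | h0 <;> rw [h0] <;> norm_num
    rw [h3]
    refine (H.gate_le_gatedInv hε x).trans ?_
    exact le_mul_of_one_le_left (H.gatedInv_nonneg ε x) (one_le_pow₀ H.one_le_h)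
  nlinarith [sq_nonneg (massKernel P T D w ε x y + 2 * gate P T D ε x)]

theorem integral_linKernel_right {ε : ℝ} (x : Ω) : ∫ y, linKernel P T D w b ε x y ∂P = 0 := by
  unfold linKernel
  rw [integral_const_mul, integral_div, H.integral_riskResidual]
  simp

theorem integral_massKernel_right {ε : ℝ} (hε : 0 < ε) (x : Ω) :
    ∫ y, massKernel P T D w ε x y ∂P = 0 := by
  unfold massKernel
  rw [integral_const_mul]
  rcases gate_eq_zero_or_one (P := P) (T := T) (D := D) ε x with h0 | h1
  · simp [h0]
  · have hS := hε.trans_le (le_survivalFun_of_gate h1).2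
    have hd : 0 < riskMean P T w (T x) :=
      (mul_pos (inv_pos.2 H.h_pos) hS).trans_le (H.inv_mul_survivalFun_le (T x))
    rw [integral_sub ((H.integrable_weight _).div_const _) (integrable_const _), integral_div]
    change gate P T D ε x * (riskMean P T w (T x) / riskMean P T w (T x) - _) = 0
    rw [div_self hd.ne']
    simp

/-- A kernel with a suitable pointwise bound has controlled second moments. -/
theorem integral_sq_kernel_le {ε : ℝ} (hε : 0 < ε) (hε1 : ε ≤ 1) {φ : Ω → Ω → ℝ} {A : ℝ}
    (hA : 0 ≤ A)
    (hb : ∀ x y, φ x y ^ 2 ≤ A * (gatedInv P T D ε x ^ 2 * atRisk T (T x) y + gatedInv P T D ε x)) :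
    ∫ z, φ z.1 z.2 ^ 2 ∂(P.prod P) ≤ 2 * A * -Real.log ε := by
  set G := gatedInv P T D ε with hG
  have hGm : Measurable G := H.measurable_gatedInv ε
  have hYm : Measurable fun z : Ω × Ω => atRisk T (T z.1) z.2 :=
    H.measurable_comp_T (measurable_atRisk H.measurable_T)
  have hi : Integrable (fun z : Ω × Ω => A * (G z.1 ^ 2 * atRisk T (T z.1) z.2 + G z.1))
      (P.prod P) := by
    refine Integrable.of_bound (C := A * (ε⁻¹ ^ 2 * 1 + ε⁻¹)) ?_ (ae_of_all _ fun z => ?_)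
    · exact ((((hGm.comp measurable_fst).pow_const 2).mul hYm).add
        (hGm.comp measurable_fst)).const_mul A |>.aestronglyMeasurable
    · have h1 := H.gatedInv_nonneg ε z.1
      have h2 := H.gatedInv_le hε z.1
      have h3 := atRisk_nonneg T (T z.1) z.2
      have h4 := atRisk_le_one T (T z.1) z.2
      rw [Real.norm_eq_abs, abs_of_nonneg (by positivity)]
      gcongr
  calc _ ≤ ∫ z : Ω × Ω, A * (G z.1 ^ 2 * atRisk T (T z.1) z.2 + G z.1) ∂(P.prod P) :=
        integral_mono_of_nonneg (ae_of_all _ fun _ => sq_nonneg _) hi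
          (ae_of_all _ fun z => hb z.1 z.2)
    _ = ∫ x, A * (G x + G x) ∂P := by
        rw [integral_prod _ hi]
        refine integral_congr_ae (ae_of_all _ fun x => ?_)
        simp only
        rw [integral_const_mul, integral_add ((H.integrable_atRisk _).const_mul _)
          (integrable_const _), integral_const_mul]
        change A * (G x ^ 2 * survivalFun P T (T x) + _) = _
        -- Integrating out `y` turns the at-risk indicator into a survival probability, so a squared
        -- reciprocal becomes a first power, whose mean is only logarithmic.
        have : G x ^ 2 * survivalFun P T (T x) = G x := by
          rw [hG]; unfold gatedInv
          rcases gate_eq_zero_or_one (P := P) (T := T) (D := D) ε x with h0 | h1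
          · simp [h0]
          · have hS := hε.trans_le (le_survivalFun_of_gate h1).2
            rw [h1]; field_simp
        rw [this]; simp
    _ = 2 * A * ∫ x, G x ∂P := by
        rw [← integral_const_mul]; congr 1; funext x; ring
    _ ≤ _ := mul_le_mul_of_nonneg_left (H.integral_gatedInv_le hε hε1) (by linarith)

/-- On the diagonal the at-risk indicator equals `1` and nothing cancels, so one factor is estimated
by `ε⁻¹`. With `ε = 1 / n` this has the same order as the sum of the `n` off-diagonal terms. -/
theorem integral_sq_kernel_diag_le {ε : ℝ} (hε : 0 < ε) (hε1 : ε ≤ 1) {φ : Ω → Ω → ℝ} {A : ℝ}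
    (hA : 0 ≤ A)
    (hb : ∀ x y, φ x y ^ 2 ≤ A * (gatedInv P T D ε x ^ 2 * atRisk T (T x) y + gatedInv P T D ε x)) :
    ∫ x, φ x x ^ 2 ∂P ≤ 2 * A * ε⁻¹ * -Real.log ε := by
  have hi := (H.integrable_gatedInv hε).const_mul (2 * A * ε⁻¹)
  calc _ ≤ ∫ x, 2 * A * ε⁻¹ * gatedInv P T D ε x ∂P := by
        refine integral_mono_of_nonneg (ae_of_all _ fun _ => sq_nonneg _) hi
          (ae_of_all _ fun x => (hb x x).trans ?_)
        have h1 := H.gatedInv_nonneg ε x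
        have h2 := H.gatedInv_le hε x
        have h3 : 1 ≤ ε⁻¹ := (one_le_inv₀ hε).2 hε1
        rw [atRisk_self, mul_one]
        have : gatedInv P T D ε x ^ 2 + gatedInv P T D ε x ≤ 2 * ε⁻¹ * gatedInv P T D ε x := by
          nlinarith
        calc _ ≤ A * (2 * ε⁻¹ * gatedInv P T D ε x) := mul_le_mul_of_nonneg_left this hA
          _ = _ := by ring
    _ ≤ _ := by
        rw [integral_const_mul]
        exact mul_le_mul_of_nonneg_left (H.integral_gatedInv_le hε hε1) (by positivity)

end IsRiskModel

end risk

/-! ### Linearisation of the risk set average and its Hoeffding decomposition -/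

section risk

variable {Ω : Type*} [MeasurableSpace Ω]

/-- The weighted average of `b` over the risk set of a sample. -/
noncomputable def riskAverage {n : ℕ} (T : Ω → ℝ) (w b : ℝ → Ω → ℝ) (x : Fin n → Ω) (s : ℝ) : ℝ :=
  (∑ j, atRisk T s (x j) * w s (x j) * b s (x j)) / ∑ j, atRisk T s (x j) * w s (x j)

/-- The sum, normalised by `√n`, of the deviations of `b` from its risk set average at events. -/
noncomputable def normalizedScore {n : ℕ} (T : Ω → ℝ) (D : Set Ω) (w b : ℝ → Ω → ℝ)
    (x : Fin n → Ω) : ℝ :=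
  (√(n : ℝ))⁻¹ * ∑ i, D.indicator (fun z => b (T z) z - riskAverage T w b x (T z)) (x i)

/-- The summand of the linear approximation of `normalizedScore`. -/
noncomputable def gatedInfluence (P : Measure Ω) (T : Ω → ℝ) (D : Set Ω) (w b : ℝ → Ω → ℝ) (ε : ℝ)
    (y : Ω) : ℝ :=
  D.indicator (fun z => b (T z) z - riskTilt P T w b (T z)) y - linProj P T D w b ε y

/-- `linKernel` centred in both arguments. -/
noncomputable def centredKernel (P : Measure Ω) (T : Ω → ℝ) (D : Set Ω) (w b : ℝ → Ω → ℝ) (ε : ℝ)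
    (x y : Ω) : ℝ :=
  linKernel P T D w b ε x y - linProj P T D w b ε y

/-- Second-order expansion of a quotient. -/
theorem abs_sub_le_of_mul_one_add_eq {Δ U V c : ℝ} (hc : 0 < c) (hΔ : |Δ| ≤ c)
    (h : Δ * (1 + V) = U) : |Δ - U| ≤ U ^ 2 / (2 * c) + 3 / 2 * c * V ^ 2 := by
  -- Iterating `Δ = U - Δ V` once makes the error quadratic. The a priori bound on `Δ` replaces any
  -- lower bound on `1 + V`.
  have e : Δ - U = Δ * V ^ 2 - U * V := by rw [← h]; ring
  rw [e]
  have h1 : |Δ * V ^ 2| ≤ c * V ^ 2 := by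
    rw [abs_mul, abs_of_nonneg (sq_nonneg V)]
    exact mul_le_mul_of_nonneg_right hΔ (sq_nonneg V)
  have h2 : |U * V| ≤ U ^ 2 / (2 * c) + c * V ^ 2 / 2 := by
    rw [abs_mul]
    have : U ^ 2 / (2 * c) + c * V ^ 2 / 2 - |U| * |V| = (|U| - c * |V|) ^ 2 / (2 * c) := by
      rw [← sq_abs U, ← sq_abs V]; field_simp; ring
    have h3 : 0 ≤ (|U| - c * |V|) ^ 2 / (2 * c) := by positivity
    linarith
  calc _ ≤ |Δ * V ^ 2| + |U * V| := abs_sub _ _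
    _ ≤ _ := by linarith

namespace IsRiskModel

variable {P : Measure Ω} [IsProbabilityMeasure P] {T : Ω → ℝ} {D : Set Ω} {w b : ℝ → Ω → ℝ}
  {κ h : ℝ} (H : IsRiskModel P T D w b κ h)
include H

theorem sum_weight_pos {n : ℕ} (x : Fin n → Ω) (i : Fin n) :
    0 < ∑ j, atRisk T (T (x i)) (x j) * w (T (x i)) (x j) := by
  refine Finset.sum_pos' (fun j _ => mul_nonneg (atRisk_nonneg _ _ _) (H.w_pos _ _).le)
    ⟨i, Finset.mem_univ i, ?_⟩
  rw [atRisk_self, one_mul]; exact H.w_pos _ _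

theorem abs_riskAverage_le {n : ℕ} (x : Fin n → Ω) (i : Fin n) :
    |riskAverage T w b x (T (x i))| ≤ κ := by
  have hp := H.sum_weight_pos x i
  rw [riskAverage, abs_div, abs_of_pos hp, div_le_iff₀ hp, Finset.mul_sum]
  refine (Finset.abs_sum_le_sum_abs _ _).trans (Finset.sum_le_sum fun j _ => ?_)
  have h0 := mul_nonneg (atRisk_nonneg T (T (x i)) (x j)) (H.w_pos (T (x i)) (x j)).le
  rw [abs_mul, abs_of_nonneg h0, mul_comm]
  exact mul_le_mul_of_nonneg_right (H.abs_b_le _ _) h0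

/-- The deviation of the risk set average from its limit, in terms of the two kernels. -/
theorem riskAverage_sub_mul {n : ℕ} (hn : 0 < n) (x : Fin n → Ω) {ε : ℝ} (hε : 0 < ε) (i : Fin n)
    (hi : gate P T D ε (x i) = 1) :
    (riskAverage T w b x (T (x i)) - riskTilt P T w b (T (x i))) *
      (1 + (n : ℝ)⁻¹ * ∑ j, massKernel P T D w ε (x i) (x j))
      = (n : ℝ)⁻¹ * ∑ j, linKernel P T D w b ε (x i) (x j) := by
  have hn' : (n : ℝ) ≠ 0 := by exact_mod_cast hn.ne'
  have hp := (H.sum_weight_pos x i).ne'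
  have hS := hε.trans_le (le_survivalFun_of_gate hi).2
  have hd : riskMean P T w (T (x i)) ≠ 0 :=
    ((mul_pos (inv_pos.2 H.h_pos) hS).trans_le (H.inv_mul_survivalFun_le _)).ne'
  have e1 : ∑ j, massKernel P T D w ε (x i) (x j)
      = (∑ j, atRisk T (T (x i)) (x j) * w (T (x i)) (x j)) / riskMean P T w (T (x i)) - n := by
    simp only [massKernel, hi, one_mul]
    rw [Finset.sum_sub_distrib, Finset.sum_div]
    simp
  have e2 : ∑ j, linKernel P T D w b ε (x i) (x j)
      = ((∑ j, atRisk T (T (x i)) (x j) * w (T (x i)) (x j) * b (T (x i)) (x j))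
        - riskTilt P T w b (T (x i)) * ∑ j, atRisk T (T (x i)) (x j) * w (T (x i)) (x j))
          / riskMean P T w (T (x i)) := by
    simp only [linKernel, hi, one_mul, riskResidual]
    rw [← Finset.sum_div, Finset.mul_sum, ← Finset.sum_sub_distrib]
    congr 1
    exact Finset.sum_congr rfl fun j _ => by ring
  rw [e1, e2, riskAverage]
  field_simp
  ring

/-- Pointwise bound for the error of the linear approximation. -/
theorem abs_normalizedScore_sub_le {n : ℕ} (hn : 0 < n) (x : Fin n → Ω) {ε : ℝ} (hε : 0 < ε) :
    |normalizedScore T D w b x - (√(n : ℝ))⁻¹ * ∑ i, gatedInfluence P T D w b ε (x i)|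
      ≤ (√(n : ℝ))⁻¹ * ((∑ i, (2 * κ * {z | survivalFun P T (T z) < ε}.indicator 1 (x i)
        + (((n : ℝ)⁻¹ * ∑ j, linKernel P T D w b ε (x i) (x j)) ^ 2 / (2 * (2 * κ))
          + 3 / 2 * (2 * κ) * ((n : ℝ)⁻¹ * ∑ j, massKernel P T D w ε (x i) (x j)) ^ 2)))
        + (n : ℝ)⁻¹ * ∑ i, |centredKernel P T D w b ε (x i) (x i)|
        + (n : ℝ)⁻¹ * |∑ q ∈ Finset.univ.offDiag, centredKernel P T D w b ε (x q.1) (x q.2)|) := by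
  have hκ := H.pos_κ
  have hn' : (n : ℝ) ≠ 0 := by exact_mod_cast hn.ne'
  set U : Fin n → ℝ := fun i => (n : ℝ)⁻¹ * ∑ j, linKernel P T D w b ε (x i) (x j) with hU
  set V : Fin n → ℝ := fun i => (n : ℝ)⁻¹ * ∑ j, massKernel P T D w ε (x i) (x j) with hV
  set Δ : Ω → ℝ := fun z => riskAverage T w b x (T z) - riskTilt P T w b (T z) with hΔ
  -- The error splits into the nonlinear remainders and the double sum of `centredKernel`. The
  -- linear double sum minus its projection is exactly the latter.
  have hdiff : normalizedScore T D w b x - (√(n : ℝ))⁻¹ * ∑ i, gatedInfluence P T D w b ε (x i)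
      = -((√(n : ℝ))⁻¹ * ((∑ i, (D.indicator Δ (x i) - U i))
        + (n : ℝ)⁻¹ * ((∑ i, centredKernel P T D w b ε (x i) (x i))
          + ∑ q ∈ Finset.univ.offDiag, centredKernel P T D w b ε (x q.1) (x q.2)))) := by
    have hall : (∑ i, centredKernel P T D w b ε (x i) (x i))
        + ∑ q ∈ Finset.univ.offDiag, centredKernel P T D w b ε (x q.1) (x q.2)
        = ∑ i, ∑ j, centredKernel P T D w b ε (x i) (x j) := by
      rw [← Finset.sum_product' (f := fun i j => centredKernel P T D w b ε (x i) (x j)),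
        ← Finset.diag_union_offDiag, Finset.sum_union (Finset.disjoint_diag_offDiag _),
        Finset.sum_diag]
    have hk : (n : ℝ)⁻¹ * ∑ i, ∑ j, centredKernel P T D w b ε (x i) (x j)
        = ∑ i, U i - ∑ j, linProj P T D w b ε (x j) := by
      simp only [centredKernel, Finset.sum_sub_distrib, Finset.sum_const, hU, ← Finset.mul_sum,
        Finset.card_univ, Fintype.card_fin, nsmul_eq_mul]
      field_simp
    have hs : ∀ i, D.indicator (fun z => b (T z) z - riskAverage T w b x (T z)) (x i)
        - gatedInfluence P T D w b ε (x i)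
        = -D.indicator Δ (x i) + linProj P T D w b ε (x i) := by
      intro i
      simp only [gatedInfluence, Set.indicator, hΔ]
      split_ifs <;> ring
    rw [hall, hk, normalizedScore, ← mul_sub, ← Finset.sum_sub_distrib]
    simp_rw [hs]
    rw [Finset.sum_add_distrib, Finset.sum_neg_distrib, Finset.sum_sub_distrib]
    ring
  rw [hdiff, abs_neg, abs_mul, abs_of_nonneg (inv_nonneg.2 (Real.sqrt_nonneg _))]
  refine mul_le_mul_of_nonneg_left ?_ (inv_nonneg.2 (Real.sqrt_nonneg _))
  have hterm : ∀ i, |D.indicator Δ (x i) - U i|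
      ≤ 2 * κ * {z | survivalFun P T (T z) < ε}.indicator 1 (x i)
        + (U i ^ 2 / (2 * (2 * κ)) + 3 / 2 * (2 * κ) * V i ^ 2) := by
    intro i
    have hc : 0 ≤ U i ^ 2 / (2 * (2 * κ)) + 3 / 2 * (2 * κ) * V i ^ 2 := by positivity
    have hbd : |Δ (x i)| ≤ 2 * κ := by
      have h1 := abs_sub (riskAverage T w b x (T (x i))) (riskTilt P T w b (T (x i)))
      have h2 := H.abs_riskAverage_le x i
      have h3 := H.abs_riskTilt_le (T (x i))
      simp only [hΔ]; linarith
    have hind0 : 0 ≤ 2 * κ * {z | survivalFun P T (T z) < ε}.indicator (1 : Ω → ℝ) (x i) :=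
      mul_nonneg (by linarith) (Set.indicator_nonneg (fun _ _ => zero_le_one) _)
    rcases gate_eq_zero_or_one (P := P) (T := T) (D := D) ε (x i) with h0 | h1
    -- A closed gate means that there is no event or that the survival probability is below `ε`. In
    -- the second case `|Δ| ≤ 2κ` is all that is used.
    · have hU0 : U i = 0 := by simp [hU, linKernel, h0]
      rw [hU0, sub_zero]
      rw [hU0] at hc
      by_cases hD : x i ∈ D
      · have hlt : x i ∈ {z | survivalFun P T (T z) < ε} := by
          by_contra hge
          have : gate P T D ε (x i) = 1 := by
            unfold gate
            rw [Set.indicator_of_mem hD, Set.indicator_of_mem]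
            · rfl
            · exact not_lt.1 (show ¬ survivalFun P T (T (x i)) < ε from hge)
          rw [h0] at this; exact zero_ne_one this
        rw [Set.indicator_of_mem hD, Set.indicator_of_mem hlt, Pi.one_apply, mul_one]
        linarith
      · rw [Set.indicator_of_notMem hD, abs_zero]
        linarith
    · rw [Set.indicator_of_mem (le_survivalFun_of_gate h1).1]
      have := abs_sub_le_of_mul_one_add_eq (by linarith : (0 : ℝ) < 2 * κ) hbd
        (H.riskAverage_sub_mul hn x hε i h1)
      linarith
  calc _ ≤ |∑ i, (D.indicator Δ (x i) - U i)| + |(n : ℝ)⁻¹ * ((∑ i, centredKernel P T D w b ε (x i) (x i))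
          + ∑ q ∈ Finset.univ.offDiag, centredKernel P T D w b ε (x q.1) (x q.2))| := abs_add_le _ _
    _ ≤ _ := by
      rw [add_assoc]
      refine add_le_add ((Finset.abs_sum_le_sum_abs _ _).trans
        (Finset.sum_le_sum fun i _ => hterm i)) ?_
      rw [abs_mul, abs_of_nonneg (inv_nonneg.2 (Nat.cast_nonneg n)), ← mul_add]
      refine mul_le_mul_of_nonneg_left ?_ (inv_nonneg.2 (Nat.cast_nonneg n))
      exact (abs_add_le _ _).trans (add_le_add_left (Finset.abs_sum_le_sum_abs _ _) _)

/-- Averaging over the first argument replaces the uniform bound of order `ε⁻¹` on the kernel by a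
logarithm. -/
theorem abs_linProj_le {ε : ℝ} (hε : 0 < ε) (hε1 : ε ≤ 1) (y : Ω) :
    |linProj P T D w b ε y| ≤ 2 * κ * h ^ 2 * -Real.log ε := by
  have hκ := H.pos_κ
  calc _ ≤ ∫ x, 2 * κ * h ^ 2 * gatedInv P T D ε x ∂P := by
        rw [← Real.norm_eq_abs, linProj]
        exact norm_integral_le_of_norm_le ((H.integrable_gatedInv hε).const_mul _)
          (ae_of_all _ fun x => H.abs_linKernel_le' hε x y)
    _ ≤ _ := by
        rw [integral_const_mul]
        exact mul_le_mul_of_nonneg_left (H.integral_gatedInv_le hε hε1) (by positivity)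

theorem measurable_centredKernel (ε : ℝ) :
    Measurable (Function.uncurry (centredKernel P T D w b ε)) :=
  (H.measurable_linKernel ε).sub ((H.measurable_linProj ε).comp measurable_snd)

theorem abs_linKernel_le_const {ε : ℝ} (hε : 0 < ε) (x y : Ω) :
    |linKernel P T D w b ε x y| ≤ 2 * κ * h ^ 2 * ε⁻¹ := by
  have hκ := H.pos_κ
  exact (H.abs_linKernel_le' hε x y).trans
    (mul_le_mul_of_nonneg_left (H.gatedInv_le hε x) (by positivity))

theorem integrable_linKernel_left {ε : ℝ} (hε : 0 < ε) (y : Ω) :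
    Integrable (fun x => linKernel P T D w b ε x y) P :=
  Integrable.of_bound (C := 2 * κ * h ^ 2 * ε⁻¹)
    ((H.measurable_linKernel ε).comp (measurable_id.prodMk measurable_const)).aestronglyMeasurable
    (ae_of_all _ fun x => H.abs_linKernel_le_const hε x y)

theorem integrable_linKernel_right {ε : ℝ} (hε : 0 < ε) (x : Ω) :
    Integrable (fun y => linKernel P T D w b ε x y) P :=
  Integrable.of_bound (C := 2 * κ * h ^ 2 * ε⁻¹)
    ((H.measurable_linKernel ε).comp (measurable_const.prodMk measurable_id)).aestronglyMeasurable
    (ae_of_all _ fun y => H.abs_linKernel_le_const hε x y)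

theorem integrable_linProj {ε : ℝ} (hε : 0 < ε) (hε1 : ε ≤ 1) :
    Integrable (linProj P T D w b ε) P :=
  Integrable.of_bound (C := 2 * κ * h ^ 2 * -Real.log ε)
    (H.measurable_linProj ε).aestronglyMeasurable (ae_of_all _ fun y => H.abs_linProj_le hε hε1 y)

theorem integral_linProj {ε : ℝ} (hε : 0 < ε) : ∫ y, linProj P T D w b ε y ∂P = 0 := by
  unfold linProj
  rw [integral_integral_swap]
  · simp [H.integral_linKernel_right]
  · exact Integrable.of_bound (C := 2 * κ * h ^ 2 * ε⁻¹)
      ((H.measurable_linKernel ε).comp measurable_swap).aestronglyMeasurable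
      (ae_of_all _ fun z => H.abs_linKernel_le_const hε z.2 z.1)

theorem integral_centredKernel_right {ε : ℝ} (hε : 0 < ε) (hε1 : ε ≤ 1) (x : Ω) :
    ∫ y, centredKernel P T D w b ε x y ∂P = 0 := by
  unfold centredKernel
  rw [integral_sub (H.integrable_linKernel_right hε x) (H.integrable_linProj hε hε1),
    H.integral_linKernel_right, H.integral_linProj hε, sub_zero]

theorem integral_centredKernel_left {ε : ℝ} (hε : 0 < ε) (y : Ω) :
    ∫ x, centredKernel P T D w b ε x y ∂P = 0 := by
  unfold centredKernel
  rw [integral_sub (H.integrable_linKernel_left hε y) (integrable_const _)]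
  simp [linProj]

theorem abs_centredKernel_le {ε : ℝ} (hε : 0 < ε) (hε1 : ε ≤ 1) (x y : Ω) :
    |centredKernel P T D w b ε x y| ≤ 2 * κ * h ^ 2 * gatedInv P T D ε x
      + 2 * κ * h ^ 2 * -Real.log ε :=
  (abs_sub _ _).trans (add_le_add (H.abs_linKernel_le' hε x y) (H.abs_linProj_le hε hε1 y))

theorem abs_centredKernel_le_const {ε : ℝ} (hε : 0 < ε) (hε1 : ε ≤ 1) (x y : Ω) :
    |centredKernel P T D w b ε x y| ≤ 2 * κ * h ^ 2 * ε⁻¹ + 2 * κ * h ^ 2 * -Real.log ε :=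
  (abs_sub _ _).trans (add_le_add (H.abs_linKernel_le_const hε x y) (H.abs_linProj_le hε hε1 y))

/-- A first moment suffices for the diagonal, whose sum carries a factor `1 / n`. This avoids the
loss of `ε⁻¹` incurred by the second moment. -/
theorem integral_abs_centredKernel_diag_le {ε : ℝ} (hε : 0 < ε) (hε1 : ε ≤ 1) :
    ∫ x, |centredKernel P T D w b ε x x| ∂P ≤ 4 * κ * h ^ 2 * -Real.log ε := by
  have hκ := H.pos_κ
  calc _ ≤ ∫ x, (2 * κ * h ^ 2 * gatedInv P T D ε x + 2 * κ * h ^ 2 * -Real.log ε) ∂P :=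
        integral_mono_of_nonneg (ae_of_all _ fun _ => abs_nonneg _)
          (((H.integrable_gatedInv hε).const_mul _).add (integrable_const _))
          (ae_of_all _ fun x => H.abs_centredKernel_le hε hε1 x x)
    _ ≤ _ := by
        rw [integral_add ((H.integrable_gatedInv hε).const_mul _) (integrable_const _),
          integral_const_mul]
        have := mul_le_mul_of_nonneg_left (H.integral_gatedInv_le hε hε1)
          (by positivity : 0 ≤ 2 * κ * h ^ 2)
        simp only [integral_const, probReal_univ, one_smul]
        linarith

/-- For each fixed `y`, subtracting the mean over `x` can only decrease the second moment, so the
bound for `linKernel` carries over. -/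
theorem integral_sq_centredKernel_le {ε : ℝ} (hε : 0 < ε) (hε1 : ε ≤ 1) :
    ∫ z, centredKernel P T D w b ε z.1 z.2 ^ 2 ∂(P.prod P)
      ≤ 2 * (4 * κ ^ 2 * h ^ 4) * -Real.log ε := by
  refine le_trans ?_ (H.integral_sq_kernel_le hε hε1 (by positivity) (H.sq_linKernel_le hε))
  have hi1 : Integrable (fun z : Ω × Ω => centredKernel P T D w b ε z.1 z.2 ^ 2) (P.prod P) := by
    refine Integrable.of_bound (C := (2 * κ * h ^ 2 * ε⁻¹ + 2 * κ * h ^ 2 * -Real.log ε) ^ 2)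
      ((show Measurable fun z : Ω × Ω => centredKernel P T D w b ε z.1 z.2 from
        H.measurable_centredKernel ε).pow_const 2).aestronglyMeasurable (ae_of_all _ fun z => ?_)
    rw [Real.norm_eq_abs, abs_pow]
    exact pow_le_pow_left₀ (abs_nonneg _) (H.abs_centredKernel_le_const hε hε1 _ _) 2
  have hi2 : Integrable (fun z : Ω × Ω => linKernel P T D w b ε z.1 z.2 ^ 2) (P.prod P) := by
    refine Integrable.of_bound (C := (2 * κ * h ^ 2 * ε⁻¹) ^ 2)
      ((show Measurable fun z : Ω × Ω => linKernel P T D w b ε z.1 z.2 from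
        H.measurable_linKernel ε).pow_const 2).aestronglyMeasurable (ae_of_all _ fun z => ?_)
    rw [Real.norm_eq_abs, abs_pow]
    exact pow_le_pow_left₀ (abs_nonneg _) (H.abs_linKernel_le_const hε _ _) 2
  rw [integral_prod_symm _ hi1, integral_prod_symm _ hi2]
  refine integral_mono hi1.integral_prod_right hi2.integral_prod_right fun y => ?_
  simp only
  have hI := H.integrable_linKernel_left hε y
  have hIsq : Integrable (fun x => linKernel P T D w b ε x y ^ 2) P := by
    refine Integrable.of_bound (C := (2 * κ * h ^ 2 * ε⁻¹) ^ 2)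
      (hI.aestronglyMeasurable.pow 2) (ae_of_all _ fun x => ?_)
    rw [Real.norm_eq_abs, abs_pow]
    exact pow_le_pow_left₀ (abs_nonneg _) (H.abs_linKernel_le_const hε _ _) 2
  have e : ∀ x, centredKernel P T D w b ε x y ^ 2 = linKernel P T D w b ε x y ^ 2
      - 2 * linProj P T D w b ε y * linKernel P T D w b ε x y + linProj P T D w b ε y ^ 2 := by
    intro x; unfold centredKernel; ring
  simp_rw [e]
  rw [integral_add (f := fun x => linKernel P T D w b ε x y ^ 2
      - 2 * linProj P T D w b ε y * linKernel P T D w b ε x y)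
    (hIsq.sub (hI.const_mul _)) (integrable_const _),
    integral_sub hIsq (hI.const_mul _), integral_const_mul]
  have : ∫ x, linKernel P T D w b ε x y ∂P = linProj P T D w b ε y := rfl
  rw [this]
  simp only [integral_const, probReal_univ, one_smul]
  nlinarith [sq_nonneg (linProj P T D w b ε y)]

end IsRiskModel

end risk

/-! ### The error of the linearisation in `L¹` -/

namespace IsRiskModel

variable {Ω Ω' : Type*} [MeasurableSpace Ω] [MeasurableSpace Ω'] {P : Measure Ω}
  {P' : Measure Ω'} [IsProbabilityMeasure P] [IsProbabilityMeasure P'] {n : ℕ}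
  {ξ : Fin n → Ω' → Ω} {T : Ω → ℝ} {D : Set Ω} {w b : ℝ → Ω → ℝ}
  {κ h : ℝ} (H : IsRiskModel P T D w b κ h)
include H

/-- A crude bound that provides integrability; the rates come from the second moments. -/
theorem abs_massKernel_le_const {ε : ℝ} (hε : 0 < ε) (hε1 : ε ≤ 1) (x y : Ω) :
    |massKernel P T D w ε x y| ≤ 2 * h ^ 2 * ε⁻¹ := by
  have h1 := H.sq_massKernel_le hε x y
  have h2 := H.gatedInv_nonneg ε x
  have h3 := H.gatedInv_le hε x
  have h4 := atRisk_le_one T (T x) y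
  have h5 : 1 ≤ ε⁻¹ := (one_le_inv₀ hε).2 hε1
  refine abs_le_of_sq_le_sq ?_ (by positivity)
  refine h1.trans ?_
  have h6 : gatedInv P T D ε x ^ 2 * atRisk T (T x) y ≤ ε⁻¹ ^ 2 := by
    calc _ ≤ gatedInv P T D ε x ^ 2 * 1 := mul_le_mul_of_nonneg_left h4 (sq_nonneg _)
      _ ≤ _ := by rw [mul_one]; exact pow_le_pow_left₀ h2 h3 2
  have h7 : gatedInv P T D ε x ≤ ε⁻¹ ^ 2 := h3.trans (by nlinarith)
  calc _ ≤ 2 * h ^ 4 * (ε⁻¹ ^ 2 + ε⁻¹ ^ 2) :=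
        mul_le_mul_of_nonneg_left (add_le_add h6 h7) (by positivity)
    _ = _ := by ring

/-- The normalised score is close in `L¹` to a normalised sum of independent variables. -/
theorem lintegral_abs_normalizedScore_sub_le (hlaw : ∀ i, MeasurePreserving (ξ i) P' P)
    (hind : iIndepFun ξ P') (hn : 0 < n) :
    ∫⁻ ω, ENNReal.ofReal |normalizedScore T D w b (fun i => ξ i ω)
      - (√(n : ℝ))⁻¹ * ∑ i, gatedInfluence P T D w b (n : ℝ)⁻¹ (ξ i ω)| ∂P'
      ≤ ENNReal.ofReal (40 * κ * h ^ 4 * (1 + Real.log n) * (√(n : ℝ))⁻¹) := by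
  have hκ := H.pos_κ
  have hh := H.one_le_h
  have hn' : (0 : ℝ) < n := by exact_mod_cast hn
  have hn1 : (1 : ℝ) ≤ n := by exact_mod_cast hn
  -- At this level the expected number of discarded events is at most `n ε = 1`, while the truncated
  -- moments grow only like `log n`.
  set ε : ℝ := (n : ℝ)⁻¹ with hεdef
  have hε : 0 < ε := inv_pos.2 hn'
  have hε1 : ε ≤ 1 := inv_le_one_of_one_le₀ hn1
  have hlog : -Real.log ε = Real.log n := by rw [hεdef, Real.log_inv, neg_neg]
  have hlog0 : 0 ≤ Real.log n := Real.log_nonneg hn1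
  set u := linKernel P T D w b ε with hu
  set v := massKernel P T D w ε with hv
  set φ := centredKernel P T D w b ε with hφ
  have hum : Measurable (Function.uncurry u) := H.measurable_linKernel ε
  have hvm : Measurable (Function.uncurry v) := H.measurable_massKernel ε
  have hφm : Measurable (Function.uncurry φ) := H.measurable_centredKernel ε
  have hub := H.abs_linKernel_le_const hε
  have hvb := H.abs_massKernel_le_const hε hε1
  have hφb := H.abs_centredKernel_le_const hε hε1
  have hsqint : ∀ {f : Ω → Ω → ℝ} {A : ℝ}, Measurable (Function.uncurry f) → (∀ x y, |f x y| ≤ A) →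
      ∀ i, Integrable (fun ω => (∑ j, f (ξ i ω) (ξ j ω)) ^ 2) P' := by
    intro f A hf hA i
    simp_rw [sq, Finset.sum_mul_sum]
    exact integrable_finsetSum _ fun j _ => integrable_finsetSum _ fun l _ =>
      integrable_mul_comp_iid hlaw hf hf hA hA i j i l
  have hkernel : ∀ {f : Ω → Ω → ℝ} {A C : ℝ}, 0 ≤ C → Measurable (Function.uncurry f) →
      (∀ x y, |f x y| ≤ A) → (∀ x, ∫ y, f x y ∂P = 0) →
      (∀ x y, f x y ^ 2 ≤ C * (gatedInv P T D ε x ^ 2 * atRisk T (T x) y + gatedInv P T D ε x)) →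
      ∀ i, ∫ ω, (∑ j, f (ξ i ω) (ξ j ω)) ^ 2 ∂P' ≤ 4 * C * n * Real.log n := by
    intro f A C hC hf hA h0 hb i
    refine (integral_sq_sum_kernel_le hlaw hind hf hA h0 i).trans ?_
    have h1 := H.integral_sq_kernel_diag_le hε hε1 hC hb
    have h2 := mul_le_mul_of_nonneg_left (H.integral_sq_kernel_le hε hε1 hC hb) hn'.le
    rw [hlog] at h1 h2
    rw [hεdef, inv_inv] at h1
    linarith
  have hU := hkernel (C := 4 * κ ^ 2 * h ^ 4) (by positivity) hum hub
    (fun x => H.integral_linKernel_right x) (H.sq_linKernel_le hε)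
  have hV := hkernel (C := 2 * h ^ 4) (by positivity) hvm hvb
    (fun x => H.integral_massKernel_right hε x) (H.sq_massKernel_le hε)
  have hoff : ∫ ω, (∑ q ∈ Finset.univ.offDiag, φ (ξ q.1 ω) (ξ q.2 ω)) ^ 2 ∂P'
      ≤ 16 * κ ^ 2 * h ^ 4 * (n : ℝ) ^ 2 * Real.log n := by
    refine (integral_sq_sum_degenerate_kernel_le hlaw hind hφm hφb
      (H.integral_centredKernel_right hε hε1) (H.integral_centredKernel_left hε)).trans ?_
    have := mul_le_mul_of_nonneg_left (H.integral_sq_centredKernel_le hε hε1)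
      (by positivity : 0 ≤ 2 * (n : ℝ) ^ 2)
    rw [hlog] at this
    linarith
  have hoffint : Integrable
      (fun ω => (∑ q ∈ Finset.univ.offDiag, φ (ξ q.1 ω) (ξ q.2 ω)) ^ 2) P' := by
    simp_rw [sq, Finset.sum_mul_sum]
    exact integrable_finsetSum _ fun q _ => integrable_finsetSum _ fun r _ =>
      integrable_mul_comp_iid hlaw hφm hφm hφb hφb q.1 q.2 r.1 r.2
  have hdm : Measurable fun x => |φ x x| :=
    (hφm.comp (measurable_id.prodMk measurable_id)).abs
  have hdiag : ∀ i, ∫ ω, |φ (ξ i ω) (ξ i ω)| ∂P' ≤ 4 * κ * h ^ 2 * Real.log n := by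
    intro i
    have h1 := integral_map (μ := P') (hlaw i).aemeasurable (f := fun x => |φ x x|)
      hdm.aestronglyMeasurable
    rw [(hlaw i).map_eq] at h1
    rw [← h1, ← hlog]
    exact H.integral_abs_centredKernel_diag_le hε hε1
  have hdiagint : ∀ i, Integrable (fun ω => |φ (ξ i ω) (ξ i ω)|) P' := fun i =>
    Integrable.of_bound (C := 2 * κ * h ^ 2 * ε⁻¹ + 2 * κ * h ^ 2 * -Real.log ε)
      (hdm.comp (hlaw i).measurable).aestronglyMeasurable
      (ae_of_all _ fun ω => by rw [Real.norm_eq_abs, abs_abs]; exact hφb _ _)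
  set B : Set Ω := {z | survivalFun P T (T z) < ε} with hB
  have hBm : MeasurableSet B :=
    measurableSet_lt (H.measurable_survivalFun.comp H.measurable_T) measurable_const
  have hBint : ∀ i, Integrable (fun ω => B.indicator (1 : Ω → ℝ) (ξ i ω)) P' := fun i =>
    (hlaw i).integrable_comp_of_integrable ((integrable_const (1 : ℝ)).indicator hBm)
  have hBval : ∀ i, ∫ ω, B.indicator (1 : Ω → ℝ) (ξ i ω) ∂P' ≤ ε := by
    intro i
    have h1 := integral_map (μ := P') (hlaw i).aemeasurable (f := B.indicator (1 : Ω → ℝ))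
      ((measurable_one.indicator hBm).aestronglyMeasurable)
    rw [(hlaw i).map_eq] at h1
    rw [← h1, integral_indicator_one hBm]
    exact H.measureReal_survivalFun_lt_le hε.le
  -- The scale of the degenerate sum up to logarithms. In `ε |s| ≤ ε² s² / (2θ) + θ / 2` it balances
  -- both terms, turning the second moment into a first-moment bound linear in `κ`.
  set θ : ℝ := 2 * κ * h ^ 2 with hθ
  have hθ0 : 0 < θ := by positivity
  let R₁ : Fin n → Ω' → ℝ := fun i ω => 2 * κ * B.indicator 1 (ξ i ω)
    + (ε ^ 2 / (2 * (2 * κ)) * (∑ j, u (ξ i ω) (ξ j ω)) ^ 2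
      + 3 / 2 * (2 * κ) * ε ^ 2 * (∑ j, v (ξ i ω) (ξ j ω)) ^ 2)
  let R₂ : Ω' → ℝ := fun ω => ε * ∑ i, |φ (ξ i ω) (ξ i ω)|
  let R₃ : Ω' → ℝ := fun ω => ε ^ 2 / (2 * θ) *
    (∑ q ∈ Finset.univ.offDiag, φ (ξ q.1 ω) (ξ q.2 ω)) ^ 2 + θ / 2
  have hi1a : ∀ i, Integrable (fun ω => 2 * κ * B.indicator (1 : Ω → ℝ) (ξ i ω)) P' :=
    fun i => (hBint i).const_mul _
  have hi1b : ∀ i, Integrable (fun ω => ε ^ 2 / (2 * (2 * κ)) * (∑ j, u (ξ i ω) (ξ j ω)) ^ 2) P' :=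
    fun i => (hsqint hum hub i).const_mul _
  have hi1c : ∀ i, Integrable
      (fun ω => 3 / 2 * (2 * κ) * ε ^ 2 * (∑ j, v (ξ i ω) (ξ j ω)) ^ 2) P' :=
    fun i => (hsqint hvm hvb i).const_mul _
  have hi1 : ∀ i, Integrable (R₁ i) P' := fun i => (hi1a i).add ((hi1b i).add (hi1c i))
  have hi2 : Integrable R₂ P' := (integrable_finsetSum _ fun i _ => hdiagint i).const_mul _
  have hi3 : Integrable R₃ P' := (hoffint.const_mul _).add (integrable_const _)
  have hi1s : Integrable (fun ω => ∑ i, R₁ i ω) P' := integrable_finsetSum _ fun i _ => hi1 i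
  have hnε : (n : ℝ) * ε = 1 := mul_inv_cancel₀ hn'.ne'
  have hh2 : h ^ 2 ≤ h ^ 4 := pow_le_pow_right₀ hh (by norm_num)
  have hh4 : 1 ≤ h ^ 4 := one_le_pow₀ hh
  have hR1 : ∀ i, ∫ ω, R₁ i ω ∂P' ≤ ε * (2 * κ + 28 * κ * h ^ 4 * Real.log n) := by
    intro i
    have e : ∫ ω, R₁ i ω ∂P' = 2 * κ * ∫ ω, B.indicator (1 : Ω → ℝ) (ξ i ω) ∂P'
        + (ε ^ 2 / (2 * (2 * κ)) * ∫ ω, (∑ j, u (ξ i ω) (ξ j ω)) ^ 2 ∂P'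
          + 3 / 2 * (2 * κ) * ε ^ 2 * ∫ ω, (∑ j, v (ξ i ω) (ξ j ω)) ^ 2 ∂P') := by
      simp only [R₁]
      have hi1bc : Integrable (fun ω => ε ^ 2 / (2 * (2 * κ)) * (∑ j, u (ξ i ω) (ξ j ω)) ^ 2
          + 3 / 2 * (2 * κ) * ε ^ 2 * (∑ j, v (ξ i ω) (ξ j ω)) ^ 2) P' := (hi1b i).add (hi1c i)
      rw [integral_add (hi1a i) hi1bc, integral_add (hi1b i) (hi1c i),
        integral_const_mul, integral_const_mul, integral_const_mul]
    rw [e]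
    have h1 := mul_le_mul_of_nonneg_left (hBval i) (by positivity : 0 ≤ 2 * κ)
    have h2 := mul_le_mul_of_nonneg_left (hU i) (by positivity : 0 ≤ ε ^ 2 / (2 * (2 * κ)))
    have h3 := mul_le_mul_of_nonneg_left (hV i) (by positivity : 0 ≤ 3 / 2 * (2 * κ) * ε ^ 2)
    have e2 : ε ^ 2 / (2 * (2 * κ)) * (4 * (4 * κ ^ 2 * h ^ 4) * n * Real.log n)
        = ε * (4 * κ * h ^ 4 * Real.log n) := by
      calc _ = ((n : ℝ) * ε) * ε * (4 * κ * h ^ 4 * Real.log n) := by field_simp; ring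
        _ = _ := by rw [hnε, one_mul]
    have e3 : 3 / 2 * (2 * κ) * ε ^ 2 * (4 * (2 * h ^ 4) * n * Real.log n)
        = ε * (24 * κ * h ^ 4 * Real.log n) := by
      calc _ = ((n : ℝ) * ε) * ε * (24 * κ * h ^ 4 * Real.log n) := by ring
        _ = _ := by rw [hnε, one_mul]
    rw [e2] at h2
    rw [e3] at h3
    linarith
  have hR1s : ∫ ω, ∑ i, R₁ i ω ∂P' ≤ 2 * κ + 28 * κ * h ^ 4 * Real.log n := by
    rw [integral_finsetSum _ fun i _ => hi1 i]
    refine (Finset.sum_le_sum fun i _ => hR1 i).trans (le_of_eq ?_)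
    rw [Finset.sum_const, Finset.card_univ, Fintype.card_fin, nsmul_eq_mul, ← mul_assoc, hnε,
      one_mul]
  have hR2 : ∫ ω, R₂ ω ∂P' ≤ 4 * κ * h ^ 2 * Real.log n := by
    simp only [R₂]
    rw [integral_const_mul, integral_finsetSum _ fun i _ => hdiagint i]
    refine (mul_le_mul_of_nonneg_left (Finset.sum_le_sum fun i _ => hdiag i) hε.le).trans
      (le_of_eq ?_)
    rw [Finset.sum_const, Finset.card_univ, Fintype.card_fin, nsmul_eq_mul, ← mul_assoc,
      mul_comm ε, hnε, one_mul]
  have hR3 : ∫ ω, R₃ ω ∂P' ≤ 4 * κ * h ^ 2 * Real.log n + κ * h ^ 2 := by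
    simp only [R₃]
    rw [integral_add (hoffint.const_mul _) (integrable_const _), integral_const_mul]
    have h1 := mul_le_mul_of_nonneg_left hoff (by positivity : 0 ≤ ε ^ 2 / (2 * θ))
    have e : ε ^ 2 / (2 * θ) * (16 * κ ^ 2 * h ^ 4 * (n : ℝ) ^ 2 * Real.log n)
        = 4 * κ * h ^ 2 * Real.log n := by
      calc _ = ((n : ℝ) * ε) ^ 2 * (4 * κ * h ^ 2 * Real.log n) := by
            rw [hθ]; field_simp; ring
        _ = _ := by rw [hnε]; ring
    rw [e] at h1
    simp only [integral_const, probReal_univ, one_smul]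
    have : θ / 2 = κ * h ^ 2 := by rw [hθ]; ring
    linarith
  have hsn : 0 ≤ (√(n : ℝ))⁻¹ := inv_nonneg.2 (Real.sqrt_nonneg _)
  have hpt : ∀ ω, |normalizedScore T D w b (fun i => ξ i ω)
      - (√(n : ℝ))⁻¹ * ∑ i, gatedInfluence P T D w b ε (ξ i ω)|
      ≤ (√(n : ℝ))⁻¹ * ((∑ i, R₁ i ω) + R₂ ω + R₃ ω) := by
    intro ω
    refine (H.abs_normalizedScore_sub_le hn (fun i => ξ i ω) hε).trans ?_
    refine mul_le_mul_of_nonneg_left ?_ hsn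
    refine add_le_add (add_le_add (le_of_eq ?_) le_rfl) ?_
    · refine Finset.sum_congr rfl fun i _ => ?_
      simp only [R₁]
      rw [← hεdef]
      ring
    · simp only [R₃]
      set s := ∑ q ∈ Finset.univ.offDiag, φ (ξ q.1 ω) (ξ q.2 ω)
      rw [← hεdef]
      have : ε ^ 2 / (2 * θ) * s ^ 2 + θ / 2 - ε * |s| = (ε * |s| - θ) ^ 2 / (2 * θ) := by
        rw [← sq_abs s]; field_simp; ring
      have h3 : 0 ≤ (ε * |s| - θ) ^ 2 / (2 * θ) := by positivity
      linarith
  have hRint : Integrable (fun ω => (√(n : ℝ))⁻¹ * ((∑ i, R₁ i ω) + R₂ ω + R₃ ω)) P' :=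
    ((hi1s.add hi2).add hi3).const_mul _
  refine (lintegral_mono fun ω => ENNReal.ofReal_le_ofReal (hpt ω)).trans ?_
  rw [← ofReal_integral_eq_lintegral_ofReal hRint
    (ae_of_all _ fun ω => (abs_nonneg _).trans (hpt ω)), integral_const_mul]
  refine ENNReal.ofReal_le_ofReal ?_
  rw [mul_comm]
  refine mul_le_mul_of_nonneg_right ?_ hsn
  have e : ∫ ω, ((∑ i, R₁ i ω) + R₂ ω + R₃ ω) ∂P'
      = ∫ ω, ∑ i, R₁ i ω ∂P' + ∫ ω, R₂ ω ∂P' + ∫ ω, R₃ ω ∂P' := by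
    rw [integral_add (f := fun ω => (∑ i, R₁ i ω) + R₂ ω) (hi1s.add hi2) hi3,
      integral_add hi1s hi2]
  rw [e]
  have h1 : κ * h ^ 2 * Real.log n ≤ κ * h ^ 4 * Real.log n :=
    mul_le_mul_of_nonneg_right (mul_le_mul_of_nonneg_left hh2 hκ.le) hlog0
  have h2 : κ * h ^ 2 ≤ κ * h ^ 4 := mul_le_mul_of_nonneg_left hh2 hκ.le
  have h3 : κ ≤ κ * h ^ 4 := le_mul_of_one_le_right hκ.le hh4
  have h4 : 0 ≤ κ * h ^ 4 := by positivity
  have h5 : 0 ≤ κ * h ^ 4 * Real.log n := by positivity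
  linarith

end IsRiskModel

/-! ### From conditional survival functions to the integrated hazard identity -/

/-- A law on `ℝ` whose survival function is `exp (-∫ r)` on `[0, M]` has hazard rate `r` there. -/
theorem restrict_eq_withDensity_of_survival {κ : Measure ℝ} [IsProbabilityMeasure κ] {r : ℝ → ℝ≥0∞}
    (hr : Measurable r) {M : ℚ} (hfin : ∫⁻ s in Set.Ioc 0 (M : ℝ), r s ≠ ∞)
    (hκ : ∀ q : ℚ, 0 ≤ q → q ≤ M → κ (Set.Ioi (q : ℝ))
      = ENNReal.ofReal (Real.exp (-(∫⁻ s in Set.Ioc 0 (q : ℝ), r s).toReal))) :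
    κ.restrict (Set.Ioc 0 (M : ℝ))
      = (volume.withDensity fun s => r s * κ (Set.Ici s)).restrict (Set.Ioc 0 (M : ℝ)) := by
  rcases lt_or_ge M 0 with hM | hM
  · have : Set.Ioc 0 (M : ℝ) = ∅ := Set.Ioc_eq_empty (by push Not; exact_mod_cast hM.le)
    simp [this]
  have hM' : (0 : ℝ) ≤ M := by exact_mod_cast hM
  set ρ : Measure ℝ := volume.withDensity r with hρ
  have hρIoc : ∀ t : ℝ, ρ (Set.Ioc 0 t) = ∫⁻ s in Set.Ioc 0 t, r s := fun t =>
    withDensity_apply _ measurableSet_Ioc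
  have hna : NullSingletonClass ρ := inferInstance
  set μ : Measure ℝ := ρ.restrict (Set.Ioc 0 (M : ℝ)) with hμ
  have hμfin : IsFiniteMeasure μ := ⟨by
    rw [hμ, Measure.restrict_apply_univ, hρIoc]; exact hfin.lt_top⟩
  set F : ℝ → ℝ := fun s => μ.real (Set.Iic s) with hF
  have hFc : Continuous F := continuous_measureReal_Iic μ
  have hFval : ∀ t : ℝ, t ≤ M → F t = (∫⁻ s in Set.Ioc 0 t, r s).toReal := by
    intro t ht
    have hset : Set.Iic t ∩ Set.Ioc 0 (M : ℝ) = Set.Ioc 0 t := by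
      ext x; simp only [Set.mem_inter_iff, Set.mem_Iic, Set.mem_Ioc]
      exact ⟨fun h => ⟨h.2.1, h.1⟩, fun h => ⟨h.2, h.1, h.2.trans ht⟩⟩
    rw [hF]
    simp only
    rw [measureReal_def, hμ, Measure.restrict_apply measurableSet_Iic, hset, hρIoc]
  have hq : ∀ q : ℚ, 0 ≤ q → q ≤ M → κ (Set.Ioi (q : ℝ)) = ENNReal.ofReal (Real.exp (-F q)) := by
    intro q h0 h1
    rw [hκ q h0 h1, hFval q (by exact_mod_cast h1)]
  have hexpc : Continuous fun s => ENNReal.ofReal (Real.exp (-F s)) :=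
    ENNReal.continuous_ofReal.comp (Real.continuous_exp.comp hFc.neg)
  -- lower bound at every point, upper bound at every positive point
  have hlow : ∀ t : ℝ, 0 ≤ t → t ≤ M → ENNReal.ofReal (Real.exp (-F t)) ≤ κ (Set.Ioi t) := by
    intro t h0 h1
    rcases h1.eq_or_lt with h1 | h1
    · rw [h1]; exact (hq M hM le_rfl).ge
    · refine le_of_tendsto (hexpc.continuousAt.tendsto.mono_left nhdsWithin_le_nhds :
        Tendsto _ (𝓝[>] t) _) ?_
      filter_upwards [Ioo_mem_nhdsGT h1] with s hs
      obtain ⟨q, hq1, hq2⟩ := exists_rat_btwn hs.1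
      have hqM : (q : ℝ) ≤ M := (hq2.trans hs.2).le
      calc _ ≤ ENNReal.ofReal (Real.exp (-F q)) := by
            refine ENNReal.ofReal_le_ofReal (Real.exp_le_exp.2 (neg_le_neg ?_))
            exact monotone_measureReal_Iic μ hq2.le
        _ = κ (Set.Ioi (q : ℝ)) :=
            (hq q (by exact_mod_cast (h0.trans_lt hq1).le) (by exact_mod_cast hqM)).symm
        _ ≤ _ := measure_mono (Set.Ioi_subset_Ioi hq1.le)
  have hup : ∀ t : ℝ, 0 < t → t ≤ M → κ (Set.Ici t) ≤ ENNReal.ofReal (Real.exp (-F t)) := by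
    intro t h0 h1
    refine ge_of_tendsto (hexpc.continuousAt.tendsto.mono_left nhdsWithin_le_nhds :
      Tendsto _ (𝓝[<] t) _) ?_
    filter_upwards [Ioo_mem_nhdsLT h0] with s hs
    obtain ⟨q, hq1, hq2⟩ := exists_rat_btwn hs.2
    calc _ ≤ κ (Set.Ioi (q : ℝ)) := measure_mono (Set.Ici_subset_Ioi.2 hq2)
      _ = ENNReal.ofReal (Real.exp (-F q)) :=
          hq q (by exact_mod_cast (hs.1.trans hq1).le) (by exact_mod_cast (hq2.le.trans h1))
      _ ≤ _ := by
          refine ENNReal.ofReal_le_ofReal (Real.exp_le_exp.2 (neg_le_neg ?_))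
          exact monotone_measureReal_Iic μ hq1.le
  have hIci : ∀ t : ℝ, 0 < t → t ≤ M → κ (Set.Ici t) = ENNReal.ofReal (Real.exp (-F t)) :=
    fun t h0 h1 => le_antisymm (hup t h0 h1)
      ((hlow t h0.le h1).trans (measure_mono Set.Ioi_subset_Ici_self))
  have hIoi : ∀ t : ℝ, 0 < t → t ≤ M → κ (Set.Ioi t) = ENNReal.ofReal (Real.exp (-F t)) :=
    fun t h0 h1 => le_antisymm ((measure_mono Set.Ioi_subset_Ici_self).trans (hup t h0 h1))
      (hlow t h0.le h1)
  -- The survival formula at time `0` excludes mass on `(-∞, 0]`.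
  have hκ0 : κ (Set.Ioi (0 : ℝ)) = 1 := by
    have := hκ 0 le_rfl hM
    simpa using this
  have hF0 : ∀ t : ℝ, 0 ≤ F t := fun t => measureReal_nonneg
  have hmain : ∀ t : ℝ, 0 < t → t ≤ M → κ (Set.Ioc 0 t)
      = ∫⁻ s in Set.Ioc 0 t, r s * κ (Set.Ici s) := by
    intro t h0 h1
    have hl : κ (Set.Ioc 0 t) = ENNReal.ofReal (1 - Real.exp (-F t)) := by
      rw [← Set.Ioi_sdiff_Ioi, measure_sdiff (Set.Ioi_subset_Ioi h0.le)
        measurableSet_Ioi.nullMeasurableSet (measure_ne_top _ _), hκ0, hIoi t h0 h1,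
        ENNReal.ofReal_sub _ (Real.exp_pos _).le, ENNReal.ofReal_one]
    have hmon : ∫⁻ s in Set.Ioc 0 t, r s ≠ ∞ :=
      ((lintegral_mono_set (Set.Ioc_subset_Ioc_right h1)).trans_lt hfin.lt_top).ne
    set μt : Measure ℝ := ρ.restrict (Set.Ioc 0 t) with hμt
    have hμtfin : IsFiniteMeasure μt := ⟨by
      rw [hμt, Measure.restrict_apply_univ, hρIoc]; exact hmon.lt_top⟩
    have hG : ∀ s ∈ Set.Ioc 0 t, μt.real (Set.Iic s) = F s := by
      intro s hs
      have hset : Set.Iic s ∩ Set.Ioc 0 t = Set.Ioc 0 s := by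
        ext x; simp only [Set.mem_inter_iff, Set.mem_Iic, Set.mem_Ioc]
        exact ⟨fun h => ⟨h.2.1, h.1⟩, fun h => ⟨h.2, h.1, h.2.trans hs.2⟩⟩
      rw [hFval s (hs.2.trans h1), measureReal_def, hμt, Measure.restrict_apply measurableSet_Iic,
        hset, hρIoc]
    have htot : μt.real Set.univ = F t := by
      rw [hFval t h1, measureReal_def, hμt, Measure.restrict_apply_univ, hρIoc]
    -- The integrated hazard is used as its own clock: `1 - exp(-F t)` is the integral of `exp(-F)`,
    -- that is of the survival function, against the hazard.
    have h2 := lintegral_ofReal_exp_neg_measureReal_Iic μt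
    rw [htot, hμt] at h2
    rw [hl, ← h2]
    have h3 : ∫⁻ s in Set.Ioc 0 t, ENNReal.ofReal (Real.exp (-(ρ.restrict (Set.Ioc 0 t)).real
        (Set.Iic s))) ∂ρ = ∫⁻ s in Set.Ioc 0 t, κ (Set.Ici s) ∂ρ := by
      refine setLIntegral_congr_fun measurableSet_Ioc fun s hs => ?_
      rw [hIci s hs.1 (hs.2.trans h1), ← hμt, hG s hs]
    have hκm : Measurable fun s => κ (Set.Ici s) :=
      (show Antitone fun s => κ (Set.Ici s) from fun a b hab =>
        measure_mono (Set.Ici_subset_Ici.2 hab)).measurable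
    rw [h3, hρ, setLIntegral_withDensity_eq_setLIntegral_mul _ hr hκm measurableSet_Ioc]
    rfl
  refine Measure.ext_of_Iic _ _ fun t => ?_
  rw [Measure.restrict_apply measurableSet_Iic, Measure.restrict_apply measurableSet_Iic]
  have hset : Set.Iic t ∩ Set.Ioc 0 (M : ℝ) = Set.Ioc 0 (min t M) := by
    ext x; simp only [Set.mem_inter_iff, Set.mem_Iic, Set.mem_Ioc, le_min_iff]; tauto
  rw [hset, withDensity_apply _ measurableSet_Ioc]
  rcases le_or_gt (min t M) 0 with h0 | h0
  · rw [Set.Ioc_eq_empty (not_lt.2 h0)]; simp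
  · exact hmain _ h0 (min_le_right _ _)

/-- Under conditional independence of the failure time `S` and the censoring time `C` given `π`,
the compensator of the event at time `S ≤ C` is the integrated hazard up to time `min S C`. -/
theorem lintegral_event_eq_lintegral_hazard {Ω E : Type*} [MeasurableSpace Ω] [MeasurableSpace E]
    {P : Measure Ω} [IsProbabilityMeasure P] {π : Ω → E} {S C : Ω → ℝ} (hπ : Measurable π)
    (hS : Measurable S) (hC : Measurable C) {η₁ η₂ : Kernel E ℝ} [IsMarkovKernel η₁]
    [IsMarkovKernel η₂]
    (hlaw : P.map (fun ω => (π ω, S ω, C ω)) = (P.map π) ⊗ₘ (η₁ ×ₖ η₂))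
    {J : Set ℝ} (hJ : MeasurableSet J) {r : ℝ → E → ℝ≥0∞} (hr : Measurable (Function.uncurry r))
    (hhaz : ∀ᵐ e ∂(P.map π), (η₁ e).restrict J
      = (volume.withDensity fun s => r s e * η₁ e (Set.Ici s)).restrict J)
    {f : ℝ → E → ℝ≥0∞} (hf : Measurable (Function.uncurry f)) :
    ∫⁻ ω, {ω | S ω ≤ C ω}.indicator (fun ω => J.indicator (fun s => f s (π ω)) (S ω)) ω ∂P
      = ∫⁻ ω, (∫⁻ s in J,
        (Set.Iic (min (S ω) (C ω))).indicator (fun s => r s (π ω) * f s (π ω)) s) ∂P := by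
  have htriple : Measurable fun ω => (π ω, S ω, C ω) := hπ.prodMk (hS.prodMk hC)
  have hfm : Measurable fun z : E × ℝ => f z.2 z.1 := hf.comp measurable_swap
  have hrm : Measurable fun z : E × ℝ => r z.2 z.1 := hr.comp measurable_swap
  let g₁ : E × ℝ × ℝ → ℝ≥0∞ := fun z =>
    {z : E × ℝ × ℝ | z.2.1 ≤ z.2.2}.indicator (fun z => J.indicator (fun s => f s z.1) z.2.1) z
  let k : (E × ℝ × ℝ) × ℝ → ℝ≥0∞ := fun z =>
    {z : (E × ℝ × ℝ) × ℝ | z.2 ≤ min z.1.2.1 z.1.2.2}.indicator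
      (fun z => r z.2 z.1.1 * f z.2 z.1.1) z
  have hg₁ : Measurable g₁ := by
    refine Measurable.indicator ?_ (measurableSet_le (by fun_prop) (by fun_prop))
    have : (fun z : E × ℝ × ℝ => J.indicator (fun s => f s z.1) z.2.1)
        = {z : E × ℝ × ℝ | z.2.1 ∈ J}.indicator (fun z => f z.2.1 z.1) := by
      funext z; simp only [Set.indicator]; rfl
    rw [this]
    refine Measurable.indicator (hfm.comp (f := fun z : E × ℝ × ℝ => (z.1, z.2.1)) (by fun_prop))
      ?_
    exact hJ.preimage (measurable_fst.comp measurable_snd)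
  have hk : Measurable k := by
    refine Measurable.indicator ?_ (measurableSet_le (by fun_prop) (by fun_prop))
    exact (hrm.comp (f := fun z : (E × ℝ × ℝ) × ℝ => (z.1.1, z.2)) (by fun_prop)).mul
      (hfm.comp (f := fun z : (E × ℝ × ℝ) × ℝ => (z.1.1, z.2)) (by fun_prop))
  let g₂ : E × ℝ × ℝ → ℝ≥0∞ := fun z => ∫⁻ s in J, k (z, s)
  have hg₂ : Measurable g₂ := hk.lintegral_prod_right'
  have hL : ∫⁻ ω, {ω | S ω ≤ C ω}.indicator (fun ω => J.indicator (fun s => f s (π ω)) (S ω)) ω ∂P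
      = ∫⁻ z, g₁ z ∂(P.map fun ω => (π ω, S ω, C ω)) := by
    rw [lintegral_map hg₁ htriple]; rfl
  have hR : ∫⁻ ω, (∫⁻ s in J,
      (Set.Iic (min (S ω) (C ω))).indicator (fun s => r s (π ω) * f s (π ω)) s) ∂P
      = ∫⁻ z, g₂ z ∂(P.map fun ω => (π ω, S ω, C ω)) := by
    rw [lintegral_map hg₂ htriple]; rfl
  rw [hL, hR, hlaw, Measure.lintegral_compProd hg₁, Measure.lintegral_compProd hg₂]
  refine lintegral_congr_ae ?_
  filter_upwards [hhaz] with e he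
  have hs1 : Measurable fun z : ℝ × ℝ => g₁ (e, z) := hg₁.comp (by fun_prop)
  have hs2 : Measurable fun z : ℝ × ℝ => g₂ (e, z) := hg₂.comp (by fun_prop)
  have hfe : Measurable fun s => f s e := hf.comp (measurable_id.prodMk measurable_const)
  have hre : Measurable fun s => r s e := hr.comp (measurable_id.prodMk measurable_const)
  have hηm : Measurable fun s => η₁ e (Set.Ici s) :=
    (show Antitone fun s => η₁ e (Set.Ici s) from fun a b hab =>
      measure_mono (Set.Ici_subset_Ici.2 hab)).measurable
  rw [Kernel.prod_apply, lintegral_prod_symm' _ hs1, lintegral_prod_symm' _ hs2]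
  -- Given the path `e`, the two times are independent. For a fixed censoring time `u`, averaging
  -- the indicator of `s ≤ x` over the failure time `x` gives the survival probability at `s`, which
  -- is the factor in the density.
  refine lintegral_congr fun u => ?_
  have e1 : ∫⁻ x, g₁ (e, x, u) ∂(η₁ e)
      = ∫⁻ x in J, (Set.Iic u).indicator (fun x => f x e) x ∂(η₁ e) := by
    rw [← lintegral_indicator hJ]
    refine lintegral_congr fun x => ?_
    simp only [g₁, Set.indicator, Set.mem_ofPred_eq, Set.mem_Iic]
    split_ifs <;> rfl
  have hind : Measurable ((Set.Iic u).indicator (fun x => f x e)) := hfe.indicator measurableSet_Iic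
  have hrη : Measurable fun s => r s e * η₁ e (Set.Ici s) := hre.mul hηm
  rw [e1, he, restrict_withDensity hJ, lintegral_withDensity_eq_lintegral_mul _ hrη hind]
  have e2 : ∫⁻ x, g₂ (e, x, u) ∂(η₁ e) = ∫⁻ s in J, ∫⁻ x, k ((e, x, u), s) ∂(η₁ e) := by
    simp only [g₂]
    rw [lintegral_lintegral_swap]
    exact (hk.comp (f := fun z : ℝ × ℝ => ((e, z.1, u), z.2)) (by fun_prop)).aemeasurable
  rw [e2]
  refine lintegral_congr fun s => ?_
  have e3 : ∀ x, k ((e, x, u), s)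
      = (Set.Ici s).indicator (fun _ => (Set.Iic u).indicator (fun s => r s e * f s e) s) x := by
    intro x
    simp only [k, Set.indicator, Set.mem_ofPred_eq, Set.mem_Iic, Set.mem_Ici, le_min_iff]
    by_cases h1 : s ≤ x <;> by_cases h2 : s ≤ u <;> simp [h1, h2]
  simp_rw [e3]
  rw [lintegral_indicator measurableSet_Ici, setLIntegral_const, Pi.mul_apply]
  simp only [Set.indicator]
  split_ifs
  · ring
  · simp

/-! ### Compensators and moments of the total hazard -/

section hazard

variable {Ω E : Type*} [MeasurableSpace Ω] [MeasurableSpace E]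

/-- The measure with density `r · e` on the part of `J` up to time `t`. -/
noncomputable def hazardMeasure (J : Set ℝ) (r : ℝ → E → ℝ≥0) (t : ℝ) (e : E) : Measure ℝ :=
  (volume.restrict (J ∩ Set.Iic t)).withDensity fun s => (r s e : ℝ≥0∞)

/-- The event `D` at time `T` has the hazard rate `r` given `π`, in integrated form. -/
structure HasHazard (P : Measure Ω) (T : Ω → ℝ) (D : Set Ω) (π : Ω → E) (J : Set ℝ)
    (r : ℝ → E → ℝ≥0) : Prop where
  measurable_T : Measurable T
  measurableSet_D : MeasurableSet D
  measurable_π : Measurable π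
  measurableSet_J : MeasurableSet J
  measurable_r : Measurable (Function.uncurry r)
  lintegral_eq : ∀ f : ℝ → E → ℝ≥0∞, Measurable (Function.uncurry f) →
    ∫⁻ ω, D.indicator (fun ω => f (T ω) (π ω)) ω ∂P
      = ∫⁻ ω, (∫⁻ s, f s (π ω) ∂(hazardMeasure J r (T ω) (π ω))) ∂P

instance (J : Set ℝ) (r : ℝ → E → ℝ≥0) (t : ℝ) (e : E) :
    NullSingletonClass (hazardMeasure J r t e) := by
  unfold hazardMeasure; infer_instance

/-- Half of the square of an integral is an iterated integral. -/
theorem integral_mul_integral_Iic (μ : Measure ℝ) [IsFiniteMeasure μ] [NullSingletonClass μ]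
    {f : ℝ → ℝ} (hf : Measurable f) {c : ℝ} (hc : ∀ s, |f s| ≤ c) :
    2 * ∫ s, f s * ∫ t in Set.Iic s, f t ∂μ ∂μ = (∫ s, f s ∂μ) ^ 2 := by
  have hprod : Measurable fun z : ℝ × ℝ => f z.1 * f z.2 :=
    (hf.comp measurable_fst).mul (hf.comp measurable_snd)
  have hb : ∀ z : ℝ × ℝ, ‖f z.1 * f z.2‖ ≤ c * c := fun z => by
    rw [Real.norm_eq_abs, abs_mul]
    exact mul_le_mul (hc _) (hc _) (abs_nonneg _) ((abs_nonneg _).trans (hc z.1))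
  have hInt : Integrable (fun z : ℝ × ℝ => f z.1 * f z.2) (μ.prod μ) :=
    Integrable.of_bound (C := c * c) hprod.aestronglyMeasurable (ae_of_all _ hb)
  set A : Set (ℝ × ℝ) := {z | z.2 ≤ z.1} with hA
  have hAm : MeasurableSet A := measurableSet_le measurable_snd measurable_fst
  have e1 : ∫ s, f s * ∫ t in Set.Iic s, f t ∂μ ∂μ
      = ∫ z in A, f z.1 * f z.2 ∂(μ.prod μ) := by
    rw [← integral_indicator hAm, integral_prod _ (hInt.indicator hAm)]
    refine integral_congr_ae (ae_of_all _ fun s => ?_)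
    simp only
    rw [← integral_const_mul, ← integral_indicator measurableSet_Iic]
    refine integral_congr_ae (ae_of_all _ fun t => ?_)
    simp only [Set.indicator, hA, Set.mem_ofPred_eq, Set.mem_Iic]
  -- The half-plane below the diagonal and its reflection cover the plane and overlap in the
  -- diagonal only, which is null without atoms; by symmetry each carries half of the double
  -- integral.
  have hdiag : (μ.prod μ) {z : ℝ × ℝ | z.1 = z.2} = 0 := by
    rw [Measure.measure_prod_null (measurableSet_eq_fun measurable_fst measurable_snd)]
    refine ae_of_all _ fun s => ?_
    have : Prod.mk s ⁻¹' {z : ℝ × ℝ | z.1 = z.2} = {s} := by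
      ext t; simp [eq_comm]
    change μ (Prod.mk s ⁻¹' {z : ℝ × ℝ | z.1 = z.2}) = 0
    rw [this]; simp
  have hcompl : ∫ z in Aᶜ, f z.1 * f z.2 ∂(μ.prod μ)
      = ∫ z in A, f z.1 * f z.2 ∂(μ.prod μ) := by
    have hswap : ∫ z in A, f z.1 * f z.2 ∂(μ.prod μ)
        = ∫ z in Prod.swap ⁻¹' A, f z.1 * f z.2 ∂(μ.prod μ) := by
      have h := (Measure.measurePreserving_swap (μ := μ) (ν := μ)).setIntegral_preimage_emb
        MeasurableEquiv.prodComm.measurableEmbedding (fun z => f z.1 * f z.2) A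
      rw [← h]
      refine integral_congr_ae (ae_of_all _ fun z => ?_)
      simp [mul_comm]
    rw [hswap]
    refine setIntegral_congr_set ?_
    rw [ae_eq_set]
    constructor
    · refine measure_mono_null (fun z hz => ?_) hdiag
      simp only [hA, Set.mem_sdiff, Set.mem_compl_iff, Set.mem_ofPred_eq, not_le, Set.mem_preimage,
        Prod.fst_swap, Prod.snd_swap] at hz ⊢
      exact absurd hz.1 (not_lt.2 hz.2.le)
    · refine measure_mono_null (fun z hz => ?_) hdiag
      simp only [hA, Set.mem_sdiff, Set.mem_compl_iff, Set.mem_ofPred_eq, not_not, Set.mem_preimage,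
        Prod.fst_swap, Prod.snd_swap] at hz ⊢
      exact le_antisymm hz.1 hz.2
  rw [e1, two_mul]
  nth_rewrite 2 [← hcompl]
  rw [integral_add_compl hAm hInt, integral_prod_mul f f, sq]

namespace HasHazard

variable {P : Measure Ω} [IsProbabilityMeasure P] {T : Ω → ℝ} {D : Set Ω} {π : Ω → E} {J : Set ℝ}
  {r : ℝ → E → ℝ≥0} (H : HasHazard P T D π J r)
include H

theorem measurable_r_section (e : E) : Measurable fun s => r s e :=
  H.measurable_r.comp (measurable_id.prodMk measurable_const)

theorem lintegral_hazardMeasure {f : ℝ → ℝ≥0∞} (hf : Measurable f) (t : ℝ) (e : E) :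
    ∫⁻ s, f s ∂(hazardMeasure J r t e)
      = ∫⁻ s, (J ∩ Set.Iic t).indicator (fun s => (r s e : ℝ≥0∞) * f s) s := by
  rw [hazardMeasure, lintegral_withDensity_eq_lintegral_mul _
    (H.measurable_r_section e).coe_nnreal_ennreal hf,
    lintegral_indicator (H.measurableSet_J.inter measurableSet_Iic)]
  rfl

theorem integral_hazardMeasure (f : ℝ → ℝ) (t : ℝ) (e : E) :
    ∫ s, f s ∂(hazardMeasure J r t e)
      = ∫ s, (J ∩ Set.Iic t).indicator (fun s => (r s e : ℝ) * f s) s := by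
  rw [hazardMeasure, integral_withDensity_eq_integral_smul (H.measurable_r_section e),
    integral_indicator (H.measurableSet_J.inter measurableSet_Iic)]
  rfl

theorem measurable_indicator_Iic {β : Type*} [MeasurableSpace β] [Zero β] {f : ℝ → E → β}
    (hf : Measurable (Function.uncurry f)) :
    Measurable fun z : (ℝ × E) × ℝ => (J ∩ Set.Iic z.1.1).indicator (fun s => f s z.1.2) z.2 := by
  have : (fun z : (ℝ × E) × ℝ => (J ∩ Set.Iic z.1.1).indicator (fun s => f s z.1.2) z.2)
      = {z : (ℝ × E) × ℝ | z.2 ∈ J ∧ z.2 ≤ z.1.1}.indicator fun z => f z.2 z.1.2 := by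
    funext z; rfl
  rw [this]
  refine Measurable.indicator (hf.comp (f := fun z : (ℝ × E) × ℝ => (z.2, z.1.2)) (by fun_prop)) ?_
  exact (H.measurableSet_J.preimage measurable_snd).inter
    (measurableSet_le measurable_snd (measurable_fst.comp measurable_fst))

theorem measurable_lintegral_hazardMeasure {f : ℝ → E → ℝ≥0∞}
    (hf : Measurable (Function.uncurry f)) :
    Measurable fun z : ℝ × E => ∫⁻ s, f s z.2 ∂(hazardMeasure J r z.1 z.2) := by
  have : (fun z : ℝ × E => ∫⁻ s, f s z.2 ∂(hazardMeasure J r z.1 z.2))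
      = fun z => ∫⁻ s, (J ∩ Set.Iic z.1).indicator (fun s => (r s z.2 : ℝ≥0∞) * f s z.2) s := by
    funext z
    exact H.lintegral_hazardMeasure (f := fun s => f s z.2)
      (hf.comp (measurable_id.prodMk measurable_const)) z.1 z.2
  rw [this]
  exact (H.measurable_indicator_Iic (f := fun s e => (r s e : ℝ≥0∞) * f s e)
    (H.measurable_r.coe_nnreal_ennreal.mul hf)).lintegral_prod_right'

theorem measurable_integral_hazardMeasure {f : ℝ → E → ℝ} (hf : Measurable (Function.uncurry f)) :
    Measurable fun z : ℝ × E => ∫ s, f s z.2 ∂(hazardMeasure J r z.1 z.2) := by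
  have : (fun z : ℝ × E => ∫ s, f s z.2 ∂(hazardMeasure J r z.1 z.2))
      = fun z => ∫ s, (J ∩ Set.Iic z.1).indicator (fun s => (r s z.2 : ℝ) * f s z.2) s := by
    funext z
    exact H.integral_hazardMeasure (fun s => f s z.2) z.1 z.2
  rw [this]
  exact (H.measurable_indicator_Iic (f := fun s e => (r s e : ℝ) * f s e)
    (H.measurable_r.coe_nnreal_real.mul hf)).stronglyMeasurable.integral_prod_right'.measurable

theorem measurable_prodMk : Measurable fun ω => (T ω, π ω) := H.measurable_T.prodMk H.measurable_π

theorem measurable_lintegral {f : ℝ → E → ℝ≥0∞} (hf : Measurable (Function.uncurry f)) :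
    Measurable fun ω => ∫⁻ s, f s (π ω) ∂(hazardMeasure J r (T ω) (π ω)) :=
  Measurable.comp (g := fun z : ℝ × E => ∫⁻ s, f s z.2 ∂(hazardMeasure J r z.1 z.2))
    (f := fun ω => (T ω, π ω)) (H.measurable_lintegral_hazardMeasure hf) H.measurable_prodMk

theorem measurable_integral {f : ℝ → E → ℝ} (hf : Measurable (Function.uncurry f)) :
    Measurable fun ω => ∫ s, f s (π ω) ∂(hazardMeasure J r (T ω) (π ω)) :=
  Measurable.comp (g := fun z : ℝ × E => ∫ s, f s z.2 ∂(hazardMeasure J r z.1 z.2))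
    (f := fun ω => (T ω, π ω)) (H.measurable_integral_hazardMeasure hf) H.measurable_prodMk

/-- Signed version of the defining identity. -/
theorem integral_eq {f : ℝ → E → ℝ} (hf : Measurable (Function.uncurry f))
    (hfin : ∫⁻ ω, (∫⁻ s, ‖f s (π ω)‖ₑ ∂(hazardMeasure J r (T ω) (π ω))) ∂P ≠ ∞) :
    Integrable (fun ω => D.indicator (fun ω => f (T ω) (π ω)) ω) P ∧
    Integrable (fun ω => ∫ s, f s (π ω) ∂(hazardMeasure J r (T ω) (π ω))) P ∧
    ∫ ω, D.indicator (fun ω => f (T ω) (π ω)) ω ∂P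
      = ∫ ω, (∫ s, f s (π ω) ∂(hazardMeasure J r (T ω) (π ω))) ∂P := by
  have hcomp : Measurable fun ω => D.indicator (fun ω => f (T ω) (π ω)) ω :=
    (hf.comp H.measurable_prodMk).indicator H.measurableSet_D
  have hi1 : Integrable (fun ω => D.indicator (fun ω => f (T ω) (π ω)) ω) P := by
    refine ⟨hcomp.aestronglyMeasurable, ?_⟩
    unfold HasFiniteIntegral
    have : ∀ ω, ‖D.indicator (fun ω => f (T ω) (π ω)) ω‖ₑ
        = D.indicator (fun ω => ‖f (T ω) (π ω)‖ₑ) ω := fun ω => enorm_indicator_eq_indicator_enorm _ _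
    simp_rw [this]
    rw [H.lintegral_eq (fun s e => ‖f s e‖ₑ) hf.enorm]
    exact hfin.lt_top
  have hpos : ∀ g : ℝ → E → ℝ, Measurable (Function.uncurry g) → (∀ s e, ‖g s e‖ₑ = ‖f s e‖ₑ) →
      Measurable (fun ω => ∫⁻ s, ENNReal.ofReal (g s (π ω)) ∂(hazardMeasure J r (T ω) (π ω))) ∧
      ∫⁻ ω, (∫⁻ s, ENNReal.ofReal (g s (π ω)) ∂(hazardMeasure J r (T ω) (π ω))) ∂P ≠ ∞ := by
    intro g hg hgf
    refine ⟨H.measurable_lintegral (f := fun s e => ENNReal.ofReal (g s e)) hg.ennreal_ofReal, ?_⟩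
    refine ((lintegral_mono fun ω => lintegral_mono fun s => ?_).trans_lt hfin.lt_top).ne
    rw [← hgf]; exact Real.ofReal_le_enorm _
  obtain ⟨hpm, hpf⟩ := hpos f hf fun _ _ => rfl
  obtain ⟨hnm, hnf⟩ := hpos (fun s e => -f s e) hf.neg fun _ _ => by simp
  have hae : ∀ᵐ ω ∂P, ∫ s, f s (π ω) ∂(hazardMeasure J r (T ω) (π ω))
      = (∫⁻ s, ENNReal.ofReal (f s (π ω)) ∂(hazardMeasure J r (T ω) (π ω))).toReal
        - (∫⁻ s, ENNReal.ofReal (-f s (π ω)) ∂(hazardMeasure J r (T ω) (π ω))).toReal := by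
    have hm : Measurable fun ω => ∫⁻ s, ‖f s (π ω)‖ₑ ∂(hazardMeasure J r (T ω) (π ω)) :=
      H.measurable_lintegral (f := fun s e => ‖f s e‖ₑ) hf.enorm
    filter_upwards [ae_lt_top hm hfin] with ω hω
    refine integral_eq_lintegral_pos_part_sub_lintegral_neg_part ⟨?_, hω⟩
    exact (hf.comp (measurable_id.prodMk measurable_const)).aestronglyMeasurable
  have hpi : Integrable (fun ω =>
      (∫⁻ s, ENNReal.ofReal (f s (π ω)) ∂(hazardMeasure J r (T ω) (π ω))).toReal) P :=
    integrable_toReal_of_lintegral_ne_top hpm.aemeasurable hpf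
  have hni : Integrable (fun ω =>
      (∫⁻ s, ENNReal.ofReal (-f s (π ω)) ∂(hazardMeasure J r (T ω) (π ω))).toReal) P :=
    integrable_toReal_of_lintegral_ne_top hnm.aemeasurable hnf
  refine ⟨hi1, (hpi.sub hni).congr (hae.mono fun ω h => h.symm), ?_⟩
  rw [integral_congr_ae hae, integral_sub hpi hni, integral_toReal hpm.aemeasurable
    (ae_lt_top hpm hpf), integral_toReal hnm.aemeasurable (ae_lt_top hnm hnf),
    integral_eq_lintegral_pos_part_sub_lintegral_neg_part hi1,
    ← H.lintegral_eq (fun s e => ENNReal.ofReal (f s e)) hf.ennreal_ofReal,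
    ← H.lintegral_eq (fun s e => ENNReal.ofReal (-f s e)) hf.neg.ennreal_ofReal]
  congr 2 <;>
  · congr 1
    funext ω
    simp only [Set.indicator]
    split_ifs <;> simp

/-- The total hazard up to the observation time. -/
noncomputable def total (_ : HasHazard P T D π J r) (ω : Ω) : ℝ≥0∞ :=
  hazardMeasure J r (T ω) (π ω) Set.univ

theorem measurable_hazardMeasure_univ :
    Measurable fun z : ℝ × E => hazardMeasure J r z.1 z.2 Set.univ := by
  have := H.measurable_lintegral_hazardMeasure (f := fun _ _ => 1) measurable_const
  simpa using this

theorem measurable_total : Measurable H.total :=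
  Measurable.comp (g := fun z : ℝ × E => hazardMeasure J r z.1 z.2 Set.univ)
    (f := fun ω => (T ω, π ω)) H.measurable_hazardMeasure_univ H.measurable_prodMk

/-- For `f = 1` the hazard identity says that the expected total hazard is the probability of an
event. -/
theorem lintegral_total_le_one : ∫⁻ ω, H.total ω ∂P ≤ 1 := by
  have h := H.lintegral_eq (fun _ _ => 1) measurable_const
  simp only [lintegral_one] at h
  change ∫⁻ ω, hazardMeasure J r (T ω) (π ω) Set.univ ∂P ≤ 1
  rw [← h]
  calc _ ≤ ∫⁻ _, 1 ∂P := lintegral_mono fun ω => Set.indicator_le_self' (by simp) ω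
    _ = 1 := by simp

theorem total_ae_lt_top : ∀ᵐ ω ∂P, H.total ω < ∞ :=
  ae_lt_top H.measurable_total (H.lintegral_total_le_one.trans_lt ENNReal.one_lt_top).ne

/-- Up to time `s` the hazard does not depend on which later time `t` ends observation. This turns
iterated integrals over the past into `hazardMeasure` at the earlier time. -/
theorem hazardMeasure_restrict_Iic {s t : ℝ} (hst : s ≤ t) (e : E) :
    (hazardMeasure J r t e).restrict (Set.Iic s) = hazardMeasure J r s e := by
  rw [hazardMeasure, hazardMeasure, restrict_withDensity measurableSet_Iic,
    Measure.restrict_restrict measurableSet_Iic]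
  congr 2
  ext x; simp only [Set.mem_inter_iff, Set.mem_Iic]
  exact ⟨fun h => ⟨h.2.1, h.1⟩, fun h => ⟨h.2, h.1, h.2.trans hst⟩⟩

theorem ae_hazardMeasure_le (t : ℝ) (e : E) : ∀ᵐ s ∂(hazardMeasure J r t e), s ≤ t := by
  refine (withDensity_absolutelyContinuous _ _).ae_le ?_
  filter_upwards [ae_restrict_mem (H.measurableSet_J.inter measurableSet_Iic)] with s hs using hs.2

/-- With `Λ(s)` the hazard accumulated up to `s`, one has `Λ(T)^(k+1) = (k+1) ∫ Λ(s)^k dΛ(s)`. By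
the hazard identity the mean of the integral is the mean of `Λ(T)^k` over events, which is at most
the previous moment. These are the moments of a standard exponential variable. -/
theorem lintegral_total_pow_le (k : ℕ) : ∫⁻ ω, H.total ω ^ k ∂P ≤ (k.factorial : ℝ≥0∞) := by
  induction k with
  | zero => simp
  | succ k ih =>
    have h := H.lintegral_eq (fun s e => hazardMeasure J r s e Set.univ ^ k)
      (H.measurable_hazardMeasure_univ.pow_const k)
    have hle : ∫⁻ ω, D.indicator (fun ω => hazardMeasure J r (T ω) (π ω) Set.univ ^ k) ω ∂P
        ≤ (k.factorial : ℝ≥0∞) :=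
      (lintegral_mono fun ω => Set.indicator_le_self' (fun _ _ => bot_le) ω).trans ih
    rw [h] at hle
    have heq : ∀ᵐ ω ∂P, H.total ω ^ (k + 1)
        = (k + 1 : ℝ≥0∞) * ∫⁻ s, hazardMeasure J r s (π ω) Set.univ ^ k
          ∂(hazardMeasure J r (T ω) (π ω)) := by
      filter_upwards [H.total_ae_lt_top] with ω hω
      set μ := hazardMeasure J r (T ω) (π ω) with hμ
      have hfin : IsFiniteMeasure μ := ⟨hω⟩
      have h1 := lintegral_ofReal_pow_measureReal_Iic μ k
      have h2 : ∫⁻ s, hazardMeasure J r s (π ω) Set.univ ^ k ∂μ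
          = ∫⁻ s, ENNReal.ofReal (μ.real (Set.Iic s) ^ k) ∂μ := by
        refine lintegral_congr_ae ?_
        filter_upwards [H.ae_hazardMeasure_le (T ω) (π ω)] with s hs
        rw [← H.hazardMeasure_restrict_Iic hs (π ω), Measure.restrict_apply_univ, ← hμ,
          ENNReal.ofReal_pow measureReal_nonneg, measureReal_def,
          ENNReal.ofReal_toReal (measure_ne_top _ _)]
      rw [h2, h1, ENNReal.ofReal_div_of_pos (by positivity), ENNReal.ofReal_pow measureReal_nonneg,
        measureReal_def, ENNReal.ofReal_toReal (measure_ne_top _ _)]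
      have e : ENNReal.ofReal ((k : ℝ) + 1) = (k + 1 : ℝ≥0∞) := by
        rw [ENNReal.ofReal_add (by positivity) zero_le_one]; simp
      rw [e, ENNReal.mul_div_cancel (by simp) (by finiteness)]
      rfl
    rw [lintegral_congr_ae heq, lintegral_const_mul _
      (H.measurable_lintegral (f := fun s e => hazardMeasure J r s e Set.univ ^ k)
        (H.measurable_hazardMeasure_univ.pow_const k))]
    calc _ ≤ (k + 1 : ℝ≥0∞) * (k.factorial : ℝ≥0∞) := by gcongr
      _ = _ := by rw [Nat.factorial_succ]; push_cast; rfl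

end HasHazard

end hazard

/-! ### Mean, variance and third moment of compensated integrals -/

section hazard

variable {Ω E : Type*} [MeasurableSpace Ω] [MeasurableSpace E]

/-- The integral of `f` against the event process minus its compensator. -/
noncomputable def compensatedIntegral (T : Ω → ℝ) (D : Set Ω) (π : Ω → E) (J : Set ℝ)
    (r : ℝ → E → ℝ≥0) (f : ℝ → E → ℝ) (ω : Ω) : ℝ :=
  D.indicator (fun ω => f (T ω) (π ω)) ω - ∫ s, f s (π ω) ∂(hazardMeasure J r (T ω) (π ω))

namespace HasHazard

variable {P : Measure Ω} [IsProbabilityMeasure P] {T : Ω → ℝ} {D : Set Ω} {π : Ω → E} {J : Set ℝ}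
  {r : ℝ → E → ℝ≥0} (H : HasHazard P T D π J r) {f : ℝ → E → ℝ} {c : ℝ}
include H

theorem measurable_compensatedIntegral (hf : Measurable (Function.uncurry f)) :
    Measurable (compensatedIntegral T D π J r f) :=
  ((hf.comp H.measurable_prodMk).indicator H.measurableSet_D).sub (H.measurable_integral hf)

theorem lintegral_enorm_ne_top (hc : ∀ s e, |f s e| ≤ c) :
    ∫⁻ ω, (∫⁻ s, ‖f s (π ω)‖ₑ ∂(hazardMeasure J r (T ω) (π ω))) ∂P ≠ ∞ := by
  have h1 : ∀ s e, ‖f s e‖ₑ ≤ ENNReal.ofReal c := fun s e => by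
    rw [Real.enorm_eq_ofReal_abs]; exact ENNReal.ofReal_le_ofReal (hc s e)
  refine ((lintegral_mono fun ω => lintegral_mono fun s => h1 s (π ω)).trans_lt ?_).ne
  simp_rw [lintegral_const]
  change ∫⁻ ω, ENNReal.ofReal c * H.total ω ∂P < ∞
  rw [lintegral_const_mul _ H.measurable_total]
  exact ENNReal.mul_lt_top ENNReal.ofReal_lt_top
    (H.lintegral_total_le_one.trans_lt ENNReal.one_lt_top)

theorem integral_compensatedIntegral (hf : Measurable (Function.uncurry f))
    (hc : ∀ s e, |f s e| ≤ c) : ∫ ω, compensatedIntegral T D π J r f ω ∂P = 0 := by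
  obtain ⟨h1, h2, h3⟩ := H.integral_eq hf (H.lintegral_enorm_ne_top hc)
  unfold compensatedIntegral
  rw [integral_sub h1 h2, h3, sub_self]

theorem abs_integral_le_total (hc : ∀ s e, |f s e| ≤ c) {ω : Ω} (hω : H.total ω < ∞) :
    |∫ s, f s (π ω) ∂(hazardMeasure J r (T ω) (π ω))| ≤ c * (H.total ω).toReal := by
  have hfin : IsFiniteMeasure (hazardMeasure J r (T ω) (π ω)) := ⟨hω⟩
  rw [← Real.norm_eq_abs]
  exact norm_integral_le_of_norm_le_const (ae_of_all _ fun s => hc s (π ω))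

theorem integrable_total_pow (k : ℕ) : Integrable (fun ω => (H.total ω).toReal ^ k) P := by
  simp_rw [← ENNReal.toReal_pow]
  exact integrable_toReal_of_lintegral_ne_top (H.measurable_total.pow_const k).aemeasurable
    ((H.lintegral_total_pow_le k).trans_lt (by finiteness)).ne

theorem integral_total_pow_le (k : ℕ) : ∫ ω, (H.total ω).toReal ^ k ∂P ≤ k.factorial := by
  simp_rw [← ENNReal.toReal_pow]
  have hne : ∫⁻ ω, H.total ω ^ k ∂P ≠ ∞ :=
    ((H.lintegral_total_pow_le k).trans_lt (by finiteness)).ne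
  rw [integral_toReal (H.measurable_total.pow_const k).aemeasurable
    (ae_lt_top (H.measurable_total.pow_const k) hne)]
  exact ENNReal.toReal_le_of_le_ofReal (by positivity) (by simpa using H.lintegral_total_pow_le k)

theorem abs_compensatedIntegral_le (hc : ∀ s e, |f s e| ≤ c) (hc0 : 0 ≤ c) :
    ∀ᵐ ω ∂P, |compensatedIntegral T D π J r f ω| ≤ c * (1 + (H.total ω).toReal) := by
  filter_upwards [H.total_ae_lt_top] with ω hω
  have h1 : |D.indicator (fun ω => f (T ω) (π ω)) ω| ≤ c := by
    simp only [Set.indicator]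
    split_ifs
    · exact hc _ _
    · simpa using hc0
  have h2 := H.abs_integral_le_total hc hω
  have h3 := abs_sub (D.indicator (fun ω => f (T ω) (π ω)) ω)
    (∫ s, f s (π ω) ∂(hazardMeasure J r (T ω) (π ω)))
  unfold compensatedIntegral
  linarith

/-- The integral is at most `c (1 + Λ)` with `Λ` the total hazard. From `(1 + x)³ ≤ 4 (1 + x³)` and
`E Λ³ ≤ 6` comes `28 = 4 · 7`. -/
theorem integral_abs_pow_three_le (hf : Measurable (Function.uncurry f))
    (hc : ∀ s e, |f s e| ≤ c) (hc0 : 0 ≤ c) :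
    Integrable (fun ω => |compensatedIntegral T D π J r f ω| ^ 3) P ∧
    ∫ ω, |compensatedIntegral T D π J r f ω| ^ 3 ∂P ≤ 28 * c ^ 3 := by
  have hle : ∀ᵐ ω ∂P, |compensatedIntegral T D π J r f ω| ^ 3
      ≤ 4 * c ^ 3 * (1 + (H.total ω).toReal ^ 3) := by
    filter_upwards [H.abs_compensatedIntegral_le hc hc0] with ω hω
    refine (pow_le_pow_left₀ (abs_nonneg _) hω 3).trans ?_
    set x := (H.total ω).toReal with hx
    have hx0 : 0 ≤ x := ENNReal.toReal_nonneg
    rw [mul_pow, mul_comm (4 : ℝ), mul_assoc]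
    refine mul_le_mul_of_nonneg_left ?_ (pow_nonneg hc0 3)
    nlinarith [mul_nonneg (by linarith : 0 ≤ 1 + x) (sq_nonneg (1 - x))]
  have hg : Integrable (fun ω => 4 * c ^ 3 * (1 + (H.total ω).toReal ^ 3)) P :=
    ((integrable_const (1 : ℝ)).add (H.integrable_total_pow 3)).const_mul _
  have hm := (H.measurable_compensatedIntegral hf).abs.pow_const 3
  refine ⟨hg.mono' hm.aestronglyMeasurable (hle.mono fun ω h => ?_), ?_⟩
  · rw [Real.norm_eq_abs, abs_of_nonneg (pow_nonneg (abs_nonneg _) 3)]; exact h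
  · refine (integral_mono_of_nonneg (ae_of_all _ fun _ => pow_nonneg (abs_nonneg _) 3) hg
      hle).trans ?_
    rw [integral_const_mul, integral_add (integrable_const _) (H.integrable_total_pow 3)]
    have h6 := H.integral_total_pow_le 3
    have h7 : ((Nat.factorial 3 : ℕ) : ℝ) = 6 := by norm_num [Nat.factorial]
    rw [h7] at h6
    have : 4 * c ^ 3 * (1 + ∫ ω, (H.total ω).toReal ^ 3 ∂P) ≤ 4 * c ^ 3 * 7 :=
      mul_le_mul_of_nonneg_left (by linarith) (by positivity)
    simp only [integral_const, probReal_univ, one_smul]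
    linarith

/-- The variance of a compensated integral. -/
theorem integral_sq_compensatedIntegral (hf : Measurable (Function.uncurry f))
    (hc : ∀ s e, |f s e| ≤ c) :
    ∫ ω, compensatedIntegral T D π J r f ω ^ 2 ∂P
      = ∫ ω, D.indicator (fun ω => f (T ω) (π ω) ^ 2) ω ∂P := by
  let I : ℝ → E → ℝ := fun t e => ∫ s, f s e ∂(hazardMeasure J r t e)
  have hI : Measurable (Function.uncurry I) := H.measurable_integral_hazardMeasure hf
  have hfI : Measurable (Function.uncurry fun s e => f s e * I s e) := hf.mul hI
  -- the compensator of `f I` is half the square of that of `f`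
  have hhalf : ∀ᵐ ω ∂P, 2 * ∫ s, f s (π ω) * I s (π ω) ∂(hazardMeasure J r (T ω) (π ω))
      = I (T ω) (π ω) ^ 2 := by
    filter_upwards [H.total_ae_lt_top] with ω hω
    have hfin : IsFiniteMeasure (hazardMeasure J r (T ω) (π ω)) := ⟨hω⟩
    have hfm : Measurable fun s => f s (π ω) := hf.comp (measurable_id.prodMk measurable_const)
    rw [← integral_mul_integral_Iic (hazardMeasure J r (T ω) (π ω)) hfm (fun s => hc s (π ω))]
    congr 1
    refine integral_congr_ae ?_
    filter_upwards [H.ae_hazardMeasure_le (T ω) (π ω)] with s hs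
    rw [H.hazardMeasure_restrict_Iic hs (π ω)]
  -- Since `|I| ≤ c Λ`, the inner integral is at most `c² Λ²`, which is integrable by the moment
  -- bound.
  have hfinI : ∫⁻ ω, (∫⁻ s, ‖f s (π ω) * I s (π ω)‖ₑ ∂(hazardMeasure J r (T ω) (π ω))) ∂P ≠ ∞ := by
    have hae : ∀ᵐ ω ∂P, (∫⁻ s, ‖f s (π ω) * I s (π ω)‖ₑ ∂(hazardMeasure J r (T ω) (π ω)))
        ≤ ENNReal.ofReal (c * c) * H.total ω ^ 2 := by
      filter_upwards [H.total_ae_lt_top] with ω hω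
      have hfin : IsFiniteMeasure (hazardMeasure J r (T ω) (π ω)) := ⟨hω⟩
      have hc0 : 0 ≤ c := (abs_nonneg _).trans (hc 0 (π ω))
      calc _ ≤ ∫⁻ _, ENNReal.ofReal (c * c) * H.total ω ∂(hazardMeasure J r (T ω) (π ω)) := by
            refine lintegral_mono_ae ?_
            filter_upwards [H.ae_hazardMeasure_le (T ω) (π ω)] with s hs
            have hb : |I s (π ω)| ≤ c * (H.total ω).toReal := by
              have h1 : |I s (π ω)| ≤ c * (hazardMeasure J r s (π ω)).real Set.univ := by
                have : IsFiniteMeasure (hazardMeasure J r s (π ω)) := by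
                  rw [← H.hazardMeasure_restrict_Iic hs (π ω)]; infer_instance
                rw [← Real.norm_eq_abs]
                exact norm_integral_le_of_norm_le_const (ae_of_all _ fun s => hc s (π ω))
              refine h1.trans (mul_le_mul_of_nonneg_left ?_ hc0)
              rw [← H.hazardMeasure_restrict_Iic hs (π ω), measureReal_restrict_apply_univ]
              exact measureReal_mono (Set.subset_univ _)
            have h2 : |f s (π ω) * I s (π ω)| ≤ c * c * (H.total ω).toReal := by
              rw [abs_mul, mul_assoc]
              exact mul_le_mul (hc _ _) hb (abs_nonneg _) hc0
            rw [Real.enorm_eq_ofReal_abs]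
            refine (ENNReal.ofReal_le_ofReal h2).trans (le_of_eq ?_)
            rw [ENNReal.ofReal_mul (mul_nonneg hc0 hc0), ENNReal.ofReal_toReal hω.ne]
        _ = _ := by rw [lintegral_const, mul_assoc, sq]; rfl
    refine ((lintegral_mono_ae hae).trans_lt ?_).ne
    rw [lintegral_const_mul _ (H.measurable_total.pow_const 2)]
    exact ENNReal.mul_lt_top ENNReal.ofReal_lt_top
      ((H.lintegral_total_pow_le 2).trans_lt (by finiteness))
  obtain ⟨hi1, hi2, hi3⟩ := H.integral_eq hfI hfinI
  have hf2 : ∀ s e, |f s e ^ 2| ≤ c ^ 2 := fun s e => by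
    rw [abs_pow]; exact pow_le_pow_left₀ (abs_nonneg _) (hc s e) 2
  obtain ⟨hj1, -, -⟩ := H.integral_eq (f := fun s e => f s e ^ 2) (hf.pow_const 2)
    (H.lintegral_enorm_ne_top hf2)
  have hIsq : Integrable (fun ω => I (T ω) (π ω) ^ 2) P :=
    (hi2.const_mul 2).congr hhalf
  have e : ∀ ω, compensatedIntegral T D π J r f ω ^ 2
      = D.indicator (fun ω => f (T ω) (π ω) ^ 2) ω
        - 2 * D.indicator (fun ω => f (T ω) (π ω) * I (T ω) (π ω)) ω + I (T ω) (π ω) ^ 2 := by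
    intro ω
    unfold compensatedIntegral
    change (_ - I (T ω) (π ω)) ^ 2 = _
    simp only [Set.indicator]
    split_ifs <;> ring
  simp_rw [e]
  have hsub : Integrable (fun ω => D.indicator (fun ω => f (T ω) (π ω) ^ 2) ω
        - 2 * D.indicator (fun ω => f (T ω) (π ω) * I (T ω) (π ω)) ω) P := hj1.sub (hi1.const_mul 2)
  -- The cross term cancels the square of the compensator: by the hazard identity, twice the mean of
  -- `f I` over events is the mean of twice the integral of `f I` against the hazard, that is of
  -- `I²`.
  rw [integral_add hsub hIsq, integral_sub hj1 (hi1.const_mul 2), integral_const_mul, hi3,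
    ← integral_congr_ae hhalf, integral_const_mul]
  ring

end HasHazard

end hazard

/-! ### Identification of the projection with the compensator -/

namespace IsRiskModel

variable {Ω E : Type*} [MeasurableSpace Ω] [MeasurableSpace E]
  {P : Measure Ω} [IsProbabilityMeasure P] {T : Ω → ℝ} {D : Set Ω} {π : Ω → E} {J : Set ℝ}
  {haz : ℝ → ℝ≥0} {w b : ℝ → E → ℝ} {κ h : ℝ}
  (R : IsRiskModel P T D (fun s x => w s (π x)) (fun s x => b s (π x)) κ h)
  (H : HasHazard P T D π J (fun s e => haz s * (w s e).toNNReal))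

/-- The integrand of the influence function. -/
noncomputable def centredIntegrand (P : Measure Ω) (T : Ω → ℝ) (π : Ω → E) (w b : ℝ → E → ℝ)
    (s : ℝ) (e : E) : ℝ :=
  b s e - riskTilt P T (fun s x => w s (π x)) (fun s x => b s (π x)) s

include R

theorem measurable_centredIntegrand (hb : Measurable (Function.uncurry b)) :
    Measurable (Function.uncurry (centredIntegrand P T π w b)) :=
  hb.sub (R.measurable_riskTilt.comp measurable_fst)

theorem abs_centredIntegrand_le (hb : ∀ s e, |b s e| ≤ κ) (s : ℝ) (e : E) :
    |centredIntegrand P T π w b s e| ≤ 2 * κ := by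
  have h1 := abs_sub (b s e) (riskTilt P T (fun s x => w s (π x)) (fun s x => b s (π x)) s)
  have h2 := hb s e
  have h3 := R.abs_riskTilt_le s
  unfold centredIntegrand
  linarith

include H

/-- The projection of the linear kernel is a gated compensator. -/
theorem linProj_eq {ε : ℝ} (hε : 0 < ε) (y : Ω) :
    linProj P T D (fun s x => w s (π x)) (fun s x => b s (π x)) ε y
      = ∫ s, {s | ε ≤ survivalFun P T s}.indicator
        (fun s => centredIntegrand P T π w b s (π y)) s
        ∂(hazardMeasure J (fun s e => haz s * (w s e).toNNReal) (T y) (π y)) := by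
  set w' : ℝ → Ω → ℝ := fun s x => w s (π x) with hw'
  set b' : ℝ → Ω → ℝ := fun s x => b s (π x) with hb'
  set r : ℝ → E → ℝ≥0 := fun s e => haz s * (w s e).toNNReal with hr
  set τ : Set ℝ := {s | ε ≤ survivalFun P T s} with hτ
  have hτm : MeasurableSet τ := measurableSet_le measurable_const R.measurable_survivalFun
  -- For fixed `y` the kernel depends on `x` only through membership in `D` and the time `T x`, so
  -- its mean over `x` is an event mean to which the hazard identity applies.
  let q : ℝ → ℝ := fun s => τ.indicator (fun s => riskResidual P T w' b' s y / riskMean P T w' s) s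
  have hqm : Measurable q :=
    ((R.measurable_riskResidual.comp (measurable_id.prodMk measurable_const)).div
      R.measurable_riskMean).indicator hτm
  have hdpos : ∀ s ∈ τ, h⁻¹ * ε ≤ riskMean P T w' s := fun s hs =>
    (mul_le_mul_of_nonneg_left hs (inv_nonneg.2 R.h_pos.le)).trans (R.inv_mul_survivalFun_le s)
  have hhε : 0 < h⁻¹ * ε := mul_pos (inv_pos.2 R.h_pos) hε
  have hκ := R.pos_κ
  have hh := R.h_pos
  have hqb : ∀ s, |q s| ≤ 2 * κ * h / (h⁻¹ * ε) := by
    intro s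
    simp only [q, Set.indicator]
    split_ifs with hs
    · rw [abs_div]
      have h1 : |riskResidual P T w' b' s y| ≤ 2 * κ * h := by
        refine (R.abs_riskResidual_le s y).trans ?_
        exact mul_le_of_le_one_right (by positivity) (atRisk_le_one _ _ _)
      refine div_le_div₀ (by positivity) h1 hhε ?_
      exact (hdpos s hs).trans (le_abs_self _)
    · rw [abs_zero]; positivity
  have hfin := H.lintegral_enorm_ne_top (f := fun s _ => q s) (fun s _ => hqb s)
  obtain ⟨-, -, hI⟩ := H.integral_eq (f := fun s _ => q s) (hqm.comp measurable_fst) hfin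
  have hlin : linProj P T D w' b' ε y = ∫ x, D.indicator (fun x => q (T x)) x ∂P := by
    unfold linProj linKernel gate
    refine integral_congr_ae (ae_of_all _ fun x => ?_)
    simp only [q, Set.indicator, hτ, Set.mem_ofPred_eq]
    split_ifs <;> simp
  rw [hlin, hI]
  let G : Ω → ℝ → ℝ := fun x s => (J ∩ Set.Iic (T x)).indicator (fun s => (r s (π x) : ℝ) * q s) s
  have hGm : Measurable (Function.uncurry G) :=
    Measurable.comp
      (g := fun z : (ℝ × E) × ℝ => (J ∩ Set.Iic z.1.1).indicator
        (fun s => (r s z.1.2 : ℝ) * q s) z.2)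
      (f := fun z : Ω × ℝ => ((T z.1, π z.1), z.2))
      (H.measurable_indicator_Iic (f := fun s e => (r s e : ℝ) * q s)
        (H.measurable_r.coe_nnreal_real.mul (hqm.comp measurable_fst)))
      ((H.measurable_prodMk.comp measurable_fst).prodMk measurable_snd)
  have hGi : Integrable (Function.uncurry G) (P.prod volume) := by
    refine ⟨hGm.aestronglyMeasurable, ?_⟩
    unfold HasFiniteIntegral
    rw [lintegral_prod _ hGm.enorm.aemeasurable]
    refine lt_of_eq_of_lt ?_ hfin.lt_top
    refine lintegral_congr fun x => ?_
    rw [H.lintegral_hazardMeasure hqm.enorm]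
    refine lintegral_congr fun s => ?_
    simp only [Function.uncurry, G, Set.indicator]
    split_ifs
    · rw [enorm_mul]; congr 1; simp [Real.enorm_eq_ofReal_abs]
    · simp
  have e1 : ∫ x, (∫ s, q s ∂(hazardMeasure J r (T x) (π x))) ∂P = ∫ x, (∫ s, G x s) ∂P := by
    refine integral_congr_ae (ae_of_all _ fun x => ?_)
    exact H.integral_hazardMeasure q (T x) (π x)
  rw [e1, integral_integral_swap hGi, H.integral_hazardMeasure]
  refine integral_congr_ae (ae_of_all _ fun s => ?_)
  have hw0 : ∀ s x, 0 < w s (π x) := fun s x => R.w_pos s x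
  -- At a fixed time `s` the only dependence on `x` is through the weight at risk. Its mean is
  -- `riskMean`, which cancels the denominator of `q` and leaves the hazard of `y` itself.
  have e2 : ∀ x, G x s = J.indicator (fun s => (haz s : ℝ) * q s) s *
      (atRisk T s x * w' s x) := by
    intro x
    simp only [G, Set.indicator, Set.mem_inter_iff, Set.mem_Iic, atRisk, hr, hw']
    by_cases h1 : s ∈ J <;> by_cases h2 : s ≤ T x <;> simp [h1, h2, (hw0 s x).le]
    ring
  simp_rw [e2]
  rw [integral_const_mul]
  change _ * riskMean P T w' s = _
  by_cases hs : s ∈ τ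
  · have hd : riskMean P T w' s ≠ 0 := (hhε.trans_le (hdpos s hs)).ne'
    simp only [q, Set.indicator, hs, if_true, Set.mem_inter_iff, Set.mem_Iic, riskResidual, atRisk,
      centredIntegrand, hr]
    by_cases h1 : s ∈ J <;> by_cases h2 : s ≤ T y <;> simp [h1, h2, (hw0 s y).le]
    field_simp
    rfl
  · simp only [q, Set.indicator, hs, if_false, Set.mem_inter_iff]
    simp

/-- The two functions differ by the compensator over times with survival probability below `ε`. The
expected hazard accumulated there is the probability of an event there, at most `ε`, and the
integrand is at most `2κ`. -/
theorem lintegral_abs_gatedInfluence_sub_le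
    (hbm : Measurable (Function.uncurry b)) (hb : ∀ s e, |b s e| ≤ κ) {ε : ℝ} (hε : 0 < ε) :
    ∫⁻ y, ENNReal.ofReal |gatedInfluence P T D (fun s x => w s (π x)) (fun s x => b s (π x)) ε y
      - compensatedIntegral T D π J (fun s e => haz s * (w s e).toNNReal)
        (centredIntegrand P T π w b) y| ∂P ≤ ENNReal.ofReal (2 * κ * ε) := by
  set r : ℝ → E → ℝ≥0 := fun s e => haz s * (w s e).toNNReal with hr
  set τ : Set ℝ := {s | ε ≤ survivalFun P T s} with hτ
  have hτm : MeasurableSet τ := measurableSet_le measurable_const R.measurable_survivalFun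
  have hκ := R.pos_κ
  have hfm := R.measurable_centredIntegrand hbm
  have hfb := R.abs_centredIntegrand_le hb
  have hpt : ∀ᵐ y ∂P, ENNReal.ofReal
      |gatedInfluence P T D (fun s x => w s (π x)) (fun s x => b s (π x)) ε y
        - compensatedIntegral T D π J r (centredIntegrand P T π w b) y|
      ≤ ENNReal.ofReal (2 * κ) *
        ∫⁻ s, τᶜ.indicator (fun _ => (1 : ℝ≥0∞)) s ∂(hazardMeasure J r (T y) (π y)) := by
    filter_upwards [H.total_ae_lt_top] with y hy
    have hfin : IsFiniteMeasure (hazardMeasure J r (T y) (π y)) := ⟨hy⟩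
    set μ := hazardMeasure J r (T y) (π y) with hμ
    set f : ℝ → ℝ := fun s => centredIntegrand P T π w b s (π y) with hf
    have hf' : Measurable f := hfm.comp (measurable_id.prodMk measurable_const)
    have hfi : Integrable f μ :=
      Integrable.of_bound (C := 2 * κ) hf'.aestronglyMeasurable (ae_of_all _ fun s => hfb s (π y))
    have e : gatedInfluence P T D (fun s x => w s (π x)) (fun s x => b s (π x)) ε y
        - compensatedIntegral T D π J r (centredIntegrand P T π w b) y
        = ∫ s in τᶜ, f s ∂μ := by
      have h1 := R.linProj_eq H hε y
      unfold gatedInfluence compensatedIntegral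
      rw [h1]
      change (_ - ∫ s, τ.indicator f s ∂μ) - (_ - ∫ s, f s ∂μ) = _
      rw [integral_indicator hτm, ← integral_add_compl hτm hfi]
      simp only [centredIntegrand]
      ring
    rw [e, lintegral_indicator hτm.compl, lintegral_one, Measure.restrict_apply_univ]
    have h2 : ‖∫ s in τᶜ, f s ∂μ‖ ≤ 2 * κ * μ.real τᶜ := by
      refine norm_setIntegral_le_of_norm_le_const (measure_lt_top _ _) fun s _ => hfb s (π y)
    rw [Real.norm_eq_abs] at h2
    refine (ENNReal.ofReal_le_ofReal h2).trans (le_of_eq ?_)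
    rw [ENNReal.ofReal_mul (by positivity), measureReal_def,
      ENNReal.ofReal_toReal (measure_ne_top _ _)]
  have hgm : Measurable (Function.uncurry fun (s : ℝ) (_ : E) => τᶜ.indicator
      (fun _ => (1 : ℝ≥0∞)) s) :=
    (measurable_const.indicator hτm.compl).comp measurable_fst
  refine (lintegral_mono_ae hpt).trans ?_
  rw [lintegral_const_mul _ (H.measurable_lintegral hgm), ← H.lintegral_eq _ hgm,
    ENNReal.ofReal_mul (p := 2 * κ) (by positivity)]
  refine mul_le_mul' le_rfl ?_
  have hle := R.measureReal_survivalFun_lt_le hε.le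
  have hset : MeasurableSet {x | survivalFun P T (T x) < ε} :=
    measurableSet_lt (R.measurable_survivalFun.comp R.measurable_T) measurable_const
  calc _ ≤ ∫⁻ x, {x | survivalFun P T (T x) < ε}.indicator (fun _ => (1 : ℝ≥0∞)) x ∂P := by
        refine lintegral_mono fun x => ?_
        have : {x | survivalFun P T (T x) < ε} = T ⁻¹' τᶜ := by
          ext x; simp [hτ]
        rw [this]
        by_cases hx : x ∈ D
        · rw [Set.indicator_of_mem hx]; rfl
        · rw [Set.indicator_of_notMem hx]; exact bot_le
    _ = P {x | survivalFun P T (T x) < ε} := by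
        rw [lintegral_indicator hset, lintegral_one, Measure.restrict_apply_univ]
    _ ≤ ENNReal.ofReal ε := by
        rw [← ENNReal.ofReal_toReal (measure_ne_top P _)]
        exact ENNReal.ofReal_le_ofReal hle

/-- The normalised score is close in `L¹` to the normalised sum of compensated integrals. -/
theorem lintegral_abs_normalizedScore_sub_compensated_le {Ω' : Type*} [MeasurableSpace Ω']
    {P' : Measure Ω'} [IsProbabilityMeasure P'] {n : ℕ} {ξ : Fin n → Ω' → Ω}
    (hlaw : ∀ i, MeasurePreserving (ξ i) P' P) (hind : iIndepFun ξ P') (hn : 0 < n)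
    (hbm : Measurable (Function.uncurry b)) (hb : ∀ s e, |b s e| ≤ κ) :
    ∫⁻ ω, ENNReal.ofReal |normalizedScore T D (fun s x => w s (π x)) (fun s x => b s (π x))
        (fun i => ξ i ω)
      - (√(n : ℝ))⁻¹ * ∑ i, compensatedIntegral T D π J (fun s e => haz s * (w s e).toNNReal)
        (centredIntegrand P T π w b) (ξ i ω)| ∂P'
      ≤ ENNReal.ofReal (42 * κ * h ^ 4 * (1 + Real.log n) * (√(n : ℝ))⁻¹) := by
  set w' : ℝ → Ω → ℝ := fun s x => w s (π x) with hw'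
  set b' : ℝ → Ω → ℝ := fun s x => b s (π x) with hb'
  set r : ℝ → E → ℝ≥0 := fun s e => haz s * (w s e).toNNReal with hr
  set γ := gatedInfluence P T D w' b' (n : ℝ)⁻¹ with hγ
  set ψ := compensatedIntegral T D π J r (centredIntegrand P T π w b) with hψ
  have hκ := R.pos_κ
  have hn' : (0 : ℝ) < n := by exact_mod_cast hn
  have hn1 : (1 : ℝ) ≤ n := by exact_mod_cast hn
  have hlog0 : 0 ≤ Real.log n := Real.log_nonneg hn1
  have hsn : 0 ≤ (√(n : ℝ))⁻¹ := inv_nonneg.2 (Real.sqrt_nonneg _)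
  have hγm : Measurable γ := by
    refine Measurable.sub ?_ (R.measurable_linProj _)
    refine Measurable.indicator ?_ R.measurableSet_D
    exact (R.measurable_b.comp (R.measurable_T.prodMk measurable_id)).sub
      (R.measurable_riskTilt.comp R.measurable_T)
  have hψm : Measurable ψ :=
    H.measurable_compensatedIntegral (R.measurable_centredIntegrand hbm)
  have hdm : Measurable fun y => ENNReal.ofReal |γ y - ψ y| :=
    (hγm.sub hψm).abs.ennreal_ofReal
  have hA := R.lintegral_abs_normalizedScore_sub_le hlaw hind hn
  have hB := R.lintegral_abs_gatedInfluence_sub_le H hbm hb (inv_pos.2 hn')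
  have hpt : ∀ ω, ENNReal.ofReal |normalizedScore T D w' b' (fun i => ξ i ω)
      - (√(n : ℝ))⁻¹ * ∑ i, ψ (ξ i ω)|
      ≤ ENNReal.ofReal |normalizedScore T D w' b' (fun i => ξ i ω)
        - (√(n : ℝ))⁻¹ * ∑ i, γ (ξ i ω)|
        + ENNReal.ofReal (√(n : ℝ))⁻¹ * ∑ i, ENNReal.ofReal |γ (ξ i ω) - ψ (ξ i ω)| := by
    intro ω
    rw [← ENNReal.ofReal_sum_of_nonneg (fun i _ => abs_nonneg _), ← ENNReal.ofReal_mul hsn,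
      ← ENNReal.ofReal_add (abs_nonneg _)
        (mul_nonneg hsn (Finset.sum_nonneg fun i _ => abs_nonneg _))]
    refine ENNReal.ofReal_le_ofReal ?_
    have e : normalizedScore T D w' b' (fun i => ξ i ω) - (√(n : ℝ))⁻¹ * ∑ i, ψ (ξ i ω)
        = (normalizedScore T D w' b' (fun i => ξ i ω) - (√(n : ℝ))⁻¹ * ∑ i, γ (ξ i ω))
          + (√(n : ℝ))⁻¹ * ∑ i, (γ (ξ i ω) - ψ (ξ i ω)) := by
      rw [Finset.sum_sub_distrib]; ring
    rw [e]
    refine (abs_add_le _ _).trans (add_le_add le_rfl ?_)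
    rw [abs_mul, abs_of_nonneg hsn]
    exact mul_le_mul_of_nonneg_left (Finset.abs_sum_le_sum_abs _ _) hsn
  have hterm : ∀ i, Measurable fun ω => ENNReal.ofReal |γ (ξ i ω) - ψ (ξ i ω)| := fun i =>
    hdm.comp (hlaw i).measurable
  refine (lintegral_mono hpt).trans ?_
  rw [lintegral_add_right _ ((Finset.measurable_fun_sum _ fun i _ => hterm i).const_mul _),
    lintegral_const_mul _ (Finset.measurable_fun_sum _ fun i _ => hterm i),
    lintegral_finsetSum _ fun i _ => hterm i]
  have hC : ∀ i, ∫⁻ ω, ENNReal.ofReal |γ (ξ i ω) - ψ (ξ i ω)| ∂P'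
      ≤ ENNReal.ofReal (2 * κ * (n : ℝ)⁻¹) := by
    intro i
    rw [(hlaw i).lintegral_comp hdm]
    exact hB
  calc _ ≤ ENNReal.ofReal (40 * κ * h ^ 4 * (1 + Real.log n) * (√(n : ℝ))⁻¹)
        + ENNReal.ofReal (√(n : ℝ))⁻¹ * ∑ _i : Fin n, ENNReal.ofReal (2 * κ * (n : ℝ)⁻¹) := by
        gcongr with i; exact hC i
    _ = ENNReal.ofReal (40 * κ * h ^ 4 * (1 + Real.log n) * (√(n : ℝ))⁻¹
        + (√(n : ℝ))⁻¹ * (2 * κ)) := by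
        rw [← ENNReal.ofReal_sum_of_nonneg (fun i _ => by positivity), ← ENNReal.ofReal_mul hsn,
          ← ENNReal.ofReal_add (by positivity [R.h_pos]) (by positivity)]
        congr 2
        rw [Finset.sum_const, Finset.card_univ, Fintype.card_fin, nsmul_eq_mul]
        field_simp
    _ ≤ _ := by
        refine ENNReal.ofReal_le_ofReal ?_
        have h4 : 1 ≤ h ^ 4 := one_le_pow₀ R.one_le_h
        have h5 : κ ≤ κ * h ^ 4 * (1 + Real.log n) := by
          calc κ ≤ κ * h ^ 4 := le_mul_of_one_le_right hκ.le h4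
            _ ≤ _ := le_mul_of_one_le_right (by positivity) (by linarith)
        have := mul_le_mul_of_nonneg_left h5 hsn
        linarith

end IsRiskModel

/-! ### A jointly measurable version of the covariate process -/

/-- The largest multiple of `1 / (k + 1)` which is at most `s`. -/
noncomputable def gridFloor (k : ℕ) (s : ℝ) : ℝ := ⌊s * (k + 1)⌋ / (k + 1)

theorem gridFloor_nonneg (k : ℕ) {s : ℝ} (hs : 0 ≤ s) : 0 ≤ gridFloor k s := by
  unfold gridFloor
  have : (0 : ℝ) ≤ ⌊s * (k + 1)⌋ := by exact_mod_cast Int.floor_nonneg.2 (by positivity)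
  positivity

theorem gridFloor_le (k : ℕ) (s : ℝ) : gridFloor k s ≤ s := by
  unfold gridFloor
  rw [div_le_iff₀ (by positivity)]
  exact Int.floor_le _

theorem tendsto_gridFloor (s : ℝ) : Tendsto (fun k => gridFloor k s) atTop (𝓝 s) := by
  have h : Tendsto (fun k : ℕ => s - 1 / ((k : ℝ) + 1)) atTop (𝓝 s) := by
    simpa using tendsto_const_nhds.sub (tendsto_one_div_add_atTop_nhds_zero_nat (𝕜 := ℝ))
  refine tendsto_of_tendsto_of_tendsto_of_le_of_le h tendsto_const_nhds (fun k => ?_)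
    fun k => gridFloor_le k s
  have hk : (0 : ℝ) < k + 1 := by positivity
  simp only [gridFloor]
  rw [le_div_iff₀ hk, sub_mul, one_div, inv_mul_cancel₀ hk.ne']
  exact (Int.sub_one_lt_floor _).le

namespace SurvivalTriple

variable {Ω : Type*} [MeasurableSpace Ω] {p : ℕ} (X : SurvivalTriple Ω p) (P : Measure Ω)

/-- The space of paths of the covariate process. -/
abbrev Path : Type := {t : ℝ // t ∈ X.timeSet P} → Fin p → ℝ

/-- The path of the covariate process. -/
def path (ω : Ω) : X.Path P := fun t => X.Z t ω

theorem measurable_path : Measurable (X.path P) := measurable_pi_lambda _ fun t => X.measurable_Z t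

/-- Conditioning on the covariates is thereby conditioning on a single random element, for which
conditional distributions are available. -/
theorem comap_path :
    MeasurableSpace.comap (X.path P) inferInstance = X.covariateSigma P := by
  change MeasurableSpace.comap _ MeasurableSpace.pi = _
  rw [MeasurableSpace.pi, MeasurableSpace.comap_iSup]
  refine iSup_congr fun t => ?_
  rw [MeasurableSpace.comap_comp]
  rfl

open Classical in
/-- The value of a path at time `t`, extended by zero outside the time index set. -/
noncomputable def pathValue (e : X.Path P) (t : ℝ) : Fin p → ℝ :=
  if h : t ∈ X.timeSet P then e ⟨t, h⟩ else 0

theorem measurable_pathValue (t : ℝ) : Measurable fun e => X.pathValue P e t := by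
  unfold pathValue
  split_ifs with h
  · exact measurable_pi_apply _
  · exact measurable_const

/-- A jointly measurable version of the covariate process, bounded by `K`, as a functional of the
path. -/
noncomputable def covariateVersion (K : ℝ) (s : ℝ) (e : X.Path P) (j : Fin p) : ℝ :=
  max (-K) (min K (limsup (fun k => X.pathValue P e (gridFloor k s) j) atTop))

/-- Each approximation depends on `s` only through an integer, so joint measurability reduces to
measurability of countably many coordinates of the path. -/
theorem measurable_covariateVersion (K : ℝ) (j : Fin p) :
    Measurable (Function.uncurry fun s e => X.covariateVersion P K s e j) := by
  refine measurable_const.max (measurable_const.min (Measurable.limsup fun k => ?_))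
  have h : Measurable fun z : ℤ × X.Path P =>
      X.pathValue P z.2 ((z.1 : ℝ) / ((k : ℝ) + 1)) j :=
    measurable_from_prod_countable_right fun m =>
      (measurable_pi_apply j).comp (X.measurable_pathValue P ((m : ℝ) / ((k : ℝ) + 1)))
  exact h.comp (f := fun z : ℝ × X.Path P => (⌊z.1 * ((k : ℝ) + 1)⌋, z.2))
    ((Int.measurable_floor.comp (measurable_fst.mul_const _)).prodMk measurable_snd)

theorem abs_covariateVersion_le {K : ℝ} (hK : 0 ≤ K) (s : ℝ) (e : X.Path P) (j : Fin p) :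
    |X.covariateVersion P K s e j| ≤ K :=
  abs_le.2 ⟨le_max_left _ _, max_le (by linarith) (min_le_left _ _)⟩

/-- Rounding down, rather than to the nearest grid point, never leaves the time index set. -/
theorem gridFloor_mem_timeSet (k : ℕ) {s : ℝ} (hs : s ∈ X.timeSet P) :
    gridFloor k s ∈ X.timeSet P :=
  ⟨gridFloor_nonneg k hs.1, (EReal.coe_le_coe_iff.2 (gridFloor_le k s)).trans hs.2⟩

/-- The pointwise bound holds off a single null set at all countably many grid points. Lipschitz
continuity makes the grid values converge to `Z(s)` for every `s` at once and extends the bound, so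
the clipping has no effect. -/
theorem covariateVersion_path_ae_eq {K L : ℝ} (hbdd : X.IsBoundedCovariate P K)
    (hlip : X.IsLipschitzCovariate P L) :
    ∀ᵐ ω ∂P, ∀ s ∈ X.timeSet P, X.covariateVersion P K s (X.path P ω) = X.Z s ω := by
  have hb : ∀ᵐ ω ∂P, ∀ (k : ℕ) (m : ℤ), (m : ℝ) / ((k : ℝ) + 1) ∈ X.timeSet P →
      ∀ j, |X.Z ((m : ℝ) / ((k : ℝ) + 1)) ω j| ≤ K := by
    rw [ae_all_iff]; intro k
    rw [ae_all_iff]; intro m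
    by_cases h : (m : ℝ) / ((k : ℝ) + 1) ∈ X.timeSet P
    · filter_upwards [hbdd _ h] with ω hω _ using hω
    · exact ae_of_all _ fun ω h' => absurd h' h
  filter_upwards [hb, hlip] with ω hω hL s hs
  funext j
  have hval : ∀ k, X.pathValue P (X.path P ω) (gridFloor k s) j = X.Z (gridFloor k s) ω j := by
    intro k
    rw [pathValue, dif_pos (X.gridFloor_mem_timeSet P k hs)]
    rfl
  have hlim : Tendsto (fun k => X.Z (gridFloor k s) ω j) atTop (𝓝 (X.Z s ω j)) := by
    rw [tendsto_iff_norm_sub_tendsto_zero]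
    refine squeeze_zero (fun k => norm_nonneg _)
      (fun k => hL _ (X.gridFloor_mem_timeSet P k hs) s hs j) ?_
    have h1 : Tendsto (fun k => L * |gridFloor k s - s|) atTop (𝓝 (L * |s - s|)) :=
      (((tendsto_gridFloor s).sub_const s).abs).const_mul L
    simpa using h1
  have hle : |X.Z s ω j| ≤ K :=
    le_of_tendsto hlim.abs (Eventually.of_forall fun k =>
      hω k _ (X.gridFloor_mem_timeSet P k hs) j)
  simp only [covariateVersion, hval]
  rw [hlim.limsup_eq, min_eq_right (abs_le.1 hle).2, max_eq_right (abs_le.1 hle).1]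

end SurvivalTriple

/-! ### Conditional independence as a product of conditional laws -/

/-- If `S` and `C` are conditionally independent given `π`, the conditional law of `(S, C)` given
`π` is the product of the conditional laws. -/
theorem map_eq_compProd_condDistrib_prod {Ω E : Type*} [MeasurableSpace Ω] [mE : MeasurableSpace E]
    {P : Measure Ω} [IsProbabilityMeasure P] {π : Ω → E} {S C : Ω → ℝ} (hπ : Measurable π)
    (hS : Measurable S) (hC : Measurable C)
    (hind : ∀ A B : Set ℝ, MeasurableSet A → MeasurableSet B →
      P[(S ⁻¹' A ∩ C ⁻¹' B).indicator (fun _ => (1 : ℝ)) | mE.comap π] =ᵐ[P]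
      P[(S ⁻¹' A).indicator (fun _ => (1 : ℝ)) | mE.comap π] *
        P[(C ⁻¹' B).indicator (fun _ => (1 : ℝ)) | mE.comap π]) :
    P.map (fun ω => (π ω, S ω, C ω))
      = (P.map π) ⊗ₘ (condDistrib S π P ×ₖ condDistrib C π P) := by
  have : IsProbabilityMeasure (P.map π) := Measure.isProbabilityMeasure_map hπ.aemeasurable
  have : IsProbabilityMeasure (P.map fun ω => (π ω, S ω, C ω)) :=
    Measure.isProbabilityMeasure_map (hπ.prodMk (hS.prodMk hC)).aemeasurable
  refine Measure.ext_prod₃ fun {s A B} hs hA hB => ?_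
  rw [Measure.map_apply (hπ.prodMk (hS.prodMk hC)) (hs.prod (hA.prod hB)),
    Measure.compProd_apply_prod hs (hA.prod hB)]
  simp_rw [Kernel.prod_apply_prod]
  have hmE : Measurable fun e => condDistrib S π P e A * condDistrib C π P e B :=
    (Kernel.measurable_coe _ hA).mul (Kernel.measurable_coe _ hB)
  rw [setLIntegral_map hs hmE hπ]
  have hF : MeasurableSet (S ⁻¹' A ∩ C ⁻¹' B) := (hS hA).inter (hC hB)
  have e1 : P.real (π ⁻¹' s ∩ (S ⁻¹' A ∩ C ⁻¹' B))
      = ∫ ω in π ⁻¹' s, (condDistrib S π P (π ω)).real A * (condDistrib C π P (π ω)).real B ∂P := by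
    have h1 := setIntegral_condExp (μ := P) (m := mE.comap π) hπ.comap_le
      (f := (S ⁻¹' A ∩ C ⁻¹' B).indicator (fun _ => (1 : ℝ)))
      ((integrable_const _).indicator hF) (s := π ⁻¹' s) ⟨s, hs, rfl⟩
    rw [integral_indicator_const _ hF, measureReal_restrict_apply hF, smul_eq_mul, mul_one]
      at h1
    rw [Set.inter_comm, ← h1]
    refine setIntegral_congr_ae (hπ hs) ?_
    filter_upwards [hind A B hA hB, condDistrib_ae_eq_condExp (μ := P) hπ hS hA,
      condDistrib_ae_eq_condExp (μ := P) hπ hC hB] with ω h2 h3 h4 _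
    rw [h2, Pi.mul_apply, h3, h4]
  have hm : Measurable fun ω => condDistrib S π P (π ω) A * condDistrib C π P (π ω) B :=
    hmE.comp hπ
  have hle : ∀ ω, condDistrib S π P (π ω) A * condDistrib C π P (π ω) B ≤ 1 := fun ω =>
    mul_le_one' prob_le_one prob_le_one
  have hfin : ∫⁻ ω in π ⁻¹' s, condDistrib S π P (π ω) A * condDistrib C π P (π ω) B ∂P ≠ ∞ := by
    refine ((lintegral_mono hle).trans_lt ?_).ne
    rw [lintegral_one]; exact measure_lt_top _ _
  have e2 : (fun ω => (π ω, S ω, C ω)) ⁻¹' s ×ˢ A ×ˢ B = π ⁻¹' s ∩ (S ⁻¹' A ∩ C ⁻¹' B) := rfl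
  rw [e2, ← ENNReal.toReal_eq_toReal_iff' (measure_ne_top _ _) hfin, ← measureReal_def, e1,
    ← integral_toReal hm.aemeasurable (ae_of_all _ fun ω => (hle ω).trans_lt ENNReal.one_lt_top)]
  simp [measureReal_def, ENNReal.toReal_mul]

/-! ### The time index set and the support of the observed time -/

namespace SurvivalTriple

variable {Ω : Type*} [MeasurableSpace Ω] {p : ℕ} {X : SurvivalTriple Ω p} {P : Measure Ω}

variable (X P) in
/-- The interior of the time index set. -/
def openTimeSet : Set ℝ := {t | 0 < t ∧ (t : EReal) < X.tPlus P}

theorem measurableSet_openTimeSet : MeasurableSet (X.openTimeSet P) :=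
  (measurableSet_lt measurable_const measurable_id).inter
    (measurableSet_lt measurable_coe_real_ereal measurable_const)

theorem measurableSet_timeSet : MeasurableSet (X.timeSet P) :=
  (measurableSet_le measurable_const measurable_id).inter
    (measurableSet_le measurable_coe_real_ereal measurable_const)

theorem openTimeSet_subset : X.openTimeSet P ⊆ X.timeSet P := fun _ h => ⟨h.1.le, h.2.le⟩

theorem T_nonneg (ω : Ω) : 0 ≤ X.T ω := le_min (X.failure_nonneg ω) (X.censoring_nonneg ω)

theorem HasBoundedDensity.nullSingletonClass [IsProbabilityMeasure P]
    (h : X.HasBoundedDensity P) : NullSingletonClass (P.map X.T) := by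
  have := h.1
  have hac : P.map X.T ≪ volume := HasPDF.absolutelyContinuous
  exact ⟨fun x => hac (measure_singleton x)⟩

/-- Almost surely `T` is below every rational number above `t₊`, and the absence of atoms removes
the endpoints `0` and `t₊`. Events may thus be confined to times strictly before `t₊`, where the
integrated hazard is finite. -/
theorem ae_T_mem_openTimeSet [IsProbabilityMeasure P] (h : X.HasBoundedDensity P) :
    ∀ᵐ ω ∂P, X.T ω ∈ X.openTimeSet P := by
  have hna := h.nullSingletonClass
  have hne : ∀ t : ℝ, ∀ᵐ ω ∂P, X.T ω ≠ t := by
    intro t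
    have h0 : P.map X.T {t} = 0 := measure_singleton t
    rw [Measure.map_apply X.measurable_T (measurableSet_singleton t)] at h0
    exact measure_eq_zero_iff_ae_notMem.1 h0
  have hq : ∀ᵐ ω ∂P, ∀ q : ℚ, X.tPlus P < ((q : ℝ) : EReal) → X.T ω ≤ q := by
    rw [ae_all_iff]; intro q
    by_cases hlt : X.tPlus P < ((q : ℝ) : EReal)
    · obtain ⟨_, ⟨t, ⟨_, ht⟩, rfl⟩, htq⟩ := sInf_lt_iff.1 hlt
      have : IsProbabilityMeasure (P.map X.T) :=
        Measure.isProbabilityMeasure_map X.measurable_T.aemeasurable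
      rw [cdf_eq_real, map_measureReal_apply X.measurable_T measurableSet_Iic] at ht
      have h1 : ∀ᵐ ω ∂P, ω ∈ X.T ⁻¹' Set.Iic t :=
        (prob_compl_eq_zero_iff (X.measurable_T measurableSet_Iic)).2
          ((ENNReal.toReal_eq_one_iff _).1 ht)
      filter_upwards [h1] with ω hω _
      exact le_trans hω (EReal.coe_lt_coe_iff.1 htq).le
    · exact ae_of_all _ fun ω h' => absurd h' hlt
  filter_upwards [hne 0, hne (X.tPlus P).toReal, hq] with ω h0 h1 h2
  refine ⟨lt_of_le_of_ne (T_nonneg ω) (Ne.symm h0), ?_⟩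
  by_contra hcon
  rcases (not_lt.1 hcon).lt_or_eq with hlt | heq
  · obtain ⟨q, hq1, hq2⟩ := EReal.lt_iff_exists_rat_btwn.1 hlt
    exact absurd (h2 q hq1) (not_le.2 (EReal.coe_lt_coe_iff.1 hq2))
  · rw [heq] at h1; exact h1 (EReal.toReal_coe _).symm

/-- If failure beyond `t` were impossible, then `T ≤ t` almost surely, and `t₊` would be at most
`t`. -/
theorem measure_failure_gt_ne_zero [IsProbabilityMeasure P] {t : ℝ} (ht : 0 ≤ t)
    (hlt : (t : EReal) < X.tPlus P) : P (X.failure ⁻¹' Set.Ioi t) ≠ 0 := by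
  intro h0
  refine absurd hlt (not_lt.2 (sInf_le ⟨t, ⟨ht, ?_⟩, rfl⟩))
  have : IsProbabilityMeasure (P.map X.T) :=
    Measure.isProbabilityMeasure_map X.measurable_T.aemeasurable
  rw [cdf_eq_real, map_measureReal_apply X.measurable_T measurableSet_Iic, measureReal_def,
    ENNReal.toReal_eq_one_iff, ← prob_compl_eq_zero_iff (X.measurable_T measurableSet_Iic)]
  refine measure_mono_null (fun ω hω => ?_) h0
  have : t < X.T ω := not_le.1 hω
  exact this.trans_le (min_le_left _ _)

end SurvivalTriple

/-! ### Hazard representation of the Cox model -/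

theorem abs_dotProduct_le {p : ℕ} {u v : Fin p → ℝ} {K : ℝ} (hv : ∀ j, |v j| ≤ K) :
    |u ⬝ᵥ v| ≤ l1Norm u * K := by
  unfold dotProduct l1Norm
  rw [Finset.sum_mul]
  refine (Finset.abs_sum_le_sum_abs _ _).trans (Finset.sum_le_sum fun j _ => ?_)
  rw [abs_mul]
  exact mul_le_mul_of_nonneg_left (hv j) (abs_nonneg _)

theorem l1Norm_nonneg {p : ℕ} (v : Fin p → ℝ) : 0 ≤ l1Norm v :=
  Finset.sum_nonneg fun _ _ => abs_nonneg _

namespace SurvivalTriple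

variable {Ω : Type*} [MeasurableSpace Ω] {p : ℕ} (X : SurvivalTriple Ω p) (P : Measure Ω)

/-- The linear combination `aᵀ Z(s)`, as a functional of the path. -/
noncomputable def linComb (K : ℝ) (a : Fin p → ℝ) (s : ℝ) (e : X.Path P) : ℝ :=
  a ⬝ᵥ X.covariateVersion P K s e

/-- The relative risk `exp (βᵀ Z(s))`, as a functional of the path. -/
noncomputable def relRisk (K : ℝ) (β : Fin p → ℝ) (s : ℝ) (e : X.Path P) : ℝ :=
  Real.exp (X.linComb P K β s e)

theorem measurable_linComb (K : ℝ) (a : Fin p → ℝ) :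
    Measurable (Function.uncurry (X.linComb P K a)) := by
  have h : Measurable fun z : ℝ × X.Path P => ∑ j, a j * X.covariateVersion P K z.1 z.2 j :=
    Finset.measurable_fun_sum _ fun j _ => (X.measurable_covariateVersion P K j).const_mul (a j)
  exact h

theorem measurable_relRisk (K : ℝ) (β : Fin p → ℝ) :
    Measurable (Function.uncurry (X.relRisk P K β)) :=
  Real.measurable_exp.comp (X.measurable_linComb P K β)

theorem abs_linComb_le {K : ℝ} (hK : 0 ≤ K) (a : Fin p → ℝ) (s : ℝ) (e : X.Path P) :
    |X.linComb P K a s e| ≤ l1Norm a * K :=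
  abs_dotProduct_le fun j => X.abs_covariateVersion_le P hK s e j

theorem relRisk_le {K : ℝ} (hK : 0 ≤ K) (β : Fin p → ℝ) (s : ℝ) (e : X.Path P) :
    X.relRisk P K β s e ≤ Real.exp (l1Norm β * K) :=
  Real.exp_le_exp.2 (abs_le.1 (X.abs_linComb_le P hK β s e)).2

theorem inv_le_relRisk {K : ℝ} (hK : 0 ≤ K) (β : Fin p → ℝ) (s : ℝ) (e : X.Path P) :
    (Real.exp (l1Norm β * K))⁻¹ ≤ X.relRisk P K β s e := by
  rw [← Real.exp_neg]
  exact Real.exp_le_exp.2 (abs_le.1 (X.abs_linComb_le P hK β s e)).1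

variable {X P} [IsProbabilityMeasure P] {haz : ℝ → ℝ≥0} {β : Fin p → ℝ} {K L : ℝ}

theorem isRiskModel (hK : 0 ≤ K) (hdens : X.HasBoundedDensity P) (a : Fin p → ℝ) {κ : ℝ}
    (hκ : 0 < κ) (ha : l1Norm a * K ≤ κ) :
    IsRiskModel P X.T {ω | X.failure ω ≤ X.censoring ω}
      (fun s x => X.relRisk P K β s (X.path P x)) (fun s x => X.linComb P K a s (X.path P x))
      κ (Real.exp (l1Norm β * K)) where
  measurable_T := X.measurable_T
  measurableSet_D := measurableSet_le X.measurable_failure X.measurable_censoring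
  measurable_w := (X.measurable_relRisk P K β).comp (f := fun z : ℝ × Ω => (z.1, X.path P z.2))
    (measurable_fst.prodMk ((X.measurable_path P).comp measurable_snd))
  measurable_b := (X.measurable_linComb P K a).comp (f := fun z : ℝ × Ω => (z.1, X.path P z.2))
    (measurable_fst.prodMk ((X.measurable_path P).comp measurable_snd))
  nullSingleton := hdens.nullSingletonClass
  pos_κ := hκ
  one_le_h := Real.one_le_exp (mul_nonneg (l1Norm_nonneg β) hK)
  le_w s _ := X.inv_le_relRisk P hK β s _
  w_le s _ := X.relRisk_le P hK β s _
  abs_b_le s _ := (X.abs_linComb_le P hK a s _).trans ha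

namespace IsCoxModel

theorem setLIntegral_hazard_path_ae_eq (hbdd : X.IsBoundedCovariate P K)
    (hlip : X.IsLipschitzCovariate P L) :
    ∀ᵐ ω ∂P, ∀ t : ℝ, (t : EReal) < X.tPlus P →
      ∫⁻ s in Set.Ioc 0 t, (haz s : ℝ≥0∞) * ENNReal.ofReal (Real.exp (β ⬝ᵥ X.Z s ω))
        = ∫⁻ s in Set.Ioc 0 t, (haz s : ℝ≥0∞) *
          ENNReal.ofReal (X.relRisk P K β s (X.path P ω)) := by
  filter_upwards [X.covariateVersion_path_ae_eq P hbdd hlip] with ω hω t ht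
  refine setLIntegral_congr_fun measurableSet_Ioc fun s hs => ?_
  have hsT : s ∈ X.timeSet P := ⟨hs.1.le, (EReal.coe_le_coe_iff.2 hs.2).trans ht.le⟩
  simp only [relRisk, linComb, hω s hsT]

/-- The relative risk is bounded below, so an infinite baseline integral would make the conditional
survival probability at `t` vanish, contradicting `t < t₊`. -/
theorem setLIntegral_haz_ne_top (hCox : X.IsCoxModel P haz β) (hK : 0 ≤ K)
    (hbdd : X.IsBoundedCovariate P K) (hlip : X.IsLipschitzCovariate P L) {t : ℝ} (ht : 0 ≤ t)
    (hlt : (t : EReal) < X.tPlus P) : ∫⁻ s in Set.Ioc 0 t, (haz s : ℝ≥0∞) ≠ ∞ := by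
  intro htop
  refine measure_failure_gt_ne_zero ht hlt ?_
  have hA : MeasurableSet (X.failure ⁻¹' Set.Ioi t) := X.measurable_failure measurableSet_Ioi
  have hzero : P[(X.failure ⁻¹' Set.Ioi t).indicator (fun _ => (1 : ℝ)) | X.covariateSigma P]
      =ᵐ[P] fun _ => 0 := by
    filter_upwards [hCox.survival t ⟨ht, hlt.le⟩,
      setLIntegral_hazard_path_ae_eq (haz := haz) (β := β) hbdd hlip] with ω h1 h2
    rw [h1, expNeg, if_pos]
    rw [h2 t hlt, eq_top_iff]
    calc (∞ : ℝ≥0∞) = ∞ * ENNReal.ofReal (Real.exp (l1Norm β * K))⁻¹ := by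
          rw [ENNReal.top_mul]
          exact (ENNReal.ofReal_pos.2 (inv_pos.2 (Real.exp_pos _))).ne'
      _ = ∫⁻ s in Set.Ioc 0 t, (haz s : ℝ≥0∞) * ENNReal.ofReal (Real.exp (l1Norm β * K))⁻¹ := by
          rw [lintegral_mul_const _ hCox.measurable_haz.coe_nnreal_ennreal, htop]
      _ ≤ _ := by
          refine lintegral_mono fun s => mul_le_mul' le_rfl (ENNReal.ofReal_le_ofReal ?_)
          exact X.inv_le_relRisk P hK β s _
  have hle : X.covariateSigma P ≤ _ := (X.comap_path P) ▸ (X.measurable_path P).comap_le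
  have h3 := integral_condExp (μ := P) hle (f := (X.failure ⁻¹' Set.Ioi t).indicator
    (fun _ => (1 : ℝ)))
  rw [integral_congr_ae hzero, integral_zero, integral_indicator_const _ hA, smul_eq_mul,
    mul_one] at h3
  exact (measureReal_eq_zero_iff).1 h3.symm

/-- For almost every path the survival formula holds simultaneously at all rational times before
`t₊`. That determines the conditional law on each `(0, M]` with `M < t₊` rational, and these
intervals exhaust the open time set. -/
theorem condDistrib_restrict_eq (hCox : X.IsCoxModel P haz β) (hK : 0 ≤ K)
    (hbdd : X.IsBoundedCovariate P K) (hlip : X.IsLipschitzCovariate P L) :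
    ∀ᵐ e ∂(P.map (X.path P)),
      (condDistrib X.failure (X.path P) P e).restrict (X.openTimeSet P)
        = (volume.withDensity fun s => ((haz s * (X.relRisk P K β s e).toNNReal : ℝ≥0) : ℝ≥0∞) *
          condDistrib X.failure (X.path P) P e (Set.Ici s)).restrict (X.openTimeSet P) := by
  set η := condDistrib X.failure (X.path P) P with hη
  let r : ℝ → X.Path P → ℝ≥0∞ := fun s e => ((haz s * (X.relRisk P K β s e).toNNReal : ℝ≥0) : ℝ≥0∞)
  have hrm : Measurable (Function.uncurry r) :=
    ((hCox.measurable_haz.comp measurable_fst).mul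
      (X.measurable_relRisk P K β).real_toNNReal).coe_nnreal_ennreal
  have hrfin : ∀ (e : X.Path P) (t : ℝ), 0 ≤ t → (t : EReal) < X.tPlus P →
      ∫⁻ s in Set.Ioc 0 t, r s e ≠ ∞ := by
    intro e t ht hlt
    refine ne_top_of_le_ne_top
      (b := (∫⁻ s in Set.Ioc 0 t, (haz s : ℝ≥0∞)) * ENNReal.ofReal (Real.exp (l1Norm β * K)))
      (ENNReal.mul_ne_top (hCox.setLIntegral_haz_ne_top hK hbdd hlip ht hlt) ENNReal.ofReal_ne_top)
      ?_
    rw [← lintegral_mul_const _ hCox.measurable_haz.coe_nnreal_ennreal]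
    refine lintegral_mono fun s => ?_
    simp only [r, ENNReal.coe_mul]
    exact mul_le_mul' le_rfl (ENNReal.ofReal_le_ofReal (X.relRisk_le P hK β s e))
  have hsurv : ∀ᵐ e ∂(P.map (X.path P)), ∀ q : ℚ, 0 ≤ q → ((q : ℝ) : EReal) < X.tPlus P →
      η e (Set.Ioi (q : ℝ))
        = ENNReal.ofReal (Real.exp (-(∫⁻ s in Set.Ioc 0 (q : ℝ), r s e).toReal)) := by
    rw [ae_all_iff]; intro q
    by_cases hq : 0 ≤ q ∧ ((q : ℝ) : EReal) < X.tPlus P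
    swap
    · exact ae_of_all _ fun e h1 h2 => absurd ⟨h1, h2⟩ hq
    obtain ⟨hq0, hq1⟩ := hq
    have hq0' : (0 : ℝ) ≤ q := by exact_mod_cast hq0
    have hms : Measurable fun e => ∫⁻ s in Set.Ioc 0 (q : ℝ), r s e := hrm.lintegral_prod_left'
    have hset : MeasurableSet {e | η e (Set.Ioi (q : ℝ))
        = ENNReal.ofReal (Real.exp (-(∫⁻ s in Set.Ioc 0 (q : ℝ), r s e).toReal))} :=
      measurableSet_eq_fun (Kernel.measurable_coe _ measurableSet_Ioi)
        (Real.measurable_exp.comp hms.ennreal_toReal.neg).ennreal_ofReal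
    have key : ∀ᵐ e ∂(P.map (X.path P)), η e (Set.Ioi (q : ℝ))
        = ENNReal.ofReal (Real.exp (-(∫⁻ s in Set.Ioc 0 (q : ℝ), r s e).toReal)) := by
      rw [ae_map_iff (X.measurable_path P).aemeasurable hset]
      have hc := condDistrib_ae_eq_condExp (μ := P) (X.measurable_path P) X.measurable_failure
        (measurableSet_Ioi (a := (q : ℝ)))
      rw [X.comap_path P] at hc
      filter_upwards [hc, hCox.survival q ⟨hq0', hq1.le⟩,
        setLIntegral_hazard_path_ae_eq (haz := haz) (β := β) hbdd hlip] with ω h1 h2 h3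
      have h4 : ∫⁻ s in Set.Ioc 0 (q : ℝ), (haz s : ℝ≥0∞) *
          ENNReal.ofReal (X.relRisk P K β s (X.path P ω))
          = ∫⁻ s in Set.Ioc 0 (q : ℝ), r s (X.path P ω) := by
        refine lintegral_congr fun s => ?_
        simp only [r, ENNReal.coe_mul]; rfl
      rw [h2, h3 q hq1, h4, expNeg, if_neg (hrfin _ _ hq0' hq1)] at h1
      rw [← h1, measureReal_def, ENNReal.ofReal_toReal (measure_ne_top _ _)]
    filter_upwards [key] with e he _ _ using he
  have hJ : X.openTimeSet P = ⋃ M : {M : ℚ // ((M : ℝ) : EReal) < X.tPlus P},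
      Set.Ioc 0 ((M : ℚ) : ℝ) := by
    ext t
    simp only [openTimeSet, Set.mem_ofPred_eq, Set.mem_iUnion, Set.mem_Ioc]
    constructor
    · rintro ⟨h0, h1⟩
      obtain ⟨q, hq1, hq2⟩ := EReal.lt_iff_exists_rat_btwn.1 h1
      exact ⟨⟨q, hq2⟩, h0, (EReal.coe_lt_coe_iff.1 hq1).le⟩
    · rintro ⟨⟨q, hq⟩, h0, h1⟩
      exact ⟨h0, (EReal.coe_le_coe_iff.2 h1).trans_lt hq⟩
  filter_upwards [hsurv] with e he
  rw [hJ, Measure.restrict_iUnion_congr]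
  rintro ⟨M, hM⟩
  rcases lt_or_ge M 0 with hM0 | hM0
  · have : Set.Ioc 0 (M : ℝ) = ∅ := Set.Ioc_eq_empty (not_lt.2 (by exact_mod_cast hM0.le))
    simp [this]
  · refine restrict_eq_withDensity_of_survival (r := fun s => r s e)
      (hrm.comp (measurable_id.prodMk measurable_const))
      (hrfin e M (by exact_mod_cast hM0) hM) fun q hq0 hqM => he q hq0 ?_
    refine lt_of_le_of_lt (EReal.coe_le_coe_iff.2 ?_) hM
    exact_mod_cast hqM

/-- On events `T` is the failure time, and it avoids the endpoints of the time index set almost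
surely. Conditional independence then reduces the claim to the hazard of the conditional law of the
failure time. -/
theorem hasHazard (hCox : X.IsCoxModel P haz β) (hK : 0 ≤ K) (hdens : X.HasBoundedDensity P)
    (hbdd : X.IsBoundedCovariate P K) (hlip : X.IsLipschitzCovariate P L) :
    HasHazard P X.T {ω | X.failure ω ≤ X.censoring ω} (X.path P) (X.openTimeSet P)
      (fun s e => haz s * (X.relRisk P K β s e).toNNReal) where
  measurable_T := X.measurable_T
  measurableSet_D := measurableSet_le X.measurable_failure X.measurable_censoring
  measurable_π := X.measurable_path P
  measurableSet_J := measurableSet_openTimeSet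
  measurable_r := (hCox.measurable_haz.comp measurable_fst).mul
    (X.measurable_relRisk P K β).real_toNNReal
  lintegral_eq f hf := by
    have hrm : Measurable (Function.uncurry fun s e => haz s * (X.relRisk P K β s e).toNNReal) :=
      (hCox.measurable_haz.comp measurable_fst).mul (X.measurable_relRisk P K β).real_toNNReal
    have hlaw := map_eq_compProd_condDistrib_prod (P := P) (X.measurable_path P)
      X.measurable_failure X.measurable_censoring (by
        rw [X.comap_path P]; exact hCox.condIndep)
    have h := lintegral_event_eq_lintegral_hazard (X.measurable_path P) X.measurable_failure
      X.measurable_censoring hlaw measurableSet_openTimeSet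
      (r := fun s e => ((haz s * (X.relRisk P K β s e).toNNReal : ℝ≥0) : ℝ≥0∞))
      hrm.coe_nnreal_ennreal
      (hCox.condDistrib_restrict_eq hK hbdd hlip) hf
    refine Eq.trans (lintegral_congr_ae ?_) (h.trans (lintegral_congr fun ω => ?_))
    · filter_upwards [ae_T_mem_openTimeSet hdens] with ω hω
      simp only [Set.indicator, Set.mem_ofPred_eq]
      by_cases hD : X.failure ω ≤ X.censoring ω
      · have hT : X.T ω = X.failure ω := min_eq_left hD
        rw [hT] at hω ⊢
        simp [hD, hω]
      · simp [hD]
    · have hr' : Measurable fun s =>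
          ((haz s * (X.relRisk P K β s (X.path P ω)).toNNReal : ℝ≥0) : ℝ≥0∞) :=
        (hrm.comp (measurable_id.prodMk measurable_const)).coe_nnreal_ennreal
      have hf' : Measurable fun s => f s (X.path P ω) :=
        hf.comp (measurable_id.prodMk measurable_const)
      rw [hazardMeasure, lintegral_withDensity_eq_lintegral_mul _ hr' hf',
        lintegral_indicator measurableSet_Iic, Measure.restrict_restrict measurableSet_Iic,
        Set.inter_comm]
      rfl

end IsCoxModel

end SurvivalTriple

/-! ### The score as an explicit sum over events -/

/-- The linear form `v ↦ vᵀ z`. -/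
noncomputable def dotForm {p : ℕ} (z : Fin p → ℝ) : (Fin p → ℝ) →L[ℝ] ℝ :=
  ∑ j, z j • ContinuousLinearMap.proj j

@[simp] theorem dotForm_apply {p : ℕ} (z v : Fin p → ℝ) : dotForm z v = v ⬝ᵥ z := by
  simp [dotForm, dotProduct, mul_comm]

theorem hasFDerivAt_dotProduct {p : ℕ} (z β : Fin p → ℝ) :
    HasFDerivAt (fun β => β ⬝ᵥ z) (dotForm z) β := by
  simp_rw [← dotForm_apply z]
  exact (dotForm z).hasFDerivAt

theorem hasFDerivAt_log_sum_exp {p n : ℕ} (y : Fin n → ℝ) (z : Fin n → Fin p → ℝ)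
    {β : Fin p → ℝ} (h : ∑ j, y j * Real.exp (β ⬝ᵥ z j) ≠ 0) :
    HasFDerivAt (fun β => Real.log (∑ j, y j * Real.exp (β ⬝ᵥ z j)))
      ((∑ j, y j * Real.exp (β ⬝ᵥ z j))⁻¹ • ∑ j, y j • Real.exp (β ⬝ᵥ z j) • dotForm (z j)) β :=
  (HasFDerivAt.fun_sum fun j _ => ((hasFDerivAt_dotProduct (z j) β).exp.const_mul (y j))).log h

namespace IsRiskModel

variable {Ω : Type*} [MeasurableSpace Ω] {P : Measure Ω} [IsProbabilityMeasure P] {T : Ω → ℝ}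
  {D : Set Ω} {w b : ℝ → Ω → ℝ} {κ h : ℝ} (R : IsRiskModel P T D w b κ h)
include R

theorem measurable_normalizedScore (n : ℕ) :
    Measurable fun x : Fin n → Ω => normalizedScore T D w b x := by
  refine Measurable.const_mul (Finset.measurable_fun_sum _ fun i _ => ?_) _
  have hTi : Measurable fun x : Fin n → Ω => T (x i) := R.measurable_T.comp (measurable_pi_apply i)
  have hj : ∀ j, Measurable fun x : Fin n → Ω => (T (x i), x j) := fun j =>
    hTi.prodMk (measurable_pi_apply j)
  have hY : ∀ j, Measurable fun x : Fin n → Ω => atRisk T (T (x i)) (x j) * w (T (x i)) (x j) :=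
    fun j => R.measurable_weight.comp (hj j)
  have hb : ∀ j, Measurable fun x : Fin n → Ω => b (T (x i)) (x j) := fun j =>
    R.measurable_b.comp (hj j)
  have hg : Measurable fun x : Fin n → Ω => b (T (x i)) (x i) - riskAverage T w b x (T (x i)) :=
    (hb i).sub ((Finset.measurable_fun_sum _ fun j _ => (hY j).mul (hb j)).div
      (Finset.measurable_fun_sum _ fun j _ => hY j))
  exact hg.indicator (R.measurableSet_D.preimage (measurable_pi_apply i))

end IsRiskModel

namespace SurvivalTriple

variable {Ω : Type*} [MeasurableSpace Ω] {p : ℕ} {X : SurvivalTriple Ω p} {P : Measure Ω}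

theorem setIntegral_dN {ω : Ω} (hω : X.T ω ∈ X.timeSet P) (f : ℝ → ℝ) :
    ∫ s in X.timeSet P, f s ∂(X.dN ω)
      = {ω | X.failure ω ≤ X.censoring ω}.indicator (fun ω => f (X.T ω)) ω := by
  classical
  unfold dN
  simp only [Set.indicator, Set.mem_ofPred_eq]
  split_ifs with h
  · rw [setIntegral_dirac, if_pos hω]
  · simp

/-- A linear combination of the coordinates of the score vector. -/
theorem dotProduct_score {n : ℕ} {x : Fin n → Ω} (hx : ∀ i, X.T (x i) ∈ X.timeSet P)
    (a β : Fin p → ℝ) :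
    a ⬝ᵥ X.score P x β = (1 / (n : ℝ)) * ∑ i, {ω | X.failure ω ≤ X.censoring ω}.indicator
      (fun ω => a ⬝ᵥ X.Z (X.T ω) ω - (∑ j, X.weight β (X.T ω) (x j) * (a ⬝ᵥ X.Z (X.T ω) (x j))) /
        ∑ j, X.weight β (X.T ω) (x j)) (x i) := by
  have hlin : a ⬝ᵥ X.score P x β = fderiv ℝ (X.logPartialLikelihood P x) β a := by
    conv_rhs => rw [← Finset.univ_sum_single a, map_sum]
    refine Finset.sum_congr rfl fun j _ => ?_
    have : Pi.single j (a j) = a j • (Pi.single j (1 : ℝ) : Fin p → ℝ) := by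
      rw [← Pi.single_smul, smul_eq_mul, mul_one]
    rw [this, map_smul, smul_eq_mul]
    rfl
  have hfun : X.logPartialLikelihood P x = fun β => (1 / (n : ℝ)) *
      (∑ i, {ω | X.failure ω ≤ X.censoring ω}.indicator
        (fun ω => β ⬝ᵥ X.Z (X.T ω) ω
          - Real.log (∑ j, X.Y (X.T ω) (x j) * Real.exp (β ⬝ᵥ X.Z (X.T ω) (x j)))) (x i)) := by
    funext β
    simp only [logPartialLikelihood, setIntegral_dN (hx _)]
    rw [← mul_sub, ← Finset.sum_sub_distrib]
    congr 1
    refine Finset.sum_congr rfl fun i _ => ?_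
    simp only [Set.indicator, weight]
    split_ifs <;> simp
  have hterm : ∀ i, HasFDerivAt (fun β => {ω | X.failure ω ≤ X.censoring ω}.indicator
        (fun ω => β ⬝ᵥ X.Z (X.T ω) ω
          - Real.log (∑ j, X.Y (X.T ω) (x j) * Real.exp (β ⬝ᵥ X.Z (X.T ω) (x j)))) (x i))
      ({ω | X.failure ω ≤ X.censoring ω}.indicator
        (fun ω => dotForm (X.Z (X.T ω) ω)
          - (∑ j, X.Y (X.T ω) (x j) * Real.exp (β ⬝ᵥ X.Z (X.T ω) (x j)))⁻¹ •
            ∑ j, X.Y (X.T ω) (x j) • Real.exp (β ⬝ᵥ X.Z (X.T ω) (x j)) •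
              dotForm (X.Z (X.T ω) (x j))) (x i)) β := by
    intro i
    by_cases hD : X.failure (x i) ≤ X.censoring (x i)
    · simp only [Set.indicator, Set.mem_ofPred_eq, hD, if_true]
      refine (hasFDerivAt_dotProduct _ β).sub (hasFDerivAt_log_sum_exp _ _ (ne_of_gt ?_))
      -- Subject `i` is at risk at its own event time, so the argument of the logarithm is positive.
      refine Finset.sum_pos' (fun j _ => ?_) ⟨i, Finset.mem_univ _, ?_⟩
      · unfold Y; split_ifs <;> positivity
      · simp [Y, Real.exp_pos]
    · simp only [Set.indicator, Set.mem_ofPred_eq, hD, if_false]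
      exact hasFDerivAt_const _ _
  rw [hlin, hfun, ((HasFDerivAt.fun_sum fun i _ => hterm i).const_mul _).fderiv]
  simp only [smul_apply, sum_apply, smul_eq_mul]
  congr 1
  refine Finset.sum_congr rfl fun i _ => ?_
  simp only [Set.indicator]
  split_ifs
  · simp [weight, div_eq_inv_mul, mul_assoc]
  · simp

variable [IsProbabilityMeasure P] {haz : ℝ → ℝ≥0} {β : Fin p → ℝ} {K L : ℝ}

/-- The normalised score in terms of the measurable version of the covariate process. -/
theorem sqrt_mul_dotProduct_score {n : ℕ} {x : Fin n → Ω} (hT : ∀ i, X.T (x i) ∈ X.timeSet P)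
    (hZ : ∀ i, ∀ s ∈ X.timeSet P, X.covariateVersion P K s (X.path P (x i)) = X.Z s (x i))
    (a β : Fin p → ℝ) :
    (n : ℝ) ^ (1 / 2 : ℝ) * (a ⬝ᵥ X.score P x β)
      = normalizedScore X.T {ω | X.failure ω ≤ X.censoring ω}
        (fun s x => X.relRisk P K β s (X.path P x)) (fun s x => X.linComb P K a s (X.path P x))
        x := by
  have hn : (n : ℝ) ^ (1 / 2 : ℝ) * (1 / (n : ℝ)) = (√(n : ℝ))⁻¹ := by
    rw [← Real.sqrt_eq_rpow, mul_one_div, Real.sqrt_div_self]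
  rw [dotProduct_score hT, ← mul_assoc, hn, normalizedScore]
  congr 1
  refine Finset.sum_congr rfl fun i _ => ?_
  simp only [Set.indicator, riskAverage, relRisk, linComb]
  simp only [hZ _ _ (hT i)]
  rfl

/-! ### The information matrix as a second moment -/

variable (X P) in
/-- The centred covariate combination `aᵀ (Z(T) - μ(T))` at an event. -/
noncomputable def eventResidual (K : ℝ) (β a : Fin p → ℝ) : Ω → ℝ :=
  {ω | X.failure ω ≤ X.censoring ω}.indicator fun ω =>
    IsRiskModel.centredIntegrand P X.T (X.path P) (X.relRisk P K β) (X.linComb P K a)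
      (X.T ω) (X.path P ω)

theorem measurable_eventResidual (hK : 0 ≤ K) (hdens : X.HasBoundedDensity P) (a : Fin p → ℝ) :
    Measurable (X.eventResidual P K β a) := by
  have R := isRiskModel (β := β) hK hdens a
    (lt_of_lt_of_le zero_lt_one (le_max_left 1 (l1Norm a * K))) (le_max_right _ _)
  refine Measurable.indicator ?_ R.measurableSet_D
  exact (R.measurable_centredIntegrand (X.measurable_linComb P K a)).comp
    (f := fun ω => (X.T ω, X.path P ω)) (X.measurable_T.prodMk (X.measurable_path P))

theorem abs_eventResidual_le (hK : 0 ≤ K) (hdens : X.HasBoundedDensity P) (a : Fin p → ℝ) (ω : Ω) :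
    |X.eventResidual P K β a ω| ≤ 2 * max 1 (l1Norm a * K) := by
  have R := isRiskModel (β := β) hK hdens a
    (lt_of_lt_of_le zero_lt_one (le_max_left 1 (l1Norm a * K))) (le_max_right _ _)
  simp only [eventResidual, Set.indicator]
  split_ifs
  · exact R.abs_centredIntegrand_le
      (fun s e => (X.abs_linComb_le P hK a s e).trans (le_max_right _ _)) _ _
  · rw [abs_zero]; positivity

theorem linComb_eq_sum (a : Fin p → ℝ) (s : ℝ) (e : X.Path P) :
    X.linComb P K a s e = ∑ j, a j * X.linComb P K (Pi.single j 1) s e := by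
  simp only [linComb, single_one_dotProduct]
  rfl

theorem eventResidual_eq_sum (hK : 0 ≤ K) (hdens : X.HasBoundedDensity P) (a : Fin p → ℝ) (ω : Ω) :
    X.eventResidual P K β a ω = ∑ j, a j * X.eventResidual P K β (Pi.single j 1) ω := by
  simp only [eventResidual, Set.indicator]
  split_ifs
  · simp only [IsRiskModel.centredIntegrand, mul_sub, Finset.sum_sub_distrib]
    rw [← linComb_eq_sum]
    congr 1
    simp only [riskTilt, mul_div_assoc', ← Finset.sum_div]
    congr 1
    simp_rw [← integral_const_mul]
    rw [← integral_finsetSum]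
    · refine integral_congr_ae (ae_of_all _ fun x => ?_)
      simp only
      rw [linComb_eq_sum, Finset.mul_sum]
      exact Finset.sum_congr rfl fun j _ => by ring
    · intro j _
      have R := isRiskModel (β := β) hK hdens (Pi.single j 1)
        (lt_of_lt_of_le zero_lt_one (le_max_left 1 (l1Norm (Pi.single j (1 : ℝ)) * K)))
        (le_max_right _ _)
      refine Integrable.const_mul (Integrable.of_bound
        (C := 1 * Real.exp (l1Norm β * K) * max 1 (l1Norm (Pi.single j (1 : ℝ)) * K))
        (R.measurable_weight_mul.comp
          (f := fun x => (X.T ω, x)) (measurable_const.prodMk measurable_id)).aestronglyMeasurable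
        (ae_of_all _ fun x => ?_)) _
      simp only [Function.comp_apply, Function.uncurry]
      have hw : 0 < X.relRisk P K β (X.T ω) (X.path P x) := R.w_pos _ x
      rw [Real.norm_eq_abs, abs_mul, abs_mul, abs_of_nonneg (atRisk_nonneg _ _ _), abs_of_pos hw]
      refine mul_le_mul (mul_le_mul (atRisk_le_one _ _ _) (R.w_le _ x) hw.le
        zero_le_one) (R.abs_b_le _ x) (abs_nonneg _) (by positivity)
  · simp

theorem tiltedMean_eq_riskTilt (hZ : ∀ᵐ ω ∂P, ∀ s ∈ X.timeSet P,
      X.covariateVersion P K s (X.path P ω) = X.Z s ω) {s : ℝ} (hs : s ∈ X.timeSet P) (j : Fin p) :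
    X.tiltedMean P β s j = riskTilt P X.T (fun s x => X.relRisk P K β s (X.path P x))
      (fun s x => X.linComb P K (Pi.single j 1) s (X.path P x)) s := by
  unfold tiltedMean riskTilt riskMean
  congr 1
  · refine integral_congr_ae ?_
    filter_upwards [hZ] with ω hω
    simp only [relRisk, linComb, hω s hs, weight, single_one_dotProduct]
    rw [mul_comm]; rfl
  · refine integral_congr_ae ?_
    filter_upwards [hZ] with ω hω
    simp only [relRisk, linComb, hω s hs, weight]
    rfl

/-- The event measure is a point mass at `T` on events and zero otherwise. Almost surely `T` lies in
the time index set, where the measurable version and the original covariates agree. -/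
theorem informationMatrix_apply (hdens : X.HasBoundedDensity P) (hbdd : X.IsBoundedCovariate P K)
    (hlip : X.IsLipschitzCovariate P L) (j k : Fin p) :
    X.informationMatrix P β j k = ∫ ω, X.eventResidual P K β (Pi.single j 1) ω *
      X.eventResidual P K β (Pi.single k 1) ω ∂P := by
  have hZ := X.covariateVersion_path_ae_eq P hbdd hlip
  simp only [informationMatrix, Matrix.of_apply]
  refine integral_congr_ae ?_
  filter_upwards [hZ, ae_T_mem_openTimeSet hdens] with ω hω hT
  have hT' := openTimeSet_subset hT
  rw [setIntegral_dN hT']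
  simp only [eventResidual, Set.indicator, IsRiskModel.centredIntegrand,
    tiltedMean_eq_riskTilt hZ hT', linComb, hω _ hT', single_one_dotProduct]
  split_ifs <;> simp

/-- Symmetry allows the inverse to be moved from the score to `c`. -/
theorem informationMatrix_transpose : (X.informationMatrix P β)ᵀ = X.informationMatrix P β := by
  ext j k
  simp only [Matrix.transpose_apply, informationMatrix, Matrix.of_apply]
  simp_rw [mul_comm]

theorem dotProduct_informationMatrix_mulVec (hK : 0 ≤ K) (hdens : X.HasBoundedDensity P)
    (hbdd : X.IsBoundedCovariate P K) (hlip : X.IsLipschitzCovariate P L) (a : Fin p → ℝ) :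
    a ⬝ᵥ (X.informationMatrix P β *ᵥ a) = ∫ ω, X.eventResidual P K β a ω ^ 2 ∂P := by
  have hInt : ∀ j k, Integrable (fun ω => X.eventResidual P K β (Pi.single j 1) ω *
      X.eventResidual P K β (Pi.single k 1) ω) P := fun j k => by
    refine Integrable.of_bound (C := 2 * max 1 (l1Norm (Pi.single j (1 : ℝ)) * K) *
      (2 * max 1 (l1Norm (Pi.single k (1 : ℝ)) * K)))
      ((measurable_eventResidual hK hdens _).mul
        (measurable_eventResidual hK hdens _)).aestronglyMeasurable (ae_of_all _ fun ω => ?_)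
    rw [Real.norm_eq_abs, abs_mul]
    exact mul_le_mul (abs_eventResidual_le hK hdens _ ω) (abs_eventResidual_le hK hdens _ ω)
      (abs_nonneg _) (by positivity)
  have e : ∀ ω, X.eventResidual P K β a ω ^ 2 = ∑ j, ∑ k, a j * a k *
      (X.eventResidual P K β (Pi.single j 1) ω * X.eventResidual P K β (Pi.single k 1) ω) := by
    intro ω
    rw [eventResidual_eq_sum hK hdens a ω, sq, Finset.sum_mul_sum]
    exact Finset.sum_congr rfl fun j _ => Finset.sum_congr rfl fun k _ => by ring
  simp_rw [e]
  rw [integral_finsetSum _ fun j _ => integrable_finsetSum _ fun k _ => (hInt j k).const_mul _]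
  simp only [dotProduct, Matrix.mulVec]
  refine Finset.sum_congr rfl fun j _ => ?_
  rw [integral_finsetSum _ fun k _ => (hInt j k).const_mul _, Finset.mul_sum]
  refine Finset.sum_congr rfl fun k _ => ?_
  rw [integral_const_mul, informationMatrix_apply hdens hbdd hlip]
  ring

end SurvivalTriple

/-! ### Norms and growth rates -/

section norms

variable {p : ℕ}

theorem abs_le_l1Norm (v : Fin p → ℝ) (j : Fin p) : |v j| ≤ l1Norm v :=
  Finset.single_le_sum (f := fun j => |v j|) (fun _ _ => abs_nonneg _) (Finset.mem_univ j)

theorem l1Norm_pos {v : Fin p → ℝ} (hv : v ≠ 0) : 0 < l1Norm v := by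
  obtain ⟨j, hj⟩ := Function.ne_iff.1 hv
  exact (abs_pos.2 hj).trans_le (abs_le_l1Norm v j)

theorem l1Norm_mulVec_le_sum (A : Matrix (Fin p) (Fin p) ℝ) (v : Fin p → ℝ) :
    l1Norm (A *ᵥ v) ≤ (∑ i, ∑ j, |A i j|) * l1Norm v := by
  rw [Finset.sum_mul]
  refine Finset.sum_le_sum fun i _ => ?_
  rw [Finset.sum_mul, Matrix.mulVec, dotProduct]
  refine (Finset.abs_sum_le_sum_abs _ _).trans (Finset.sum_le_sum fun j _ => ?_)
  rw [abs_mul]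
  exact mul_le_mul_of_nonneg_left (abs_le_l1Norm v j) (abs_nonneg _)

theorem l1Norm_mulVec_le_opOneNorm (A : Matrix (Fin p) (Fin p) ℝ) {v : Fin p → ℝ}
    (hv : l1Norm v = 1) : l1Norm (A *ᵥ v) ≤ opOneNorm A := by
  have hv0 : v ≠ 0 := by
    rintro rfl
    simp [l1Norm] at hv
  -- Boundedness has to be shown, since the supremum of an unbounded set of reals is `0` by
  -- convention.
  have hb : BddAbove (Set.range fun v : {v : Fin p → ℝ // v ≠ 0} =>
      l1Norm (A *ᵥ v.1) / l1Norm v.1) := by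
    refine ⟨∑ i, ∑ j, |A i j|, ?_⟩
    rintro _ ⟨v, rfl⟩
    exact (div_le_iff₀ (l1Norm_pos v.2)).2 (l1Norm_mulVec_le_sum A v.1)
  have h := le_ciSup hb ⟨v, hv0⟩
  simp only [hv, div_one] at h
  exact h

theorem one_le_maxColumnSupport {A : Matrix (Fin p) (Fin p) ℝ} (hA : A ≠ 0) :
    1 ≤ maxColumnSupport A := by
  obtain ⟨i, j, hij⟩ : ∃ i j, A i j ≠ 0 := by
    by_contra! h
    exact hA (by ext i j; exact h i j)
  refine le_trans ?_ (Finset.le_sup (f := fun j => (Finset.univ.filter fun i => A i j ≠ 0).card)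
    (Finset.mem_univ j))
  exact Finset.card_pos.2 ⟨i, by simpa using hij⟩

end norms

/-- A sparsity condition on the matrices `A n` forces their `ℓ₁` operator norms to be
`o(n ^ (1 / 6))`. -/
theorem tendsto_opOneNorm_mul_rpow {p : ℕ → ℕ} {A : ∀ n, Matrix (Fin (p n)) (Fin (p n)) ℝ}
    {d : ℕ → ℝ} (hp : ∀ n, 1 ≤ p n) (hA : ∀ᶠ n in atTop, A n ≠ 0) {δ₀ : ℝ} (hδ : 0 < δ₀)
    (h : (fun n : ℕ => opOneNorm (A n) ^ 2 * max (d n) ((n : ℝ) ^ (-(1 / 3 - δ₀))) *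
        (maxColumnSupport (A n) : ℝ))
      =o[atTop] fun n : ℕ => 1 / Real.log ((n : ℝ) * (p n : ℝ)) ^ (1 / 2 : ℝ)) :
    Tendsto (fun n : ℕ => opOneNorm (A n) * (n : ℝ) ^ (-(1 / 6) : ℝ)) atTop (𝓝 0) := by
  have hsq : Tendsto (fun n : ℕ => (opOneNorm (A n) * (n : ℝ) ^ (-(1 / 6) : ℝ)) ^ 2) atTop
      (𝓝 0) := by
    have hle1 : ∀ᶠ n : ℕ in atTop, ‖1 / Real.log ((n : ℝ) * (p n : ℝ)) ^ (1 / 2 : ℝ)‖ ≤ 1 := by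
      filter_upwards [eventually_ge_atTop 3] with n hn
      have hn3 : (3 : ℝ) ≤ n := by exact_mod_cast hn
      have hpn : (1 : ℝ) ≤ p n := by exact_mod_cast hp n
      have hlog : 1 ≤ Real.log ((n : ℝ) * (p n : ℝ)) := by
        rw [Real.le_log_iff_exp_le (by positivity)]
        nlinarith [Real.exp_one_lt_d9]
      have h1 : 1 ≤ Real.log ((n : ℝ) * (p n : ℝ)) ^ (1 / 2 : ℝ) :=
        Real.one_le_rpow hlog (by norm_num)
      rw [Real.norm_eq_abs, abs_of_nonneg (by positivity), div_le_one (by positivity)]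
      exact h1
    have hQ : Tendsto (fun n : ℕ => opOneNorm (A n) ^ 2 *
        max (d n) ((n : ℝ) ^ (-(1 / 3 - δ₀))) * (maxColumnSupport (A n) : ℝ)) atTop (𝓝 0) := by
      rw [← isLittleO_one_iff ℝ]
      refine h.trans_isBigO (IsBigO.of_bound 1 ?_)
      filter_upwards [hle1] with n hn
      simpa using hn
    refine squeeze_zero' (Eventually.of_forall fun n => sq_nonneg _) ?_ hQ
    filter_upwards [hA, eventually_ge_atTop 1] with n hn hn1
    have hn1' : (1 : ℝ) ≤ n := by exact_mod_cast hn1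
    have hm : (1 : ℝ) ≤ maxColumnSupport (A n) := by exact_mod_cast one_le_maxColumnSupport hn
    -- Only the second entry of the maximum matters here: `n^(-1/3) ≤ n^(-(1/3 - δ₀))`.
    have hr : ((n : ℝ) ^ (-(1 / 6) : ℝ)) ^ 2 ≤ max (d n) ((n : ℝ) ^ (-(1 / 3 - δ₀))) := by
      refine le_trans ?_ (le_max_right _ _)
      rw [← Real.rpow_natCast, ← Real.rpow_mul (by positivity)]
      refine Real.rpow_le_rpow_of_exponent_le hn1' ?_
      push_cast; linarith
    rw [mul_pow]
    have h2 : opOneNorm (A n) ^ 2 * ((n : ℝ) ^ (-(1 / 6) : ℝ)) ^ 2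
        ≤ opOneNorm (A n) ^ 2 * max (d n) ((n : ℝ) ^ (-(1 / 3 - δ₀))) :=
      mul_le_mul_of_nonneg_left hr (sq_nonneg _)
    exact h2.trans (le_mul_of_one_le_right ((by positivity : (0 : ℝ) ≤ _).trans h2) hm)
  rw [tendsto_zero_iff_abs_tendsto_zero]
  have := hsq.sqrt
  simpa [Real.sqrt_sq_eq_abs, Function.comp_def] using this

theorem tendsto_log_mul_rpow :
    Tendsto (fun n : ℕ => (1 + Real.log n) * (n : ℝ) ^ (-(1 / 4) : ℝ)) atTop (𝓝 0) := by
  have h1 : Tendsto (fun n : ℕ => (n : ℝ) ^ (-(1 / 4) : ℝ)) atTop (𝓝 0) :=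
    (tendsto_rpow_neg_atTop (by norm_num : (0 : ℝ) < 1 / 4)).comp tendsto_natCast_atTop_atTop
  have h2 : Tendsto (fun n : ℕ => Real.log n / (n : ℝ) ^ (1 / 4 : ℝ)) atTop (𝓝 0) :=
    (isLittleO_log_rpow_atTop (by norm_num : (0 : ℝ) < 1 / 4)).tendsto_div_nhds_zero.comp
      tendsto_natCast_atTop_atTop
  have h3 := h1.add h2
  rw [add_zero] at h3
  refine h3.congr fun n => ?_
  rw [Real.rpow_neg (Nat.cast_nonneg n), add_mul, one_mul, div_eq_mul_inv (Real.log n)]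

/-- The exponent `1 / 6` is exactly what Lyapunov's condition asks for: its cube is `√n`. -/
theorem tendsto_pow_three_div_sqrt {κ : ℕ → ℝ}
    (hκ : Tendsto (fun n : ℕ => κ n * (n : ℝ) ^ (-(1 / 6) : ℝ)) atTop (𝓝 0)) :
    Tendsto (fun n : ℕ => (√(n : ℝ))⁻¹ * κ n ^ 3) atTop (𝓝 0) := by
  have h := hκ.pow 3
  rw [zero_pow three_ne_zero] at h
  refine h.congr fun n => ?_
  rw [mul_pow, ← Real.rpow_natCast (_ ^ (_ : ℝ)), ← Real.rpow_mul (Nat.cast_nonneg n),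
    Real.sqrt_eq_rpow, ← Real.rpow_neg (Nat.cast_nonneg n), mul_comm]
  norm_num

/-- The exponents match as `1/12 - 1/2 = -1/6 - 1/4`: one part is absorbed by `κ`, and the other
leaves `n^(-1/4)` to beat the logarithm. -/
theorem tendsto_mul_pow_four_mul_log {κ h : ℕ → ℝ} (hκ0 : ∀ n, 0 ≤ κ n)
    (hκ : Tendsto (fun n : ℕ => κ n * (n : ℝ) ^ (-(1 / 6) : ℝ)) atTop (𝓝 0))
    (hh : ∀ᶠ n : ℕ in atTop, h n ^ 4 ≤ (n : ℝ) ^ (1 / 12 : ℝ)) :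
    Tendsto (fun n : ℕ => 42 * κ n * h n ^ 4 * (1 + Real.log n) * (√(n : ℝ))⁻¹) atTop (𝓝 0) := by
  have h1 := (hκ.mul tendsto_log_mul_rpow).const_mul 42
  rw [mul_zero, mul_zero] at h1
  refine squeeze_zero' ?_ ?_ h1
  · filter_upwards [eventually_ge_atTop 1] with n hn
    have : 0 ≤ Real.log n := Real.log_nonneg (by exact_mod_cast hn)
    have := hκ0 n
    have := Even.pow_nonneg (by decide : Even 4) (h n)
    positivity
  · filter_upwards [hh, eventually_ge_atTop 1] with n hn hn1
    have hn0 : (0 : ℝ) < n := by exact_mod_cast hn1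
    have hl : 0 ≤ Real.log n := Real.log_nonneg (by exact_mod_cast hn1)
    have hk := hκ0 n
    have e : (n : ℝ) ^ (1 / 12 : ℝ) * (√(n : ℝ))⁻¹
        = (n : ℝ) ^ (-(1 / 6) : ℝ) * (n : ℝ) ^ (-(1 / 4) : ℝ) := by
      rw [Real.sqrt_eq_rpow, ← Real.rpow_neg hn0.le, ← Real.rpow_add hn0, ← Real.rpow_add hn0]
      norm_num
    calc _ = 42 * κ n * (1 + Real.log n) * (√(n : ℝ))⁻¹ * h n ^ 4 := by ring
      _ ≤ 42 * κ n * (1 + Real.log n) * (√(n : ℝ))⁻¹ * (n : ℝ) ^ (1 / 12 : ℝ) :=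
          mul_le_mul_of_nonneg_left hn (by positivity)
      _ = 42 * κ n * (1 + Real.log n) * ((n : ℝ) ^ (1 / 12 : ℝ) * (√(n : ℝ))⁻¹) := by ring
      _ = _ := by rw [e]; ring

theorem eventually_exp_pow_four_le {b : ℕ → ℝ} (hb : b =o[atTop] fun n : ℕ => Real.log (n : ℝ))
    {K : ℝ} (hK : 0 < K) :
    ∀ᶠ n : ℕ in atTop, Real.exp (b n * K) ^ 4 ≤ (n : ℝ) ^ (1 / 12 : ℝ) := by
  -- The constant is chosen so that `4 K b_n ≤ (log n) / 12`.
  have h := hb.def (c := 1 / (48 * K)) (by positivity)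
  filter_upwards [h, eventually_ge_atTop 1] with n hn hn1
  have hn0 : (0 : ℝ) < n := by exact_mod_cast hn1
  have hl : 0 ≤ Real.log n := Real.log_nonneg (by exact_mod_cast hn1)
  rw [← Real.exp_nat_mul, Real.rpow_def_of_pos hn0, Real.exp_le_exp]
  rw [Real.norm_eq_abs, Real.norm_eq_abs, abs_of_nonneg hl] at hn
  have h1 : b n * K ≤ 1 / (48 * K) * Real.log n * K :=
    mul_le_mul_of_nonneg_right ((le_abs_self _).trans hn) hK.le
  have h2 : 1 / (48 * K) * Real.log n * K = Real.log n / 48 := by field_simp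
  push_cast
  linarith

/-! ### The influence function of the score -/

namespace SurvivalTriple

variable {Ω : Type*} [MeasurableSpace Ω] {p : ℕ} {X : SurvivalTriple Ω p} {P : Measure Ω}
  [IsProbabilityMeasure P] {haz : ℝ → ℝ≥0} {β : Fin p → ℝ} {K L : ℝ}

variable (X P) in
/-- The influence function of the linear combination `a` of the coordinates of the score. -/
noncomputable def influence (haz : ℝ → ℝ≥0) (K : ℝ) (β a : Fin p → ℝ) : Ω → ℝ :=
  compensatedIntegral X.T {ω | X.failure ω ≤ X.censoring ω} (X.path P) (X.openTimeSet P)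
    (fun s e => haz s * (X.relRisk P K β s e).toNNReal)
    (IsRiskModel.centredIntegrand P X.T (X.path P) (X.relRisk P K β) (X.linComb P K a))

/-- The score, expressed through the measurable version of the covariate process. -/
theorem sqrt_mul_score_ae_eq (hdens : X.HasBoundedDensity P) (hbdd : X.IsBoundedCovariate P K)
    (hlip : X.IsLipschitzCovariate P L) {Ω' : Type*} [MeasurableSpace Ω'] {P' : Measure Ω'}
    {n : ℕ} {ξ : Fin n → Ω' → Ω} (hξ : ∀ i, MeasurePreserving (ξ i) P' P) (a : Fin p → ℝ) :
    (fun ω => (n : ℝ) ^ (1 / 2 : ℝ) * (a ⬝ᵥ X.score P (fun i => ξ i ω) β)) =ᵐ[P'] fun ω =>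
      normalizedScore X.T {ω | X.failure ω ≤ X.censoring ω}
        (fun s x => X.relRisk P K β s (X.path P x)) (fun s x => X.linComb P K a s (X.path P x))
        (fun i => ξ i ω) := by
  have h1 : ∀ᵐ ω ∂P', ∀ i, X.T (ξ i ω) ∈ X.openTimeSet P :=
    ae_all_iff.2 fun i => (hξ i).quasiMeasurePreserving.ae (ae_T_mem_openTimeSet hdens)
  have h2 : ∀ᵐ ω ∂P', ∀ i, ∀ s ∈ X.timeSet P,
      X.covariateVersion P K s (X.path P (ξ i ω)) = X.Z s (ξ i ω) :=
    ae_all_iff.2 fun i =>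
      (hξ i).quasiMeasurePreserving.ae (X.covariateVersion_path_ae_eq P hbdd hlip)
  filter_upwards [h1, h2] with ω hω1 hω2
  exact sqrt_mul_dotProduct_score (fun i => openTimeSet_subset (hω1 i)) hω2 a β

theorem aemeasurable_sqrt_mul_score (hK : 0 ≤ K) (hdens : X.HasBoundedDensity P)
    (hbdd : X.IsBoundedCovariate P K) (hlip : X.IsLipschitzCovariate P L) {Ω' : Type*}
    [MeasurableSpace Ω'] {P' : Measure Ω'} {n : ℕ} {ξ : Fin n → Ω' → Ω}
    (hξ : ∀ i, MeasurePreserving (ξ i) P' P) (a : Fin p → ℝ) :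
    AEMeasurable (fun ω => (n : ℝ) ^ (1 / 2 : ℝ) * (a ⬝ᵥ X.score P (fun i => ξ i ω) β)) P' := by
  have R := isRiskModel (β := β) hK hdens a (κ := l1Norm a * K + 1)
    (by have := mul_nonneg (l1Norm_nonneg a) hK; linarith) (by linarith)
  refine AEMeasurable.congr ?_ (sqrt_mul_score_ae_eq (K := K) hdens hbdd hlip hξ a).symm
  exact ((R.measurable_normalizedScore n).comp
    (measurable_pi_lambda _ fun i => (hξ i).measurable)).aemeasurable

variable (hCox : X.IsCoxModel P haz β) (hK : 0 ≤ K) (hdens : X.HasBoundedDensity P)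
  (hbdd : X.IsBoundedCovariate P K) (hlip : X.IsLipschitzCovariate P L) (a : Fin p → ℝ)
include hCox hK hdens hbdd hlip

/-- The general error bound with `κ = ‖a‖₁ K + 1`; the added `1` keeps `κ` positive when `a`
vanishes. -/
theorem lintegral_sqrt_mul_score_sub_le {Ω' : Type*} [MeasurableSpace Ω'] {P' : Measure Ω'}
    [IsProbabilityMeasure P'] {n : ℕ} {ξ : Fin n → Ω' → Ω}
    (hξ : ∀ i, MeasurePreserving (ξ i) P' P) (hind : iIndepFun ξ P') (hn : 0 < n) :
    ∫⁻ ω, ENNReal.ofReal |(n : ℝ) ^ (1 / 2 : ℝ) * (a ⬝ᵥ X.score P (fun i => ξ i ω) β)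
      - (√(n : ℝ))⁻¹ * ∑ i, X.influence P haz K β a (ξ i ω)| ∂P'
      ≤ ENNReal.ofReal (42 * (l1Norm a * K + 1) * Real.exp (l1Norm β * K) ^ 4 *
        (1 + Real.log n) * (√(n : ℝ))⁻¹) := by
  have hκ : 0 < l1Norm a * K + 1 := by have := mul_nonneg (l1Norm_nonneg a) hK; linarith
  have R := isRiskModel (β := β) hK hdens a hκ (by linarith)
  have H := hCox.hasHazard hK hdens hbdd hlip
  refine le_trans (le_of_eq (lintegral_congr_ae ?_))
    (R.lintegral_abs_normalizedScore_sub_compensated_le H hξ hind hn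
      (X.measurable_linComb P K a) fun s e => (X.abs_linComb_le P hK a s e).trans (by linarith))
  filter_upwards [sqrt_mul_score_ae_eq (K := K) (β := β) hdens hbdd hlip hξ a] with ω hω
  rw [hω]
  rfl

theorem measurable_influence : Measurable (X.influence P haz K β a) := by
  have R := isRiskModel (β := β) hK hdens a (κ := l1Norm a * K + 1)
    (by have := mul_nonneg (l1Norm_nonneg a) hK; linarith) (by linarith)
  exact (hCox.hasHazard hK hdens hbdd hlip).measurable_compensatedIntegral
    (R.measurable_centredIntegrand (X.measurable_linComb P K a))

theorem integral_influence : ∫ x, X.influence P haz K β a x ∂P = 0 := by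
  have R := isRiskModel (β := β) hK hdens a (κ := l1Norm a * K + 1)
    (by have := mul_nonneg (l1Norm_nonneg a) hK; linarith) (by linarith)
  exact (hCox.hasHazard hK hdens hbdd hlip).integral_compensatedIntegral
    (R.measurable_centredIntegrand (X.measurable_linComb P K a))
    (R.abs_centredIntegrand_le fun s e => (X.abs_linComb_le P hK a s e).trans (by linarith))

/-- The variance of the compensated integral is the mean of the squared integrand over events, and
that is the quadratic form of the information matrix. -/
theorem integral_influence_sq :
    ∫ x, X.influence P haz K β a x ^ 2 ∂P = a ⬝ᵥ (X.informationMatrix P β *ᵥ a) := by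
  have R := isRiskModel (β := β) hK hdens a (κ := l1Norm a * K + 1)
    (by have := mul_nonneg (l1Norm_nonneg a) hK; linarith) (by linarith)
  rw [dotProduct_informationMatrix_mulVec hK hdens hbdd hlip]
  refine ((hCox.hasHazard hK hdens hbdd hlip).integral_sq_compensatedIntegral
    (R.measurable_centredIntegrand (X.measurable_linComb P K a))
    (R.abs_centredIntegrand_le fun s e =>
      (X.abs_linComb_le P hK a s e).trans (by linarith))).trans ?_
  refine integral_congr_ae (ae_of_all _ fun ω => ?_)
  simp only [eventResidual, Set.indicator]
  split_ifs <;> simp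

theorem integral_abs_influence_pow_three_le :
    Integrable (fun x => |X.influence P haz K β a x| ^ 3) P ∧
      ∫ x, |X.influence P haz K β a x| ^ 3 ∂P ≤ 28 * (2 * (l1Norm a * K + 1)) ^ 3 := by
  have hκ : 0 < l1Norm a * K + 1 := by have := mul_nonneg (l1Norm_nonneg a) hK; linarith
  have R := isRiskModel (β := β) hK hdens a hκ (by linarith)
  exact (hCox.hasHazard hK hdens hbdd hlip).integral_abs_pow_three_le
    (R.measurable_centredIntegrand (X.measurable_linComb P K a))
    (R.abs_centredIntegrand_le fun s e => (X.abs_linComb_le P hK a s e).trans (by linarith))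
    (by positivity)

end SurvivalTriple

/-! ### Proof of asymptotic normality -/

theorem proposition1
    {Ω : ℕ → Type*} [∀ n, MeasurableSpace (Ω n)]
    (P : ∀ n, Measure (Ω n)) [∀ n, IsProbabilityMeasure (P n)]
    (p : ℕ → ℕ) (X : ∀ n, SurvivalTriple (Ω n) (p n))
    (haz : ℕ → ℝ → ℝ≥0) (β : ∀ n, Fin (p n) → ℝ)
    (hCox : ∀ n, (X n).IsCoxModel (P n) (haz n) (β n))
    {Ω' : ℕ → Type*} [∀ n, MeasurableSpace (Ω' n)]
    (P' : ∀ n, Measure (Ω' n)) [∀ n, IsProbabilityMeasure (P' n)]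
    (ξ : ∀ n, Fin n → Ω' n → Ω n)
    (hξ_law : ∀ n i, MeasurePreserving (ξ n i) (P' n) (P n))
    (hξ_indep : ∀ n, iIndepFun (ξ n) (P' n))
    (hpred : ∀ n, (X n).IsPredictableCovariate (P n))
    (K : ℝ) (hK : 0 < K) (hbdd : ∀ n, (X n).IsBoundedCovariate (P n) K)
    (hlip : ∀ n, ∃ L : ℝ, 0 < L ∧ (X n).IsLipschitzCovariate (P n) L)
    (hdens : ∀ n, (X n).HasBoundedDensity (P n))
    (hmoment : ∀ n, (X n).HasSomeMoment (P n))
    (hp : ∀ a : ℝ, 0 < a →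
      (fun n : ℕ => (p n : ℝ)) =o[atTop] fun n : ℕ => Real.exp ((n : ℝ) ^ a))
    (hsparse : ∃ δ₀ : ℝ, 0 < δ₀ ∧
      (fun n : ℕ =>
        opOneNorm ((X n).informationMatrix (P n) (β n))⁻¹ ^ 2 *
          max ((supportSize (β n) : ℝ) * Real.log ((n : ℝ) * (p n : ℝ)) / (n : ℝ) ^ (1 / 2 : ℝ))
            ((n : ℝ) ^ (-(1 / 3 - δ₀))) *
          (maxColumnSupport ((X n).informationMatrix (P n) (β n))⁻¹ : ℝ))
        =o[atTop] fun n : ℕ => 1 / Real.log ((n : ℝ) * (p n : ℝ)) ^ (1 / 2 : ℝ))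
    (hβ : (fun n : ℕ => l1Norm (β n)) =o[atTop] fun n : ℕ => Real.log (n : ℝ))
    (c : ∀ n, Fin (p n) → ℝ) (hc : ∀ n, l1Norm (c n) = 1)
    (ν : ℝ) (hν : 0 < ν)
    (hlim : Tendsto (fun n => c n ⬝ᵥ (((X n).informationMatrix (P n) (β n))⁻¹ *ᵥ c n))
      atTop (𝓝 (ν ^ 2))) :
    TendstoInDistribution
      (fun (n : ℕ) (ω : Ω' n) => (n : ℝ) ^ (1 / 2 : ℝ) *
        (c n ⬝ᵥ (((X n).informationMatrix (P n) (β n))⁻¹ *ᵥ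
          (X n).score (P n) (fun i => ξ n i ω) (β n))))
      atTop (id : ℝ → ℝ) P' (gaussianReal 0 (ν ^ 2).toNNReal) := by
  obtain ⟨δ₀, hδ, hsp⟩ := hsparse
  choose L hL using hlip
  let M : ∀ n, Matrix (Fin (p n)) (Fin (p n)) ℝ := fun n => (X n).informationMatrix (P n) (β n)
  -- By symmetry of the information matrix the statistic is the linear combination of the score with
  -- coefficients `a n`.
  let a : ∀ n, Fin (p n) → ℝ := fun n => (M n)⁻¹ *ᵥ c n
  have hdual : ∀ n (v : Fin (p n) → ℝ),
      c n ⬝ᵥ (((X n).informationMatrix (P n) (β n))⁻¹ *ᵥ v) = a n ⬝ᵥ v := fun n v => by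
    rw [Matrix.dotProduct_mulVec, ← Matrix.mulVec_transpose, Matrix.transpose_nonsing_inv,
      SurvivalTriple.informationMatrix_transpose]
  have hpos : ∀ᶠ n in atTop, 0 < c n ⬝ᵥ ((M n)⁻¹ *ᵥ c n) := hlim.eventually_const_lt (by positivity)
  -- Invertibility comes from the positive limit: a singular matrix has inverse `0` by convention,
  -- and the quadratic form would vanish.
  have hinv : ∀ᶠ n in atTop, (M n)⁻¹ ≠ 0 := by
    filter_upwards [hpos] with n hn h0
    simp [h0] at hn
  have hp1 : ∀ n, 1 ≤ p n := fun n => by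
    by_contra hcon
    have h0 : p n = 0 := by omega
    have : IsEmpty (Fin (p n)) := by rw [h0]; infer_instance
    have := hc n
    simp [l1Norm] at this
  have hop := tendsto_opOneNorm_mul_rpow hp1 hinv hδ hsp
  set κ : ℕ → ℝ := fun n => l1Norm (a n) * K + 1 with hκ
  have hκ0 : ∀ n, 0 ≤ κ n := fun n => by
    have := mul_nonneg (l1Norm_nonneg (a n)) hK.le
    simp only [hκ]; linarith
  have hκlim : Tendsto (fun n : ℕ => κ n * (n : ℝ) ^ (-(1 / 6) : ℝ)) atTop (𝓝 0) := by
    have h1 : Tendsto (fun n : ℕ => (n : ℝ) ^ (-(1 / 6) : ℝ)) atTop (𝓝 0) :=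
      (tendsto_rpow_neg_atTop (by norm_num : (0 : ℝ) < 1 / 6)).comp tendsto_natCast_atTop_atTop
    have h2 := (hop.mul_const K).add h1
    rw [zero_mul, zero_add] at h2
    refine squeeze_zero (fun n => mul_nonneg (hκ0 n) (by positivity)) (fun n => ?_) h2
    have h3 := l1Norm_mulVec_le_opOneNorm (M n)⁻¹ (hc n)
    have h4 : (0 : ℝ) ≤ (n : ℝ) ^ (-(1 / 6) : ℝ) := by positivity
    have h5 := mul_le_mul_of_nonneg_right (mul_le_mul_of_nonneg_right h3 h4) hK.le
    simp only [hκ, a]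
    linarith
  simp_rw [hdual]
  refine tendstoInDistribution_of_close_to_iid_row_sum hξ_law hξ_indep
    (ψ := fun n => (X n).influence (P n) (haz n) K (β n) (a n))
    (fun n => SurvivalTriple.aemeasurable_sqrt_mul_score hK.le (hdens n) (hbdd n) (hL n).2
      (hξ_law n) (a n))
    (Eventually.of_forall fun n => SurvivalTriple.measurable_influence (hCox n) hK.le (hdens n)
      (hbdd n) (hL n).2 (a n))
    (Eventually.of_forall fun n => SurvivalTriple.integral_influence (hCox n) hK.le (hdens n)
      (hbdd n) (hL n).2 (a n))
    ?_
    (Eventually.of_forall fun n => (SurvivalTriple.integral_abs_influence_pow_three_le (hCox n)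
      hK.le (hdens n) (hbdd n) (hL n).2 (a n)).1)
    ?_ ?_
  · refine hlim.congr' ?_
    filter_upwards [hinv] with n hn
    have hdet : IsUnit (M n).det := by
      by_contra hcon
      exact hn (Matrix.nonsing_inv_apply_not_isUnit _ hcon)
    rw [SurvivalTriple.integral_influence_sq (hCox n) hK.le (hdens n) (hbdd n) (hL n).2, hdual]
    change _ = a n ⬝ᵥ (M n *ᵥ ((M n)⁻¹ *ᵥ c n))
    rw [Matrix.mulVec_mulVec, Matrix.mul_nonsing_inv _ hdet, Matrix.one_mulVec]
  -- Here `224 = 28 · 2³`, as the integrand is bounded by `2κ`.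
  · have h1 := (tendsto_pow_three_div_sqrt hκlim).const_mul 224
    rw [mul_zero] at h1
    refine squeeze_zero (fun n => mul_nonneg (inv_nonneg.2 (Real.sqrt_nonneg _))
      (integral_nonneg fun x => by positivity)) (fun n => ?_) h1
    have h2 := (SurvivalTriple.integral_abs_influence_pow_three_le (hCox n) hK.le (hdens n)
      (hbdd n) (hL n).2 (a n)).2
    refine (mul_le_mul_of_nonneg_left h2 (inv_nonneg.2 (Real.sqrt_nonneg _))).trans
      (le_of_eq ?_)
    simp only [hκ]; ring
  · have h1 := ENNReal.tendsto_ofReal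
      (tendsto_mul_pow_four_mul_log hκ0 hκlim (eventually_exp_pow_four_le hβ hK))
    rw [ENNReal.ofReal_zero] at h1
    refine tendsto_of_tendsto_of_tendsto_of_le_of_le' tendsto_const_nhds h1
      (Eventually.of_forall fun n => bot_le) ?_
    filter_upwards [eventually_gt_atTop 0] with n hn
    exact SurvivalTriple.lintegral_sqrt_mul_score_sub_le (hCox n) hK.le (hdens n) (hbdd n)
      (hL n).2 (a n) (hξ_law n) (hξ_indep n) hn
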